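/- **Causality principle.** Let $\mathcal E_1:[0,\infty)\to\mathbb C$ be locally integrable, not a.e. zero, with $\int_0^\infty(1+t)|\mathcal E_1(t)|\,dt<\infty$. For $\Im k\ge 0$ let $\varphi(t;k)\in\mathbb C^2$ be the (unique) absolutely continuous solution on $[0,\infty)$ of $$\varphi_t=-\Big(ik\sigma_3+\tfrac12\begin{pmatrix}0&\mathcal E_1\\-\overline{\mathcal E_1}&0\end{pmatrix}\Big)\varphi,\qquad \lim_{t\to\infty}\varphi(t;k)e^{-ikt}=\binom01,\qquad \sigma_3=\begin{pmatrix}1&0\\0&-1\end{pmatrix},$$ and put $\binom{b(k)}{a(k)}=\varphi(0;k)$, $r=b/a$. Write $f^*(k)=\overline{f(\bar k)}$, $\theta=\theta(t,x;k)=kt-\big(k+\frac1{4k}\big)x$, $\Omega_\pm=\{\pm\Im k>0,|k|>\frac12\}$, $D_\pm=\{\pm\Im k>0,|k|<\frac12\}$, and let $\Sigma$ be the union of $\mathbb R$ and the circle $|k|=\frac12$, with $\mathbb R$ and both open semicircles $C_u$ (upper), $C_d$ (lower) oriented from left to right; the $+$ side is on the left. Assume that $a(k)\ne0$ for real $|k|\ge\frac12$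 and $b(k)\neq0$ for real $|k|\le\frac12$ (so that the jump matrices below are finite on the real line and bounded near $0,\pm\frac12$). *RH problem.* Let $Z_a$ be the set of zeros of $a$ in $\Omega_+\cup C_u$ and $Z_b$ the set of zeros of $b$ in $D_+\cup C_u$. For $z\in Z_a$ let $p_z(k)$ be the principal part at $z$ of the Laurent expansion of $b/a$; for $z\in Z_b$ let $q_z(k)$ be that of $a/b$. Find a $2\times2$ matrix $M(t,x;k)$ such that: 1. $M$ is analytic in $k$ off $\Sigma$, $Z_a$, $Z_b$ and their complex conjugates, and extends continuously from each of $\Omega_\pm,D_\pm$ to its boundary, except at $0,\pm\frac12$, and at the points of $Z_a\cap C_u$ (for $\Omega_+$), $Z_b\cap C_u$ (for $D_+$) and their conjugates (for $\Omega_-$, $D_-$); 2. for $z\in Z_a$: $M\begin{pmatrix}1&-p_z e^{-2i\theta}\\0&1\end{pmatrix}=O(1)$ as $k\to z$ in $\Omega_+$ and $M\begin{pmatrix}1&0\\p_z^*e^{2i\theta}&1\end{pmatrix}=O(1)$ as $k\to\bar z$ in $\Omega_-$; 3. for $z\in Z_b$: $M\begin{pmatrix}1&0\\-q_ze^{2i\theta}&1\end{pmatrix}=O(1)$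 as $k\to z$ in $D_+$ and $M\begin{pmatrix}1&q_z^*e^{-2i\theta}\\0&1\end{pmatrix}=O(1)$ as $k\to\bar z$ in $D_-$; 4. $M_-=M_+J$ on $\Sigma\setminus\{0,\pm\frac12\}$ (excluding the zeros of $a,b$ on $C_u$ and their conjugates on $C_d$), where $J$ equals $$\begin{pmatrix}1+|r|^2&-re^{-2i\theta}\\-r^*e^{2i\theta}&1\end{pmatrix},\ \begin{pmatrix}1&-(r^*)^{-1}e^{-2i\theta}\\-r^{-1}e^{2i\theta}&1+|r|^{-2}\end{pmatrix},\ \begin{pmatrix}0&-re^{-2i\theta}\\r^{-1}e^{2i\theta}&1\end{pmatrix},\ \begin{pmatrix}0&(r^*)^{-1}e^{-2i\theta}\\-r^*e^{2i\theta}&1\end{pmatrix}$$ for real $|k|>\frac12$, for real $0<|k|<\frac12$, on $C_u$, and on $C_d$, respectively; 5. $M$ is bounded near $0,\pm\frac12$; 6. $M=I+O(k^{-1})$ as $k\to\infty$. *Claim.* Let $x>0$ and $0\le t\le x$. If $r(k)=O(k^{-1})$ as $k\to\infty$ in $\Im k\ge0$, the RH problem has a solution. Every solution is trivial up to an explicit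 triangular factor, and hence the solution is unique: off $\Sigma$ and the poles, $M(t,x;k)\,G(t,x;k)\equiv I$, where $$G=\begin{pmatrix}1&-re^{-2i\theta}\\0&1\end{pmatrix},\ \begin{pmatrix}1&0\\r^*e^{2i\theta}&1\end{pmatrix},\ \begin{pmatrix}1&0\\-r^{-1}e^{2i\theta}&1\end{pmatrix},\ \begin{pmatrix}1&(r^*)^{-1}e^{-2i\theta}\\0&1\end{pmatrix}$$ in $\Omega_+,\Omega_-,D_+,D_-$, respectively. Consequently, for every solution $M$: - $M(t,x;+i0)=I$, so that the functions $\mathcal N,\rho$ defined by $\begin{pmatrix}\mathcal N&\rho\\\bar\rho&-\mathcal N\end{pmatrix}=M(t,x;+i0)\,\sigma_3\,M(t,x;+i0)^{-1}$ are $\mathcal N(t,x)=1$, $\rho(t,x)=0$; - $\mathcal E(t,x):=-\lim_{k\to\infty}4ikM_{12}(t,x;k)=0$ for $t<x$, the limit being taken in every set $|\Im k|\ge c|k|$, $c>0$. The same holds also on the light cone $t=x$ if $k\,r(k)\to0$ as $k\to\infty$ in every set $\Im k\ge c|k|$, $c>0$; and if $k\,r(k)\to0$ as $k\to\infty$ without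 restriction in $\Im k\ge0$, then for all $t\le x$ the limit is $0$ as $k\to\infty$ without restriction (off $\Sigma$). -/

import Mathlib

open Filter Topology MeasureTheory Set Asymptotics

noncomputable section

namespace MaxwellBloch

/-- The Schwarz reflection `f^*(k) = conj (f (conj k))`. -/
def schwarz (f : ℂ → ℂ) (k : ℂ) : ℂ := starRingEnd ℂ (f (starRingEnd ℂ k))

/-! ### Spectral functions of the boundary pulse -/

def sigma3 : Matrix (Fin 2) (Fin 2) ℂ := !![1, 0; 0, -1]

/-- The matrix `H` of the Lax pair, for the field value `e`. -/
def laxH (e : ℂ) : Matrix (Fin 2) (Fin 2) ℂ :=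
  (1 / 2 : ℂ) • !![0, e; -starRingEnd ℂ e, 0]

/-- The matrix `U = -(i k σ₃ + H)` of the `t`-equation, for the field value `e`. -/
def laxU (e k : ℂ) : Matrix (Fin 2) (Fin 2) ℂ := -((Complex.I * k) • sigma3 + laxH e)

/-- `φ` is the second column of the Jost solution `Φ(t; k)` of the `t`-equation at `x = 0`:
an absolutely continuous solution of `φ' = U φ` on `[0, ∞)` with
`φ(t) e^{-i k t} → (0, 1)` as `t → ∞`. For `Im k ≥ 0` and an integrable pulse
there is exactly one such `φ` on `[0, ∞)`. -/
structure IsJostColumn (E₁ : ℝ → ℂ) (k : ℂ) (φ : ℝ → Fin 2 → ℂ) : Prop where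
  continuousOn : ContinuousOn φ (Ici 0)
  equation : ∀ t : ℝ, 0 ≤ t → φ t = φ 0 + ∫ s in (0 : ℝ)..t, (laxU (E₁ s) k).mulVec (φ s)
  normalization : Tendsto (fun t : ℝ => Complex.exp (-(Complex.I * k * t)) • φ t) atTop
    (𝓝 ![0, 1])

open Classical in
/-- The value at `t = 0` of the second Jost column, `(B(k), A(k))`; used for `Im k ≥ 0`. -/
def jostAtZero (E₁ : ℝ → ℂ) (k : ℂ) : Fin 2 → ℂ :=
  if h : ∃ φ, IsJostColumn E₁ k φ then h.choose 0 else 0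

/-- The spectral function `a = A` (on the closed upper half-plane). -/
def specA (E₁ : ℝ → ℂ) (k : ℂ) : ℂ := jostAtZero E₁ k 1

/-- The spectral function `b = B` (on the closed upper half-plane). -/
def specB (E₁ : ℝ → ℂ) (k : ℂ) : ℂ := jostAtZero E₁ k 0

/-- The reflection coefficient `r = b / a`. -/
def refl (a b : ℂ → ℂ) (k : ℂ) : ℂ := b k / a k

/-! ### Contour, domains, phase -/

def OmegaP : Set ℂ := {k | 0 < k.im ∧ 1 / 2 < ‖k‖}
def OmegaM : Set ℂ := {k | k.im < 0 ∧ 1 / 2 < ‖k‖}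
def DP : Set ℂ := {k | 0 < k.im ∧ ‖k‖ < 1 / 2}
def DM : Set ℂ := {k | k.im < 0 ∧ ‖k‖ < 1 / 2}

/-- The contour: the real axis and the circle of radius `1/2`. -/
def contour : Set ℂ := {k | k.im = 0 ∨ ‖k‖ = 1 / 2}

/-- The phase `θ(t, x; k) = k t - (k + 1/(4k)) x`. -/
def theta (t x : ℝ) (k : ℂ) : ℂ := k * t - (k + 1 / (4 * k)) * x

/-- `e^{2 i θ}`. -/
def ePlus (t x : ℝ) (k : ℂ) : ℂ := Complex.exp (2 * Complex.I * theta t x k)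
/-- `e^{-2 i θ}`. -/
def eMinus (t x : ℝ) (k : ℂ) : ℂ := Complex.exp (-(2 * Complex.I * theta t x k))

/-! ### Pole data -/

/-- Zeros of `a` in `Ω₊`, including those on the open upper semicircle. -/
def zerosA (a : ℂ → ℂ) : Set ℂ := {k | 0 < k.im ∧ 1 / 2 ≤ ‖k‖ ∧ a k = 0}
/-- Zeros of `b` in `D₊`, including those on the open upper semicircle. -/
def zerosB (b : ℂ → ℂ) : Set ℂ := {k | 0 < k.im ∧ ‖k‖ ≤ 1 / 2 ∧ b k = 0}

/-- `T_q`: the coefficient of `(k - z)^{-q}` in the Laurent expansion of `1 / f` at a zero `z`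
of order `n` of `f`. Writing `f = (k - z)^n g`, the function `g` is the `n`-fold divided
difference of `f` at `z`, and `T_q` is the Taylor coefficient of `1 / g` of degree `n - q`. -/
def laurentT (f : ℂ → ℂ) (z : ℂ) (q : ℕ) : ℂ :=
  iteratedDeriv (analyticOrderNatAt f z - q)
    (fun k => (((Function.swap dslope z)^[analyticOrderNatAt f z]) f k)⁻¹) z /
      (Nat.factorial (analyticOrderNatAt f z - q) : ℂ)

/-- `A_p = ∑_{q=0}^{n-p} T_{q+p} μ_q / q!` with `μ_q = g^{(q)}(z)`. -/
def poleCoeff (f g : ℂ → ℂ) (z : ℂ) (p : ℕ) : ℂ :=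
  ∑ q ∈ Finset.range (analyticOrderNatAt f z - p + 1),
    laurentT f z (q + p) * iteratedDeriv q g z / (Nat.factorial q : ℂ)

/-- `∑_{q=1}^{n} A_q / (k - z)^q`. -/
def polarSum (f g : ℂ → ℂ) (z k : ℂ) : ℂ :=
  ∑ q ∈ Finset.Icc 1 (analyticOrderNatAt f z), poleCoeff f g z q / (k - z) ^ q

/-- The points off the contour and off the poles. -/
def regularSet (a b : ℂ → ℂ) : Set ℂ :=
  {k | k ∉ contour ∧ k ∉ zerosA a ∧ starRingEnd ℂ k ∉ zerosA a ∧
    k ∉ zerosB b ∧ starRingEnd ℂ k ∉ zerosB b}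

/-! ### The Riemann–Hilbert problem -/

/-- `M` is bounded, entry by entry, along the filter `l`. -/
def BoundedAlong (M : ℂ → Matrix (Fin 2) (Fin 2) ℂ) (l : Filter ℂ) : Prop :=
  ∀ i j, (fun k => M k i j) =O[l] (fun _ => (1 : ℝ))

/-- `M` has a limit at every boundary point of `R` outside `S`, from inside `R`. -/
def ContinuousUpTo (M : ℂ → Matrix (Fin 2) (Fin 2) ℂ) (R S : Set ℂ) : Prop :=
  ∀ k ∈ frontier R \ S, ∃ L, Tendsto M (𝓝[R] k) (𝓝 L)

/-- `M₋ = M₊ J` at `k`, with boundary values from `P` (plus side) and `N` (minus side). -/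
def HasJump (M : ℂ → Matrix (Fin 2) (Fin 2) ℂ) (P N : Set ℂ) (k : ℂ)
    (J : Matrix (Fin 2) (Fin 2) ℂ) : Prop :=
  ∃ Mp Mm, Tendsto M (𝓝[P] k) (𝓝 Mp) ∧ Tendsto M (𝓝[N] k) (𝓝 Mm) ∧ Mm = Mp * J

/-- Jump matrix on the real axis, `|k| > 1/2`. -/
def jumpOuter (r : ℂ → ℂ) (t x : ℝ) (k : ℂ) : Matrix (Fin 2) (Fin 2) ℂ :=
  !![1 + (‖r k‖ : ℂ) ^ 2, -(r k * eMinus t x k); -(schwarz r k * ePlus t x k), 1]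

/-- Jump matrix on the real axis, `0 < |k| < 1/2`. -/
def jumpInner (r : ℂ → ℂ) (t x : ℝ) (k : ℂ) : Matrix (Fin 2) (Fin 2) ℂ :=
  !![1, -((schwarz r k)⁻¹ * eMinus t x k);
     -((r k)⁻¹ * ePlus t x k), 1 + ((‖r k‖ : ℂ) ^ 2)⁻¹]

/-- Jump matrix on the upper semicircle. -/
def jumpUp (r : ℂ → ℂ) (t x : ℝ) (k : ℂ) : Matrix (Fin 2) (Fin 2) ℂ :=
  !![0, -(r k * eMinus t x k); (r k)⁻¹ * ePlus t x k, 1]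

/-- Jump matrix on the lower semicircle. -/
def jumpDown (r : ℂ → ℂ) (t x : ℝ) (k : ℂ) : Matrix (Fin 2) (Fin 2) ℂ :=
  !![0, (schwarz r k)⁻¹ * eMinus t x k; -(schwarz r k * ePlus t x k), 1]

/-- `M = M(t, x; ·)` solves the Riemann–Hilbert problem with spectral functions `a`, `b`.
Only the values of `M` on `regularSet a b` are relevant. -/
structure IsRHSolution (a b : ℂ → ℂ) (t x : ℝ) (M : ℂ → Matrix (Fin 2) (Fin 2) ℂ) : Prop where
  analytic : ∀ i j, DifferentiableOn ℂ (fun k => M k i j) (regularSet a b)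
  cont_OmegaP : ContinuousUpTo M OmegaP ({-(1 / 2), 1 / 2} ∪ zerosA a)
  cont_OmegaM : ContinuousUpTo M OmegaM ({-(1 / 2), 1 / 2} ∪ starRingEnd ℂ ⁻¹' zerosA a)
  cont_DP : ContinuousUpTo M DP ({-(1 / 2), 0, 1 / 2} ∪ zerosB b)
  cont_DM : ContinuousUpTo M DM ({-(1 / 2), 0, 1 / 2} ∪ starRingEnd ℂ ⁻¹' zerosB b)
  pole_a : ∀ z ∈ zerosA a,
    BoundedAlong (fun k => M k * !![1, -(polarSum a b z k * eMinus t x k); 0, 1])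
      (𝓝[OmegaP \ {z}] z)
  pole_a_conj : ∀ z ∈ zerosA a,
    BoundedAlong (fun k => M k * !![1, 0; schwarz (polarSum a b z) k * ePlus t x k, 1])
      (𝓝[OmegaM \ {starRingEnd ℂ z}] (starRingEnd ℂ z))
  pole_b : ∀ z ∈ zerosB b,
    BoundedAlong (fun k => M k * !![1, 0; -(polarSum b a z k * ePlus t x k), 1])
      (𝓝[DP \ {z}] z)
  pole_b_conj : ∀ z ∈ zerosB b,
    BoundedAlong (fun k => M k * !![1, schwarz (polarSum b a z) k * eMinus t x k; 0, 1])
      (𝓝[DM \ {starRingEnd ℂ z}] (starRingEnd ℂ z))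
  jump_outer : ∀ s : ℝ, 1 / 2 < |s| →
    HasJump M OmegaP OmegaM s (jumpOuter (refl a b) t x s)
  jump_inner : ∀ s : ℝ, s ≠ 0 → |s| < 1 / 2 →
    HasJump M DP DM s (jumpInner (refl a b) t x s)
  jump_up : ∀ k : ℂ, 0 < k.im → ‖k‖ = 1 / 2 → a k ≠ 0 → b k ≠ 0 →
    HasJump M OmegaP DP k (jumpUp (refl a b) t x k)
  jump_down : ∀ k : ℂ, k.im < 0 → ‖k‖ = 1 / 2 → schwarz a k ≠ 0 → schwarz b k ≠ 0 →
    HasJump M DM OmegaM k (jumpDown (refl a b) t x k)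
  bounded : ∀ p ∈ ({-(1 / 2), 0, 1 / 2} : Set ℂ), BoundedAlong M (𝓝[regularSet a b] p)
  normalization : ∀ i j, (fun k => M k i j - (1 : Matrix (Fin 2) (Fin 2) ℂ) i j)
    =O[Bornology.cobounded ℂ ⊓ 𝓟 (regularSet a b)] (fun k => k⁻¹)

open Classical in
/-- The triangular factor that removes all jumps and poles of the problem. -/
def factorG (r : ℂ → ℂ) (t x : ℝ) (k : ℂ) : Matrix (Fin 2) (Fin 2) ℂ :=
  if k ∈ OmegaP then !![1, -(r k * eMinus t x k); 0, 1]
  else if k ∈ OmegaM then !![1, 0; schwarz r k * ePlus t x k, 1]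
  else if k ∈ DP then !![1, 0; -((r k)⁻¹ * ePlus t x k), 1]
  else if k ∈ DM then !![1, (schwarz r k)⁻¹ * eMinus t x k; 0, 1]
  else 1

/-! ### Reconstruction of the fields -/

/-- `f(k) → l` as `k → ∞` in `S`, within every sector that avoids the real directions. -/
def TendstoSector (f : ℂ → ℂ) (S : Set ℂ) (l : ℂ) : Prop :=
  ∀ c : ℝ, 0 < c →
    Tendsto f (Bornology.cobounded ℂ ⊓ 𝓟 (S ∩ {k | c * ‖k‖ ≤ |k.im|})) (𝓝 l)

/-- `e = - lim 4 i k M₁₂(k)`, `k → ∞` non-tangentially to the real axis. -/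
def HasField (M : ℂ → Matrix (Fin 2) (Fin 2) ℂ) (e : ℂ) : Prop :=
  TendstoSector (fun k => -(4 * Complex.I * k * M k 0 1)) univ e

/-- `e = - lim 4 i k M₁₂(k)`, `k → ∞` without any restriction (off the contour). -/
def HasFieldUnrestricted (M : ℂ → Matrix (Fin 2) (Fin 2) ℂ) (e : ℂ) : Prop :=
  Tendsto (fun k => -(4 * Complex.I * k * M k 0 1))
    (Bornology.cobounded ℂ ⊓ 𝓟 contourᶜ) (𝓝 e)

/-- `M₀ = M(+i0)`. -/
def HasValueAtZero (M : ℂ → Matrix (Fin 2) (Fin 2) ℂ) (M₀ : Matrix (Fin 2) (Fin 2) ℂ) : Prop :=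
  Tendsto (fun y : ℝ => M (Complex.I * y)) (𝓝[>] 0) (𝓝 M₀)

/-- `(N, ρ; conj ρ, -N) = M(+i0) σ₃ M(+i0)⁻¹`. -/
def HasMedium (M : ℂ → Matrix (Fin 2) (Fin 2) ℂ) (N : ℝ) (ρ : ℂ) : Prop :=
  ∃ M₀, HasValueAtZero M M₀ ∧ IsUnit M₀.det ∧
    M₀ * sigma3 * M₀⁻¹ = !![(N : ℂ), ρ; starRingEnd ℂ ρ, -(N : ℂ)]

end MaxwellBloch

end

/-! For `t ≤ x` the exponential `e^{-2iθ}` is bounded near infinity in the upper half-plane, and as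
`x` is positive `e^{2iθ}` is bounded there near the origin. Since `a` and `b` extend holomorphically
to the upper half-plane, where `a → 1` and `b → 0` at infinity, the explicit triangular factor `G`
is itself admissible: multiplication by `G` removes every pole of a solution `M` and turns each jump
condition into continuity. Hence `M G` extends across the contour by Morera's theorem and across the
remaining isolated points by Riemann's theorem, and the resulting entire function is bounded and
tends to `I` at infinity, so that `M G = I` by Liouville's theorem. Conversely `G⁻¹` solves the
problem as soon as `r = O(1/k)`.

The analytic properties of `a` and `b` come from the Neumann series of the Volterra equations for
the Jost column, and their behaviour at infinity from the Riemann–Lebesgue lemma. -/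

namespace MaxwellBloch

/-! ### Removing lines, circles and isolated points -/

section Removability

variable {E : Type*} [NormedAddCommGroup E] [NormedSpace ℂ E]

theorem wedgeIntegral_add_wedgeIntegral_split {f : ℂ → E} {z w : ℂ} {c : ℝ}
    (hf : ContinuousOn f (Complex.Rectangle z w)) (hc : c ∈ uIcc z.im w.im) :
    Complex.wedgeIntegral z w f + Complex.wedgeIntegral w z f =
      (Complex.wedgeIntegral z ⟨w.re, c⟩ f + Complex.wedgeIntegral ⟨w.re, c⟩ z f) +
        (Complex.wedgeIntegral ⟨z.re, c⟩ w f + Complex.wedgeIntegral w ⟨z.re, c⟩ f) := by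
  have integrable_side : ∀ u ∈ uIcc z.re w.re, ∀ p ∈ uIcc z.im w.im, ∀ q ∈ uIcc z.im w.im,
      IntervalIntegrable (fun y : ℝ => f (u + y * Complex.I)) volume p q := by
    intro u hu p hp q hq
    refine (hf.comp (by fun_prop) fun y hy => ⟨?_, ?_⟩).intervalIntegrable
    · simpa using hu
    · simpa using uIcc_subset_uIcc hp hq hy
  have split_side : ∀ u ∈ uIcc z.re w.re, (∫ y : ℝ in z.im..w.im, f (u + y * Complex.I)) =
      (∫ y : ℝ in z.im..c, f (u + y * Complex.I)) + ∫ y : ℝ in c..w.im, f (u + y * Complex.I) :=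
    fun u hu => (intervalIntegral.integral_add_adjacent_intervals
      (integrable_side u hu _ left_mem_uIcc _ hc) (integrable_side u hu _ hc _ right_mem_uIcc)).symm
  simp only [Complex.wedgeIntegral_add_wedgeIntegral_eq, split_side _ left_mem_uIcc,
    split_side _ right_mem_uIcc, smul_add]
  abel

variable [CompleteSpace E]

/-- Morera: a rectangle across the real axis is the union of two rectangles that touch it. -/
theorem differentiableOn_of_diff_real {f : ℂ → E} {U : Set ℂ} (hU : IsOpen U)
    (hc : ContinuousOn f U) (hd : DifferentiableOn ℂ f (U \ {z | z.im = 0})) :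
    DifferentiableOn ℂ f U := by
  rw [← Complex.isConservativeOn_and_continuousOn_iff_isDifferentiableOn hU]
  refine ⟨fun z w hzw => ?_, hc⟩
  have of_not_across : ∀ z w : ℂ, Complex.Rectangle z w ⊆ U →
      (0 : ℝ) ∉ Ioo (min z.im w.im) (max z.im w.im) →
      Complex.wedgeIntegral z w f + Complex.wedgeIntegral w z f = 0 := by
    intro z w hzw h0
    rw [Complex.wedgeIntegral_add_wedgeIntegral_eq]
    refine Complex.integral_boundary_rect_eq_zero_of_continuousOn_of_differentiableOn f z w
      (hc.mono hzw) (hd.mono ?_)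
    rintro k ⟨hre, him⟩
    exact ⟨hzw ⟨Ioo_subset_Icc_self hre, Ioo_subset_Icc_self him⟩, fun hk => h0 (hk ▸ him)⟩
  rw [← add_eq_zero_iff_eq_neg]
  by_cases h0 : (0 : ℝ) ∈ uIcc z.im w.im
  · have hz : Complex.Rectangle z ⟨w.re, 0⟩ ⊆ U := fun _ hk =>
      hzw ⟨hk.1, uIcc_subset_uIcc left_mem_uIcc h0 hk.2⟩
    have hw : Complex.Rectangle ⟨z.re, 0⟩ w ⊆ U := fun _ hk =>
      hzw ⟨hk.1, uIcc_subset_uIcc h0 right_mem_uIcc hk.2⟩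
    rw [wedgeIntegral_add_wedgeIntegral_split (hc.mono hzw) h0,
      of_not_across _ _ hz (by simpa using le_of_lt),
      of_not_across _ _ hw (by simpa using le_of_lt), add_zero]
  · exact of_not_across z w hzw fun h => h0 (Ioo_subset_Icc_self h)

/-- Near a point `p` of the circle, `w ↦ p exp(i w)` straightens the circle to the real axis. -/
theorem differentiableOn_of_diff_sphere {f : ℂ → E} {U : Set ℂ} {ρ : ℝ} (hρ : 0 < ρ)
    (hU : IsOpen U) (hc : ContinuousOn f U) (hd : DifferentiableOn ℂ f (U \ {z | ‖z‖ = ρ})) :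
    DifferentiableOn ℂ f U := by
  intro p hp
  refine DifferentiableAt.differentiableWithinAt ?_
  by_cases hpρ : ‖p‖ = ρ
  swap
  · exact hd.differentiableAt ((hU.sdiff (isClosed_eq continuous_norm continuous_const)).mem_nhds
      ⟨hp, hpρ⟩)
  have hp0 : p ≠ 0 := norm_pos_iff.1 (hpρ ▸ hρ)
  let g : ℂ → ℂ := fun w => p * Complex.exp (Complex.I * w)
  let l : ℂ → ℂ := fun k => -Complex.I * Complex.log (k / p)
  have hg : Differentiable ℂ g := by fun_prop
  have hgl : ∀ k : ℂ, k ≠ 0 → g (l k) = k := by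
    intro k hk
    simp only [g, l, ← mul_assoc, mul_neg, Complex.I_mul_I, neg_neg, one_mul,
      Complex.exp_log (div_ne_zero hk hp0)]
    field_simp
  have hV : IsOpen (g ⁻¹' U) := hU.preimage hg.continuous
  have hfg : DifferentiableOn ℂ (f ∘ g) (g ⁻¹' U) := by
    refine differentiableOn_of_diff_real hV (hc.comp hg.continuous.continuousOn fun _ h => h)
      (hd.comp hg.differentiableOn fun w hw => ⟨hw.1, fun (h : ‖g w‖ = ρ) => hw.2 ?_⟩)
    have hexp : ‖p‖ * Real.exp (-w.im) = ‖p‖ := by simpa [g, Complex.norm_exp, hpρ] using h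
    simpa [hp0] using hexp
  have hfg_at : DifferentiableAt ℂ (f ∘ g) (l p) :=
    hfg.differentiableAt (hV.mem_nhds (by simpa [hgl p hp0] using hp))
  have hl : DifferentiableAt ℂ l p :=
    (DifferentiableAt.clog (by fun_prop) (by simp [hp0])).const_mul _
  refine (hfg_at.comp p hl).congr_of_eventuallyEq ?_
  filter_upwards [isOpen_ne.mem_nhds hp0] with k hk
  simp [hgl k hk]

theorem differentiableOn_of_diff_contour {f : ℂ → E} {U : Set ℂ} (hU : IsOpen U)
    (hc : ContinuousOn f U) (hd : DifferentiableOn ℂ f (U \ contour)) :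
    DifferentiableOn ℂ f U := by
  refine differentiableOn_of_diff_sphere (ρ := 1 / 2) (by norm_num) hU hc
    (differentiableOn_of_diff_real
      (hU.sdiff (isClosed_eq continuous_norm continuous_const)) (hc.mono sdiff_subset) ?_)
  exact hd.mono fun k hk => ⟨hk.1.1, not_or.2 ⟨hk.2, hk.1.2⟩⟩

theorem differentiable_of_diff_discrete {f : ℂ → E} {X : Set ℂ} (hX : Xᶜ ∈ codiscrete ℂ)
    (hc : Continuous f) (hd : DifferentiableOn ℂ f Xᶜ) : Differentiable ℂ f := by
  intro p
  refine (Complex.analyticAt_of_differentiable_on_punctured_nhds_of_continuousAt ?_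
    hc.continuousAt).differentiableAt
  filter_upwards [disjoint_principal_right.1 (mem_codiscrete.1 hX p)] with k hk
  rw [compl_compl] at hk
  exact hd.differentiableAt ((mem_codiscrete'.1 hX).1.mem_nhds hk)

end Removability

theorem isClosed_contour : IsClosed contour :=
  (isClosed_eq Complex.continuous_im continuous_const).union
    (isClosed_eq continuous_norm continuous_const)

theorem interior_contour : interior contour = ∅ := by
  have hline : interior {k : ℂ | k.im = 0} = ∅ := by
    have h : {k : ℂ | k.im = 0} = frontier {k : ℂ | k.im ≤ 0} := by
      simp [Complex.frontier_setOfPred_im_le]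
    rw [h, interior_frontier (isClosed_le Complex.continuous_im continuous_const)]
  have hcircle : interior {k : ℂ | ‖k‖ = 1 / 2} = ∅ := by
    simpa [Metric.sphere] using interior_sphere (0 : ℂ) (r := 1 / 2) (by norm_num)
  exact (interior_union_isClosed_of_interior_empty
    (isClosed_eq Complex.continuous_im continuous_const) hcircle).trans hline

theorem dense_of_codiscrete {S : Set ℂ} (hS : S ∈ codiscrete ℂ) : Dense S := by
  intro p
  have hp : S ∈ 𝓝[≠] p := by simpa using mem_codiscrete.1 hS p
  exact mem_closure_iff_frequently.2 ((Filter.Eventually.frequently hp).filter_mono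
    nhdsWithin_le_nhds)

theorem dense_compl_contour : Dense contourᶜ :=
  interior_eq_empty_iff_dense_compl.1 interior_contour

/-- Near a removable point the bound on a dense set is a bound on a punctured neighbourhood, so that
Riemann's theorem applies. -/
theorem exists_tendsto_of_isBigO_one {E : Type*} [NormedAddCommGroup E] [NormedSpace ℂ E]
    [CompleteSpace E] {f : ℂ → E} {R : Set ℂ} {p : ℂ} (hR : Dense R)
    (hf : ∀ᶠ k in 𝓝[≠] p, DifferentiableAt ℂ f k) (hb : f =O[𝓝[R] p] (fun _ => (1 : ℝ))) :
    ∃ L, Tendsto f (𝓝[≠] p) (𝓝 L) := by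
  obtain ⟨C, hC⟩ := hb.bound
  obtain ⟨V, hV, hVo, hpV⟩ := eventually_nhds_iff.1 (eventually_nhdsWithin_iff.1 hC)
  refine ⟨_, Complex.tendsto_limUnder_of_differentiable_on_punctured_nhds_of_bounded_under hf
    ⟨C + ‖f p‖, ?_⟩⟩
  rw [eventually_map]
  filter_upwards [hf, nhdsWithin_le_nhds (hVo.mem_nhds hpV)] with k hk hkV
  refine (norm_sub_le _ _).trans (add_le_add_left ?_ _)
  have : (𝓝[V ∩ R] k).NeBot :=
    mem_closure_iff_nhdsWithin_neBot.1 (hR.open_subset_closure_inter hVo hkV)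
  refine le_of_tendsto (hk.continuousAt.norm.continuousWithinAt (s := V ∩ R)) ?_
  filter_upwards [self_mem_nhdsWithin] with z hz
  simpa using hV z hz.1 hz.2

theorem tendsto_cobounded_of_dense {Y : Type*} [PseudoMetricSpace Y] {g : ℂ → Y} {R : Set ℂ} {c : Y}
    (hR : Dense R) (hg : Continuous g)
    (h : Tendsto g (Bornology.cobounded ℂ ⊓ 𝓟 R) (𝓝 c)) :
    Tendsto g (Bornology.cobounded ℂ) (𝓝 c) := by
  rw [Metric.nhds_basis_closedBall.tendsto_right_iff]
  intro ε hε
  obtain ⟨N, -, hN⟩ := (Metric.hasBasis_cobounded_compl_closedBall (0 : ℂ)).eventually_iff.1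
    (eventually_inf_principal.1 (h.eventually (Metric.closedBall_mem_nhds c hε)))
  refine (Metric.hasBasis_cobounded_compl_closedBall 0).eventually_iff.2
    ⟨N, trivial, fun k hk => ?_⟩
  exact closure_minimal (fun z hz => hN hz.1 hz.2) (Metric.isClosed_closedBall.preimage hg)
    (hR.open_subset_closure_inter Metric.isClosed_closedBall.isOpen_compl hk)

theorem eq_const_of_removable_contour {E : Type*} [NormedAddCommGroup E] [NormedSpace ℂ E]
    [CompleteSpace E] {f : ℂ → E} {X : Set ℂ} {c : E} (hX : Xᶜ ∈ codiscrete ℂ)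
    (hf : DifferentiableOn ℂ f (contour ∪ X)ᶜ)
    (hlim : ∀ p ∈ contour \ X, ∃ L, Tendsto f (𝓝[(contour ∪ X)ᶜ] p) (𝓝 L))
    (hbdd : ∀ p ∈ X, f =O[𝓝[(contour ∪ X)ᶜ] p] (fun _ => (1 : ℝ)))
    (hinf : Tendsto f (Bornology.cobounded ℂ ⊓ 𝓟 (contour ∪ X)ᶜ) (𝓝 c)) :
    ∀ k ∈ (contour ∪ X)ᶜ, f k = c := by
  set R : Set ℂ := (contour ∪ X)ᶜ with hR_def
  have hXo : IsOpen Xᶜ := (mem_codiscrete'.1 hX).1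
  have hR : Dense R := by
    rw [hR_def, compl_union]
    exact dense_compl_contour.inter_of_isOpen_left (dense_of_codiscrete hX)
      isClosed_contour.isOpen_compl
  set g := extendFrom R f
  have hgR : ∀ k ∈ R, g k = f k := fun k hk => extendFrom_eq (hR k) (hf.continuousOn k hk)
  have hlim' : ∀ p ∈ Xᶜ, ∃ L, Tendsto f (𝓝[R] p) (𝓝 L) := fun p hpX =>
    (em (p ∈ contour)).elim (fun hp => hlim p ⟨hp, hpX⟩)
      fun hp => ⟨f p, hf.continuousOn p (not_or.2 ⟨hp, hpX⟩)⟩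
  have hgX : DifferentiableOn ℂ g Xᶜ :=
    differentiableOn_of_diff_contour hXo (continuousOn_extendFrom (fun p _ => hR p) hlim')
      ((hf.congr hgR).mono fun k hk => not_or.2 ⟨hk.2, hk.1⟩)
  have hlimX : ∀ p ∈ X, ∃ L, Tendsto f (𝓝[R] p) (𝓝 L) := by
    intro p hpX
    have hg_near : ∀ᶠ k in 𝓝[≠] p, DifferentiableAt ℂ g k := by
      filter_upwards [disjoint_principal_right.1 (mem_codiscrete.1 hX p)] with k hk
      exact hgX.differentiableAt (hXo.mem_nhds (by simpa using hk))
    have hgf : g =ᶠ[𝓝[R] p] f := eventually_nhdsWithin_of_forall hgR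
    obtain ⟨L, hL⟩ := exists_tendsto_of_isBigO_one hR hg_near
      ((hbdd p hpX).congr' hgf.symm EventuallyEq.rfl)
    have hRp : R ⊆ {p}ᶜ := fun k hk hkp => hk (Or.inr (hkp ▸ hpX))
    exact ⟨L, (hL.mono_left (nhdsWithin_mono p hRp)).congr' hgf⟩
  have hgc : Continuous g := continuous_extendFrom hR fun p =>
    (em (p ∈ X)).elim (hlimX p) (hlim' p)
  have hg_inf : Tendsto g (cocompact ℂ) (𝓝 c) := by
    rw [← Metric.cobounded_eq_cocompact]
    refine tendsto_cobounded_of_dense hR hgc (hinf.congr' ?_)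
    filter_upwards [mem_inf_of_right (mem_principal_self R)] with k hk using (hgR k hk).symm
  intro k hk
  rw [← hgR k hk]
  exact (differentiable_of_diff_discrete hX hgc hgX).apply_eq_of_tendsto_cocompact k hg_inf

/-! ### Principal parts -/

/-- The factor `F` of `f = (k - z)^n F`, where `n` is the order of the zero `z` of `f`. -/
noncomputable def zeroCofactor (f : ℂ → ℂ) (z : ℂ) : ℂ → ℂ :=
  (Function.swap dslope z)^[analyticOrderNatAt f z] f

section PrincipalPart

variable {f g : ℂ → ℂ} {z : ℂ}

theorem zeroCofactor_spec (hf : AnalyticAt ℂ f z) (hord : analyticOrderAt f z ≠ ⊤) :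
    AnalyticAt ℂ (zeroCofactor f z) z ∧ zeroCofactor f z z ≠ 0 ∧
      ∀ k, f k = (k - z) ^ analyticOrderNatAt f z * zeroCofactor f z k := by
  obtain ⟨p, hp⟩ := hf
  have hp0 : p ≠ 0 := fun h =>
    hord (analyticOrderAt_eq_top.2 (hp.locally_zero_iff.2 h))
  have hF : AnalyticAt ℂ ((Function.swap dslope z)^[p.order] f) z :=
    ⟨_, hp.has_fpower_series_iterate_dslope_fslope p.order⟩
  have hFz := hp.iterate_dslope_fslope_ne_zero hp0
  have hfF := hp.eq_pow_order_mul_iterate_dslope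
  have hn : analyticOrderNatAt f z = p.order := by
    rw [analyticOrderNatAt, (hp.analyticAt.analyticOrderAt_eq_natCast (n := p.order)).2
      ⟨_, hF, hFz, Eventually.of_forall hfF⟩, ENat.toNat_natCast]
  rw [zeroCofactor, hn]
  exact ⟨hF, hFz, hfF⟩

theorem poleCoeff_eq_iteratedDeriv_div (hf : AnalyticAt ℂ f z) (hord : analyticOrderAt f z ≠ ⊤)
    (hg : AnalyticAt ℂ g z) (p : ℕ) :
    poleCoeff f g z p =
      iteratedDeriv (analyticOrderNatAt f z - p) (fun k => g k * (zeroCofactor f z k)⁻¹) z /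
        (Nat.factorial (analyticOrderNatAt f z - p) : ℂ) := by
  obtain ⟨hF, hFz, -⟩ := zeroCofactor_spec hf hord
  rw [iteratedDeriv_fun_mul hg.contDiffAt (hF.fun_inv hFz).contDiffAt, Finset.sum_div, poleCoeff]
  refine Finset.sum_congr rfl fun j hj => ?_
  rw [Nat.cast_choose ℂ (Finset.mem_range_succ_iff.1 hj), laurentT, Nat.add_comm j p,
    Nat.sub_add_eq]
  have hfact : ∀ m : ℕ, (Nat.factorial m : ℂ) ≠ 0 := fun m =>
    Nat.cast_ne_zero.2 (Nat.factorial_ne_zero m)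
  have := hfact (analyticOrderNatAt f z - p)
  have := hfact (analyticOrderNatAt f z - p - j)
  have := hfact j
  simp only [zeroCofactor]
  field_simp

theorem polarSum_eq_taylor_div_pow (hf : AnalyticAt ℂ f z) (hord : analyticOrderAt f z ≠ ⊤)
    (hg : AnalyticAt ℂ g z) {k : ℂ} (hk : k ≠ z) :
    polarSum f g z k = (∑ j ∈ Finset.range (analyticOrderNatAt f z),
      iteratedDeriv j (fun k => g k * (zeroCofactor f z k)⁻¹) z / (Nat.factorial j : ℂ) *
        (k - z) ^ j) / (k - z) ^ analyticOrderNatAt f z := by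
  set n := analyticOrderNatAt f z with hn
  have : k - z ≠ 0 := sub_ne_zero.2 hk
  have hIcc : Finset.Icc 1 n = Finset.Ico 1 (n + 1) := by ext; simp
  rw [polarSum, ← hn, hIcc, Finset.sum_Ico_eq_sum_range, Nat.add_sub_cancel,
    ← Finset.sum_range_reflect, Finset.sum_div]
  refine Finset.sum_congr rfl fun j hj => ?_
  have hjn : j < n := Finset.mem_range.1 hj
  rw [poleCoeff_eq_iteratedDeriv_div hf hord hg, ← hn,
    show n - (1 + (n - 1 - j)) = j by omega,
    show (k - z) ^ n = (k - z) ^ j * (k - z) ^ (1 + (n - 1 - j)) by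
      rw [← pow_add]; congr 1; omega]
  field_simp

theorem isBigO_sub_taylor {H : ℂ → ℂ} (hH : AnalyticAt ℂ H z) (n : ℕ) :
    (fun k => H k - ∑ j ∈ Finset.range n,
      iteratedDeriv j H z / (Nat.factorial j : ℂ) * (k - z) ^ j) =O[𝓝 z]
      fun k => (k - z) ^ n := by
  have hz : Tendsto (fun k : ℂ => k - z) (𝓝 z) (𝓝 0) :=
    (continuous_sub_right z).tendsto' z 0 (sub_self z)
  refine (((hH.hasFPowerSeriesAt.isBigO_sub_partialSum_pow n).comp_tendsto hz).congr_left
    fun k => ?_).trans (IsBigO.of_bound 1 (Eventually.of_forall fun k => ?_))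
  · simp [FormalMultilinearSeries.partialSum, mul_comm]
  · simp

theorem polarSum_sub_isBigO (hf : AnalyticAt ℂ f z) (hord : analyticOrderAt f z ≠ ⊤)
    (hg : AnalyticAt ℂ g z) :
    (fun k => g k / f k - polarSum f g z k) =O[𝓝[≠] z] (fun _ => (1 : ℝ)) := by
  obtain ⟨hF, hFz, hfF⟩ := zeroCofactor_spec hf hord
  obtain ⟨C, hC⟩ := (isBigO_sub_taylor (hg.mul (hF.fun_inv hFz))
    (analyticOrderNatAt f z)).bound
  refine IsBigO.of_bound C ?_
  filter_upwards [self_mem_nhdsWithin, nhdsWithin_le_nhds hC] with k hk hCk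
  have hpow : (k - z) ^ analyticOrderNatAt f z ≠ 0 := pow_ne_zero _ (sub_ne_zero.2 hk)
  have hgf : g k / f k =
      g k * (zeroCofactor f z k)⁻¹ / (k - z) ^ analyticOrderNatAt f z := by
    rw [hfF k, div_mul_eq_div_div_swap, div_eq_mul_inv (g k)]
  rw [hgf, polarSum_eq_taylor_div_pow hf hord hg hk, ← sub_div, norm_div,
    div_le_iff₀ (norm_pos_iff.2 hpow), norm_one, mul_one]
  exact hCk

end PrincipalPart

/-! ### Absolutely continuous functions and integrals with a parameter -/

section AbsolutelyContinuous

variable {F : Type*} [NormedAddCommGroup F] {a b : ℝ}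

theorem absolutelyContinuousOnInterval_of_dist_le {X Y : Type*} [PseudoMetricSpace X]
    [PseudoMetricSpace Y] {f : ℝ → X} {g : ℝ → Y} (hg : AbsolutelyContinuousOnInterval g a b)
    (h : ∀ x ∈ uIcc a b, ∀ y ∈ uIcc a b, dist (f x) (f y) ≤ dist (g x) (g y)) :
    AbsolutelyContinuousOnInterval f a b := by
  rw [absolutelyContinuousOnInterval_iff] at hg ⊢
  intro ε hε
  obtain ⟨δ, hδ, H⟩ := hg ε hε
  refine ⟨δ, hδ, fun E hE hlt => lt_of_le_of_lt (Finset.sum_le_sum fun i hi => ?_) (H E hE hlt)⟩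
  exact h _ (hE.1 i hi).1 _ (hE.1 i hi).2

theorem absolutelyContinuousOnInterval_integral [NormedSpace ℝ F] {v : ℝ → F}
    (hv : IntervalIntegrable v volume a b) :
    AbsolutelyContinuousOnInterval (fun x => ∫ s in a..x, v s) a b := by
  refine absolutelyContinuousOnInterval_of_dist_le
    (hv.norm.absolutelyContinuousOnInterval_intervalIntegral (c := a) left_mem_uIcc) ?_
  intro x hx y hy
  have hax : IntervalIntegrable v volume a x :=
    hv.mono_set (uIcc_subset_uIcc left_mem_uIcc hx)
  have hay : IntervalIntegrable v volume a y :=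
    hv.mono_set (uIcc_subset_uIcc left_mem_uIcc hy)
  rw [dist_eq_norm, dist_eq_norm, intervalIntegral.integral_interval_sub_left hax hay,
    intervalIntegral.integral_interval_sub_left hax.norm hay.norm]
  exact intervalIntegral.norm_integral_le_abs_integral_norm

theorem integral_eq_sub_of_ae_hasDerivAt [NormedSpace ℝ F] [CompleteSpace F] {f f' : ℝ → F}
    (hf : AbsolutelyContinuousOnInterval f a b) (hf' : IntervalIntegrable f' volume a b)
    (hderiv : ∀ᵐ x, x ∈ uIcc a b → HasDerivAt f (f' x) x) :
    ∫ x in a..b, f' x = f b - f a := by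
  have hsub := hf.sub (absolutelyContinuousOnInterval_integral hf')
  obtain ⟨C, hC⟩ := hsub.const_of_ae_hasDerivAt_zero (by
    filter_upwards [hderiv, hf'.ae_hasDerivAt_integral] with x h1 h2 hx
    simpa only [sub_self] using (h1 hx).sub (h2 hx a left_mem_uIcc))
  have ha := hC a left_mem_uIcc
  have hb := hC b right_mem_uIcc
  simp only [Pi.sub_apply, intervalIntegral.integral_same, sub_zero] at ha hb
  rw [ha, ← hb, sub_sub_cancel]

theorem integral_mul_add_mul_of_primitive {U V u v : ℝ → ℂ}
    (hu : IntervalIntegrable u volume a b) (hv : IntervalIntegrable v volume a b)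
    (hU : ∀ t ∈ uIcc a b, U t = U a + ∫ s in a..t, u s)
    (hV : ∀ t ∈ uIcc a b, V t = V a + ∫ s in a..t, v s) :
    ∫ t in a..b, (u t * V t + U t * v t) = U b * V b - U a * V a := by
  set P : ℝ → ℂ := fun t => U a + ∫ s in a..t, u s with hP
  set Q : ℝ → ℂ := fun t => V a + ∫ s in a..t, v s with hQ
  have hPac : AbsolutelyContinuousOnInterval P a b :=
    absolutelyContinuousOnInterval_of_dist_le (absolutelyContinuousOnInterval_integral hu)
      fun x _ y _ => by simp only [hP, dist_add_left, le_refl]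
  have hQac : AbsolutelyContinuousOnInterval Q a b :=
    absolutelyContinuousOnInterval_of_dist_le (absolutelyContinuousOnInterval_integral hv)
      fun x _ y _ => by simp only [hQ, dist_add_left, le_refl]
  have hderiv : ∀ᵐ x, x ∈ uIcc a b → HasDerivAt (fun t => P t * Q t) (u x * Q x + P x * v x) x := by
    filter_upwards [hu.ae_hasDerivAt_integral, hv.ae_hasDerivAt_integral] with x h1 h2 hx
    exact ((h1 hx a left_mem_uIcc).const_add (U a)).fun_mul
      ((h2 hx a left_mem_uIcc).const_add (V a))
  have hint : IntervalIntegrable (fun t => u t * Q t + P t * v t) volume a b :=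
    (hu.mul_continuousOn hQac.continuousOn).add (hv.continuousOn_mul hPac.continuousOn)
  have hPQ := integral_eq_sub_of_ae_hasDerivAt (f := fun t => P t * Q t) (hPac.smul hQac) hint
    hderiv
  have hcongr : ∫ t in a..b, (u t * V t + U t * v t) = ∫ t in a..b, (u t * Q t + P t * v t) :=
    intervalIntegral.integral_congr fun t ht => by simp only [hP, hQ, hU t ht, hV t ht]
  rw [hcongr, hPQ, hU b right_mem_uIcc, hV b right_mem_uIcc]
  simp only [hP, hQ, intervalIntegral.integral_same, add_zero]

end AbsolutelyContinuous

section HalfLine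

variable {F : Type*} [NormedAddCommGroup F] [NormedSpace ℝ F] {h : ℝ → F}

theorem integral_Ioi_eq_sub (hh : Integrable h) (a t : ℝ) :
    ∫ s in Ioi t, h s = (∫ s in Ioi a, h s) - ∫ s in a..t, h s := by
  rw [← intervalIntegral.integral_interval_add_Ioi (μ := volume) (a := a) (b := t)
    hh.integrableOn hh.integrableOn, add_sub_cancel_left]

theorem tendsto_integral_Ioi_zero (hh : Integrable h) :
    Tendsto (fun t => ∫ s in Ioi t, h s) atTop (𝓝 0) := by
  rw [funext (integral_Ioi_eq_sub hh 0)]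
  simpa only [sub_self, id] using (intervalIntegral_tendsto_integral_Ioi (μ := volume) 0
    hh.integrableOn tendsto_id).const_sub (∫ s in Ioi 0, h s)

theorem continuous_integral_Ioi (hh : Integrable h) : Continuous fun t => ∫ s in Ioi t, h s := by
  rw [funext (integral_Ioi_eq_sub hh 0)]
  exact continuous_const.sub (intervalIntegral.continuous_primitive
    (fun a b => hh.intervalIntegrable) 0)

end HalfLine

section Parameter

variable {α : Type*} [MeasurableSpace α] {μ : Measure α} {U : Set ℂ} {f : ℂ → α → ℂ}

theorem aestronglyMeasurable_deriv_param (hU : IsOpen U)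
    (hmeas : ∀ k ∈ U, AEStronglyMeasurable (f k) μ)
    (hdiff : ∀ᵐ s ∂μ, DifferentiableOn ℂ (fun k => f k s) U) {k₀ : ℂ} (hk₀ : k₀ ∈ U) :
    AEStronglyMeasurable (fun s => deriv (fun k => f k s) k₀) μ := by
  have hU₀ : ∀ᶠ k in 𝓝[≠] k₀, k ∈ U := nhdsWithin_le_nhds (hU.mem_nhds hk₀)
  refine aestronglyMeasurable_of_tendsto_ae (𝓝[≠] k₀)
    (f := fun k s => U.indicator (fun k => slope (fun k => f k s) k₀ k) k) (fun k => ?_) ?_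
  · by_cases hk : k ∈ U
    · simp only [indicator_of_mem hk, slope_def_module]
      exact (AEStronglyMeasurable.sub (hmeas k hk) (hmeas k₀ hk₀)).const_smul (k - k₀)⁻¹
    · simpa only [indicator_of_notMem hk] using aestronglyMeasurable_const
  · filter_upwards [hdiff] with s hs
    refine (hasDerivAt_iff_tendsto_slope.1
      (hs.differentiableAt (hU.mem_nhds hk₀)).hasDerivAt).congr' ?_
    filter_upwards [hU₀] with k hk
    rw [indicator_of_mem hk]

theorem differentiableOn_integral_of_dominated (hU : IsOpen U) {D : α → ℝ} (hD : Integrable D μ)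
    (hmeas : ∀ k ∈ U, AEStronglyMeasurable (f k) μ)
    (hbd : ∀ᵐ s ∂μ, ∀ k ∈ U, ‖f k s‖ ≤ D s)
    (hdiff : ∀ᵐ s ∂μ, DifferentiableOn ℂ (fun k => f k s) U) :
    DifferentiableOn ℂ (fun k => ∫ s, f k s ∂μ) U := by
  intro k₀ hk₀
  obtain ⟨r, hr, hball⟩ := Metric.isOpen_iff.1 hU k₀ hk₀
  have hsub : ∀ x ∈ Metric.ball k₀ (r / 2), Metric.closedBall x (r / 4) ⊆ U := fun x hx =>
    (Metric.closedBall_subset_ball' (by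
      rw [Metric.mem_ball] at hx; linarith)).trans hball
  -- Cauchy's estimate dominates the derivative by the same function.
  have hcauchy : ∀ᵐ s ∂μ, ∀ x ∈ Metric.ball k₀ (r / 2),
      ‖deriv (fun k => f k s) x‖ ≤ D s / (r / 4) := by
    filter_upwards [hbd, hdiff] with s hs hds x hx
    refine Complex.norm_deriv_le_of_forall_mem_sphere_norm_le (by positivity)
      (DifferentiableOn.diffContOnCl (hds.mono ?_))
      fun z hz => hs z (hsub x hx (Metric.sphere_subset_closedBall hz))
    rw [closure_ball _ (by positivity)]
    exact hsub x hx
  refine (hasDerivAt_integral_of_dominated_loc_of_deriv_le (F := f)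
    (F' := fun k s => deriv (fun k => f k s) k) (Metric.ball_mem_nhds k₀ (half_pos hr))
    ((hU.eventually_mem hk₀).mono hmeas) (hD.mono' (hmeas k₀ hk₀) (hbd.mono fun s hs => hs k₀ hk₀))
    (aestronglyMeasurable_deriv_param hU hmeas hdiff hk₀) hcauchy (hD.div_const _)
    ?_).2.differentiableAt.differentiableWithinAt
  filter_upwards [hdiff] with s hs x hx
  exact (hs.differentiableAt (hU.mem_nhds
    (hsub x hx (Metric.mem_closedBall_self (by positivity))))).hasDerivAt

end Parameter

/-! ### Volterra operators -/

/-- The Volterra operator `f ↦ ∫_t^∞ e^{c(s-t)} v(s) f(s) ds`. -/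
noncomputable def volterra (c : ℂ) (v f : ℝ → ℂ) (t : ℝ) : ℂ :=
  ∫ s in Ioi t, Complex.exp (c * (s - t)) * v s * f s

/-- The weight `exp (2 ∫_t^∞ m)`; in the weighted supremum norm a Volterra operator whose
kernel is bounded by `m` is a contraction with factor `1 / 2`. -/
noncomputable def volterraWeight (m : ℝ → ℝ) (t : ℝ) : ℝ := Real.exp (2 * ∫ s in Ioi t, m s)

section Weight

variable {m : ℝ → ℝ}

theorem one_le_volterraWeight (hm0 : ∀ s, 0 ≤ m s) (t : ℝ) : 1 ≤ volterraWeight m t :=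
  Real.one_le_exp (mul_nonneg zero_le_two (integral_nonneg hm0))

theorem volterraWeight_le (hm : Integrable m) (hm0 : ∀ s, 0 ≤ m s) (t : ℝ) :
    volterraWeight m t ≤ Real.exp (2 * ∫ s, m s) :=
  Real.exp_le_exp.2 (mul_le_mul_of_nonneg_left
    (setIntegral_le_integral hm (Eventually.of_forall hm0)) zero_le_two)

theorem continuous_volterraWeight (hm : Integrable m) : Continuous (volterraWeight m) :=
  Real.continuous_exp.comp ((continuous_integral_Ioi hm).const_mul 2)

theorem integrable_mul_volterraWeight (hm : Integrable m) (hm0 : ∀ s, 0 ≤ m s) :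
    Integrable fun s => m s * volterraWeight m s :=
  hm.mul_bdd (c := Real.exp (2 * ∫ s, m s)) (continuous_volterraWeight hm).aestronglyMeasurable
    (Eventually.of_forall fun s => by
      rw [volterraWeight, Real.norm_of_nonneg (Real.exp_pos _).le]
      exact volterraWeight_le hm hm0 s)

theorem absolutelyContinuousOnInterval_volterraWeight (hm : Integrable m) (a b : ℝ) :
    AbsolutelyContinuousOnInterval (volterraWeight m) a b := by
  set W : ℝ → ℝ := fun t => 2 * ∫ s in Ioi t, m s with hW
  have hWac : AbsolutelyContinuousOnInterval W a b := by
    refine absolutelyContinuousOnInterval_of_dist_le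
      ((absolutelyContinuousOnInterval_integral hm.intervalIntegrable).const_mul 2)
      fun x _ y _ => le_of_eq ?_
    simp only [hW]
    rw [integral_Ioi_eq_sub hm a x, integral_Ioi_eq_sub hm a y, mul_sub, mul_sub, dist_sub_left]
  obtain ⟨C, hC⟩ := hWac.exists_bound
  have hexp : LipschitzOnWith (Real.exp C).toNNReal Real.exp (Iic C) := by
    refine Convex.lipschitzOnWith_of_nnnorm_deriv_le (fun x _ => Real.differentiableAt_exp)
      (fun x hx => ?_) (convex_Iic C)
    rw [Real.deriv_exp, ← NNReal.coe_le_coe, coe_nnnorm, Real.norm_of_nonneg (Real.exp_pos _).le,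
      Real.coe_toNNReal _ (Real.exp_pos _).le]
    exact Real.exp_le_exp.2 hx
  refine absolutelyContinuousOnInterval_of_dist_le (hWac.const_mul (Real.exp C)) fun x hx y hy => ?_
  refine (hexp.dist_le_mul _ ((le_abs_self _).trans (hC x hx)) _
    ((le_abs_self _).trans (hC y hy))).trans (le_of_eq ?_)
  rw [Real.coe_toNNReal _ (Real.exp_pos _).le, Real.dist_eq, Real.dist_eq,
    ← mul_sub (Real.exp C), abs_mul (Real.exp C), abs_of_pos (Real.exp_pos C)]

theorem integral_mul_volterraWeight (hm : Integrable m) (hm0 : ∀ s, 0 ≤ m s) (t : ℝ) :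
    ∫ s in Ioi t, m s * volterraWeight m s = (volterraWeight m t - 1) / 2 := by
  have hint := integrable_mul_volterraWeight hm hm0
  have hFTC : ∀ T, ∫ s in t..T, -2 * (m s * volterraWeight m s) =
      volterraWeight m T - volterraWeight m t := fun T => by
    refine integral_eq_sub_of_ae_hasDerivAt (absolutelyContinuousOnInterval_volterraWeight hm t T)
      (hint.const_mul (-2)).intervalIntegrable ?_
    filter_upwards [hm.intervalIntegrable.ae_hasDerivAt_integral] with x hx hxm
    have hd : HasDerivAt (fun t => 2 * ∫ s in Ioi t, m s) (2 * -m x) x := by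
      rw [funext fun y => congrArg (2 * ·) (integral_Ioi_eq_sub hm t y)]
      exact ((hx hxm t left_mem_uIcc).const_sub _).const_mul 2
    exact hd.exp.congr_deriv (by rw [volterraWeight]; ring)
  have hlim : Tendsto (volterraWeight m) atTop (𝓝 1) := by
    have := (Real.continuous_exp.tendsto _).comp ((tendsto_integral_Ioi_zero hm).const_mul 2)
    rwa [mul_zero, Real.exp_zero] at this
  have h := tendsto_nhds_unique (intervalIntegral_tendsto_integral_Ioi t
    (hint.const_mul (-2)).integrableOn tendsto_id) ((hlim.sub_const _).congr fun T => (hFTC T).symm)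
  rw [integral_const_mul] at h
  linarith

end Weight

section Volterra

variable {c : ℂ} {v f g : ℝ → ℂ} {m : ℝ → ℝ} {D D' : ℝ}

theorem volterra_eq_exp_mul (c : ℂ) (v f : ℝ → ℂ) (t : ℝ) :
    volterra c v f t =
      Complex.exp (-(c * t)) * ∫ s in Ioi t, Complex.exp (c * s) * v s * f s := by
  rw [volterra, ← integral_const_mul]
  refine integral_congr_ae (Eventually.of_forall fun s => ?_)
  simp only [← mul_assoc, ← Complex.exp_add]
  ring_nf

theorem norm_exp_mul_sub_le_one (hc : c.re ≤ 0) {s t : ℝ} (hts : t ≤ s) :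
    ‖Complex.exp (c * (s - t))‖ ≤ 1 := by
  rw [Complex.norm_exp, Real.exp_le_one_iff, ← Complex.ofReal_sub, Complex.re_mul_ofReal]
  exact mul_nonpos_of_nonpos_of_nonneg hc (sub_nonneg.2 hts)

theorem norm_volterra_integrand_le (hc : c.re ≤ 0) {s t : ℝ} (hts : t ≤ s) {A : ℝ}
    (hA : ‖f s‖ ≤ A) : ‖Complex.exp (c * (s - t)) * v s * f s‖ ≤ ‖v s‖ * A := by
  rw [norm_mul, norm_mul]
  exact mul_le_mul (mul_le_of_le_one_left (norm_nonneg _) (norm_exp_mul_sub_le_one hc hts)) hA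
    (norm_nonneg _) (norm_nonneg _)

theorem integrableOn_volterra_kernel (hc : c.re ≤ 0) (hv : Integrable v) (t : ℝ) :
    IntegrableOn (fun s : ℝ => Complex.exp (c * (s - t)) * v s) (Ioi t) := by
  refine hv.integrableOn.bdd_mul (c := 1) (Continuous.aestronglyMeasurable (by fun_prop)) ?_
  filter_upwards [ae_restrict_mem measurableSet_Ioi] with s hs using
    norm_exp_mul_sub_le_one hc (le_of_lt hs)

theorem integrableOn_volterra_integrand (hc : c.re ≤ 0) (hv : Integrable v) (hf : Continuous f)
    (hfD : ∀ s, ‖f s‖ ≤ D) (t : ℝ) :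
    IntegrableOn (fun s : ℝ => Complex.exp (c * (s - t)) * v s * f s) (Ioi t) :=
  (integrableOn_volterra_kernel hc hv t).mul_bdd hf.aestronglyMeasurable
    (Eventually.of_forall hfD)

theorem norm_volterra_le (hc : c.re ≤ 0) {W : ℝ → ℝ} {t : ℝ} (hf : ∀ s, ‖f s‖ ≤ W s)
    (hW : IntegrableOn (fun s => ‖v s‖ * W s) (Ioi t)) :
    ‖volterra c v f t‖ ≤ ∫ s in Ioi t, ‖v s‖ * W s := by
  refine norm_integral_le_of_norm_le hW ?_
  filter_upwards [ae_restrict_mem measurableSet_Ioi] with s hs using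
    norm_volterra_integrand_le hc (le_of_lt hs) (hf s)

theorem norm_volterra_le_const (hc : c.re ≤ 0) (hv : Integrable v) (hfD : ∀ s, ‖f s‖ ≤ D)
    (t : ℝ) : ‖volterra c v f t‖ ≤ (∫ s, ‖v s‖) * D := by
  refine (norm_volterra_le hc hfD (hv.norm.mul_const D).integrableOn).trans ?_
  rw [integral_mul_const]
  exact mul_le_mul_of_nonneg_right (setIntegral_le_integral hv.norm
    (Eventually.of_forall fun s => norm_nonneg _)) ((norm_nonneg _).trans (hfD 0))

theorem norm_volterra_le_volterraWeight (hc : c.re ≤ 0) (hm : Integrable m)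
    (hvm : ∀ s, ‖v s‖ = m s) {A : ℝ} (hA : 0 ≤ A) (hf : ∀ s, ‖f s‖ ≤ A * volterraWeight m s)
    (t : ℝ) : ‖volterra c v f t‖ ≤ A / 2 * volterraWeight m t := by
  have hm0 : ∀ s, 0 ≤ m s := fun s => hvm s ▸ norm_nonneg _
  have hcongr : (fun s => ‖v s‖ * (A * volterraWeight m s)) =
      fun s => A * (m s * volterraWeight m s) := funext fun s => by rw [hvm]; ring
  have hint := (integrable_mul_volterraWeight hm hm0).const_mul A
  have hle := norm_volterra_le (c := c) (t := t) hc hf (hcongr ▸ hint.integrableOn)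
  rw [hcongr, integral_const_mul, integral_mul_volterraWeight hm hm0] at hle
  linarith

theorem continuous_volterra (hc : c.re ≤ 0) (hv : Integrable v) (hf : Continuous f)
    (hfD : ∀ s, ‖f s‖ ≤ D) : Continuous (volterra c v f) := by
  have hD : 0 ≤ D := (norm_nonneg _).trans (hfD 0)
  set G : ℝ → ℝ → ℂ := fun t => (Ioi t).indicator fun s => Complex.exp (c * (s - t)) * v s * f s
  have hG : volterra c v f = fun t => ∫ s, G t s :=
    funext fun t => (integral_indicator measurableSet_Ioi).symm
  rw [hG, continuous_iff_continuousAt]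
  have hint : ∀ t, Integrable (G t) := fun t =>
    (integrableOn_volterra_integrand hc hv hf hfD t).integrable_indicator measurableSet_Ioi
  refine fun t₀ => continuousAt_of_dominated (bound := fun s => ‖v s‖ * D)
    (Eventually.of_forall fun t => (hint t).aestronglyMeasurable)
    (Eventually.of_forall fun t => Eventually.of_forall fun s => ?_) (hv.norm.mul_const D) ?_
  · rcases le_or_gt s t with hst | hst
    · simpa only [G, indicator_of_notMem (notMem_Ioi.2 hst), norm_zero] using
        mul_nonneg (norm_nonneg _) hD
    · simpa only [G, indicator_of_mem (mem_Ioi.2 hst)] using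
        norm_volterra_integrand_le hc hst.le (hfD s)
  · filter_upwards [compl_mem_ae_iff.2 (measure_singleton t₀)] with s hs
    rcases lt_or_gt_of_ne (hs : s ≠ t₀) with h | h
    · refine continuousAt_const.congr (f := fun _ => (0 : ℂ)) ?_
      filter_upwards [lt_mem_nhds h] with t ht
      simp only [G, indicator_of_notMem (notMem_Ioi.2 ht.le)]
    · refine ContinuousAt.congr (f := fun t : ℝ => Complex.exp (c * (s - t)) * v s * f s)
        (Continuous.continuousAt (by fun_prop)) ?_
      filter_upwards [gt_mem_nhds h] with t ht
      simp only [G, indicator_of_mem (mem_Ioi.2 ht)]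

theorem volterra_sub (hc : c.re ≤ 0) (hv : Integrable v) (hf : Continuous f)
    (hfD : ∀ s, ‖f s‖ ≤ D) (hg : Continuous g) (hgD : ∀ s, ‖g s‖ ≤ D') :
    volterra c v f - volterra c v g = volterra c v (f - g) := by
  ext t
  simp only [volterra, Pi.sub_apply, mul_sub (Complex.exp _ * _)]
  exact (integral_sub (integrableOn_volterra_integrand hc hv hf hfD t)
    (integrableOn_volterra_integrand hc hv hg hgD t)).symm

theorem integral_mul_tsum {κ : ℝ → ℂ} {S : Set ℝ} (hκ : IntegrableOn κ S) {f : ℕ → ℝ → ℂ}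
    {d : ℕ → ℝ} (hd : Summable d) (hf : ∀ n, Continuous (f n)) (hfd : ∀ n s, ‖f n s‖ ≤ d n) :
    ∫ s in S, κ s * ∑' n, f n s = ∑' n, ∫ s in S, κ s * f n s := by
  have hint : ∀ n, IntegrableOn (fun s => κ s * f n s) S := fun n =>
    hκ.mul_bdd (hf n).aestronglyMeasurable (Eventually.of_forall (hfd n))
  have hsummable : Summable fun n => ∫ s in S, ‖κ s * f n s‖ := by
    refine Summable.of_nonneg_of_le (fun n => integral_nonneg fun s => norm_nonneg _) (fun n => ?_)
      (hd.mul_left (∫ s in S, ‖κ s‖))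
    rw [← integral_mul_const]
    refine integral_mono (hint n).norm (hκ.norm.mul_const _) fun s => ?_
    rw [norm_mul]
    exact mul_le_mul_of_nonneg_left (hfd n s) (norm_nonneg _)
  rw [(hasSum_integral_of_summable_integral_norm hint hsummable).tsum_eq]
  simp only [tsum_mul_left]

theorem volterra_tsum (hc : c.re ≤ 0) (hv : Integrable v) {f : ℕ → ℝ → ℂ} {d : ℕ → ℝ}
    (hd : Summable d) (hf : ∀ n, Continuous (f n)) (hfd : ∀ n s, ‖f n s‖ ≤ d n) :
    volterra c v (fun s => ∑' n, f n s) = fun t => ∑' n, volterra c v (f n) t :=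
  funext fun t => integral_mul_tsum (integrableOn_volterra_kernel hc hv t) hd hf hfd

end Volterra

/-- A family of continuous functions of `t`, bounded by `D`, that depends continuously on `k` in
the closed upper half-plane and holomorphically in the open one. -/
structure IsJostFamily (Φ : ℂ → ℝ → ℂ) (D : ℝ) : Prop where
  continuous : ∀ k : ℂ, 0 ≤ k.im → Continuous (Φ k)
  norm_le : ∀ k : ℂ, 0 ≤ k.im → ∀ t, ‖Φ k t‖ ≤ D
  continuousOn : ∀ t, ContinuousOn (fun k => Φ k t) {k | 0 ≤ k.im}
  differentiableOn : ∀ t, DifferentiableOn ℂ (fun k => Φ k t) {k | 0 < k.im}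

theorem isOpen_upper : IsOpen {k : ℂ | 0 < k.im} :=
  isOpen_lt continuous_const Complex.continuous_im

theorem IsJostFamily.volterra {Φ : ℂ → ℝ → ℂ} {D : ℝ} (hΦ : IsJostFamily Φ D) {c : ℂ → ℂ}
    (hc : Differentiable ℂ c) (hre : ∀ k : ℂ, 0 ≤ k.im → (c k).re ≤ 0) {v : ℝ → ℂ}
    (hv : Integrable v) :
    IsJostFamily (fun k => volterra (c k) v (Φ k)) ((∫ s, ‖v s‖) * D) := by
  have hbd : ∀ t : ℝ, ∀ᵐ s : ℝ ∂volume.restrict (Ioi t), ∀ k : ℂ, 0 ≤ k.im →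
      ‖Complex.exp (c k * (s - t)) * v s * Φ k s‖ ≤ ‖v s‖ * D := fun t => by
    filter_upwards [ae_restrict_mem measurableSet_Ioi] with s hs k hk using
      norm_volterra_integrand_le (hre k hk) (le_of_lt hs) (hΦ.norm_le k hk s)
  have hmeas : ∀ k : ℂ, 0 ≤ k.im → ∀ t : ℝ, AEStronglyMeasurable
      (fun s : ℝ => Complex.exp (c k * (s - t)) * v s * Φ k s) (volume.restrict (Ioi t)) :=
    fun k hk t => (integrableOn_volterra_integrand (hre k hk) hv (hΦ.continuous k hk)
      (hΦ.norm_le k hk) t).aestronglyMeasurable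
  refine ⟨fun k hk => continuous_volterra (hre k hk) hv (hΦ.continuous k hk) (hΦ.norm_le k hk),
    fun k hk => norm_volterra_le_const (hre k hk) hv (hΦ.norm_le k hk), fun t => ?_, fun t => ?_⟩
  · refine continuousOn_of_dominated (fun k hk => hmeas k hk t)
      (fun k hk => (hbd t).mono fun s hs => hs k hk) (hv.norm.mul_const D).integrableOn
      (Eventually.of_forall fun s => ContinuousOn.mul ?_ (hΦ.continuousOn s))
    exact ((((hc.continuous.mul continuous_const).cexp).mul continuous_const)).continuousOn
  · refine differentiableOn_integral_of_dominated isOpen_upper (hv.norm.mul_const D).integrableOn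
      (fun k hk => hmeas k (le_of_lt hk) t)
      ((hbd t).mono fun s hs k hk => hs k (le_of_lt hk))
      (Eventually.of_forall fun s => DifferentiableOn.mul ?_ (hΦ.differentiableOn s))
    exact (((hc.mul_const _).cexp).mul_const _).differentiableOn

/-- The Volterra operator that carries the oscillating factor: it produces the first component of
the normalized Jost column from the second one. -/
noncomputable def volB (e : ℝ → ℂ) (k : ℂ) : (ℝ → ℂ) → ℝ → ℂ :=
  volterra (2 * Complex.I * k) fun s => e s / 2

/-- The Volterra operator without oscillating factor: it produces the second component of the
normalized Jost column, minus its limit `1`, from the first one. -/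
noncomputable def volC (e : ℝ → ℂ) : (ℝ → ℂ) → ℝ → ℂ :=
  volterra 0 fun s => -(starRingEnd ℂ (e s) / 2)

/-- The terms of the Neumann series of the second component of the normalized Jost column. -/
noncomputable def neumannTerm (e : ℝ → ℂ) (k : ℂ) : ℕ → ℝ → ℂ
  | 0 => fun _ => 1
  | n + 1 => volC e (volB e k (neumannTerm e k n))

/-- The second component of the Jost column, normalized by the factor `e^{-ikt}`. -/
noncomputable def psiTwo (e : ℝ → ℂ) (k : ℂ) (t : ℝ) : ℂ := ∑' n, neumannTerm e k n t

/-- The first component of the Jost column, normalized by the factor `e^{-ikt}`. -/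
noncomputable def psiOne (e : ℝ → ℂ) (k : ℂ) : ℝ → ℂ := volB e k (psiTwo e k)

section NeumannSeries

variable {e : ℝ → ℂ} {k : ℂ} {f : ℝ → ℂ} {D : ℝ}

theorem re_two_mul_I_mul_nonpos (hk : 0 ≤ k.im) : (2 * Complex.I * k).re ≤ 0 := by
  simpa [Complex.mul_re, Complex.mul_im] using hk

theorem integrable_neg_conj_div_two (he : Integrable e) :
    Integrable fun s : ℝ => -(starRingEnd ℂ (e s) / 2) :=
  ((Complex.conjCLE.toContinuousLinearMap.integrable_comp he).div_const 2).neg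

theorem IsJostFamily.volB {Φ : ℂ → ℝ → ℂ} (hΦ : IsJostFamily Φ D) (he : Integrable e) :
    IsJostFamily (fun k => volB e k (Φ k)) ((∫ s, ‖e s / 2‖) * D) :=
  hΦ.volterra (by fun_prop) (fun _ hk => re_two_mul_I_mul_nonpos hk) (he.div_const 2)

theorem IsJostFamily.volC {Φ : ℂ → ℝ → ℂ} (hΦ : IsJostFamily Φ D) (he : Integrable e) :
    IsJostFamily (fun k => volC e (Φ k)) ((∫ s, ‖-(starRingEnd ℂ (e s) / 2)‖) * D) :=
  hΦ.volterra (c := fun _ => 0) (differentiable_const 0) (fun _ _ => le_rfl)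
    (integrable_neg_conj_div_two he)

theorem norm_volC_volB_le (he : Integrable e) (hk : 0 ≤ k.im) {A : ℝ} (hA : 0 ≤ A)
    (hf : ∀ s, ‖f s‖ ≤ A * volterraWeight (fun s => ‖e s‖ / 2) s) (t : ℝ) :
    ‖volC e (volB e k f) t‖ ≤ A / 4 * volterraWeight (fun s => ‖e s‖ / 2) t := by
  have hm : Integrable fun s => ‖e s‖ / 2 := he.norm.div_const 2
  have hB := norm_volterra_le_volterraWeight (v := fun s => e s / 2) (re_two_mul_I_mul_nonpos hk)
    hm (fun s => by rw [norm_div, Complex.norm_ofNat]) hA hf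
  refine (norm_volterra_le_volterraWeight (c := 0) (v := fun s => -(starRingEnd ℂ (e s) / 2)) le_rfl
    hm (fun s => by rw [norm_neg, norm_div, RCLike.norm_conj, Complex.norm_ofNat])
    (by positivity) hB t).trans (le_of_eq ?_)
  ring

theorem norm_neumannTerm_le_volterraWeight (he : Integrable e) (hk : 0 ≤ k.im) (n : ℕ) (t : ℝ) :
    ‖neumannTerm e k n t‖ ≤ (1 / 4) ^ n * volterraWeight (fun s => ‖e s‖ / 2) t := by
  induction n generalizing t with
  | zero =>
    simpa only [neumannTerm, norm_one, pow_zero, one_mul] using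
      one_le_volterraWeight (fun s => by positivity) t
  | succ n ih =>
    refine (norm_volC_volB_le he hk (by positivity) ih t).trans (le_of_eq ?_)
    ring

theorem isJostFamily_neumannTerm (he : Integrable e) (n : ℕ) :
    IsJostFamily (fun k => neumannTerm e k n) ((1 / 4) ^ n * Real.exp (2 * ∫ s, ‖e s‖ / 2)) := by
  have hbd : ∀ n, ∀ k : ℂ, 0 ≤ k.im → ∀ t,
      ‖neumannTerm e k n t‖ ≤ (1 / 4) ^ n * Real.exp (2 * ∫ s, ‖e s‖ / 2) := fun n k hk t =>
    (norm_neumannTerm_le_volterraWeight he hk n t).trans (mul_le_mul_of_nonneg_left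
      (volterraWeight_le (he.norm.div_const 2) (fun s => by positivity) t) (by positivity))
  induction n with
  | zero =>
    exact ⟨fun k _ => continuous_const, hbd 0, fun _ => continuousOn_const,
      fun _ => differentiableOn_const _⟩
  | succ n ih =>
    have hCB := (ih.volB he).volC he
    exact ⟨hCB.continuous, hbd (n + 1), hCB.continuousOn, hCB.differentiableOn⟩

theorem summable_geometric_quarter (K : ℝ) : Summable fun n : ℕ => (1 / 4 : ℝ) ^ n * K :=
  (summable_geometric_of_lt_one (by norm_num) (by norm_num)).mul_right K

theorem exists_isJostFamily_psiTwo (he : Integrable e) : ∃ D, IsJostFamily (psiTwo e) D := by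
  have hterm := isJostFamily_neumannTerm he
  have hsum := summable_geometric_quarter (Real.exp (2 * ∫ s, ‖e s‖ / 2))
  refine ⟨_, fun k hk => continuous_tsum (fun n => (hterm n).continuous k hk) hsum
      fun n t => (hterm n).norm_le k hk t,
    fun k hk t => tsum_of_norm_bounded hsum.hasSum fun n => (hterm n).norm_le k hk t,
    fun t => continuousOn_tsum (fun n => (hterm n).continuousOn t) hsum
      fun n k hk => (hterm n).norm_le k hk t,
    fun t => Complex.differentiableOn_tsum_of_summable_norm hsum
      (fun n => (hterm n).differentiableOn t) isOpen_upper
      fun n k hk => (hterm n).norm_le k (le_of_lt hk) t⟩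

theorem exists_isJostFamily_psiOne (he : Integrable e) : ∃ D, IsJostFamily (psiOne e) D :=
  let ⟨_, hD⟩ := exists_isJostFamily_psiTwo he
  ⟨_, hD.volB he⟩

theorem psiTwo_eq (he : Integrable e) (hk : 0 ≤ k.im) :
    psiTwo e k = 1 + volC e (psiOne e k) := by
  have hterm := isJostFamily_neumannTerm he
  have hBterm := fun n => (hterm n).volB he
  have hsum := summable_geometric_quarter (Real.exp (2 * ∫ s, ‖e s‖ / 2))
  have hpsiOne : psiOne e k = fun t => ∑' n, volB e k (neumannTerm e k n) t :=
    volterra_tsum (re_two_mul_I_mul_nonpos hk) (he.div_const 2) hsum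
      (fun n => (hterm n).continuous k hk) fun n s => (hterm n).norm_le k hk s
  have hpsiOne' : volC e (psiOne e k) = fun t => ∑' n, neumannTerm e k (n + 1) t := by
    rw [hpsiOne]
    exact volterra_tsum (c := 0) le_rfl (integrable_neg_conj_div_two he) (hsum.mul_left _)
      (fun n => (hBterm n).continuous k hk) fun n s => (hBterm n).norm_le k hk s
  ext t
  rw [psiTwo, (Summable.of_norm_bounded hsum
    fun n => (hterm n).norm_le k hk t).tsum_eq_zero_add, hpsiOne']
  rfl

theorem eq_psiTwo_of_eq_one_add_volC_volB (he : Integrable e) (hk : 0 ≤ k.im) (hf : Continuous f)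
    (hfD : ∀ s, ‖f s‖ ≤ D) (heq : f = 1 + volC e (volB e k f)) : f = psiTwo e k := by
  obtain ⟨D', hΦ⟩ := exists_isJostFamily_psiTwo he
  have hg := hΦ.continuous k hk
  have hgD := hΦ.norm_le k hk
  have hre := re_two_mul_I_mul_nonpos hk
  have he2 := he.div_const 2
  have hfix : f - psiTwo e k = volC e (volB e k (f - psiTwo e k)) := by
    rw [volB, ← volterra_sub hre he2 hf hfD hg hgD, volC, ← volterra_sub (c := 0) le_rfl
      (integrable_neg_conj_div_two he) (continuous_volterra hre he2 hf hfD)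
      (norm_volterra_le_const hre he2 hfD) (continuous_volterra hre he2 hg hgD)
      (norm_volterra_le_const hre he2 hgD)]
    conv_lhs => rw [heq, psiTwo_eq he hk]
    rw [add_sub_add_left_eq_sub]
    rfl
  have hDD : 0 ≤ D + D' := add_nonneg ((norm_nonneg _).trans (hfD 0))
    ((norm_nonneg _).trans (hgD 0))
  have hiter : ∀ n : ℕ, ∀ t, ‖(f - psiTwo e k) t‖ ≤
      (D + D') * (1 / 4) ^ n * volterraWeight (fun s => ‖e s‖ / 2) t := by
    intro n
    induction n with
    | zero =>
      intro t
      rw [pow_zero, mul_one]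
      exact (norm_sub_le_of_le (hfD t) (hgD t)).trans
        (le_mul_of_one_le_right hDD (one_le_volterraWeight (fun s => by positivity) t))
    | succ n ih =>
      intro t
      rw [hfix]
      refine (norm_volC_volB_le he hk (by positivity) ih t).trans (le_of_eq ?_)
      ring
  have hlim : ∀ t, Tendsto (fun n : ℕ => (D + D') * (1 / 4) ^ n *
      volterraWeight (fun s => ‖e s‖ / 2) t) atTop (𝓝 0) := fun t => by
    simpa only [mul_zero, zero_mul] using ((tendsto_pow_atTop_nhds_zero_of_lt_one
      (by norm_num : (0 : ℝ) ≤ 1 / 4) (by norm_num)).const_mul (D + D')).mul_const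
        (volterraWeight (fun s => ‖e s‖ / 2) t)
  exact sub_eq_zero.1 (funext fun t =>
    norm_le_zero_iff.1 (ge_of_tendsto' (hlim t) fun n => hiter n t))

end NeumannSeries

/-! ### The spectral functions -/

/-- `u` solves the scalar linear equation `u' = c u + g` on `[0, ∞)`, in integrated form. -/
def IsLinearSolution (c : ℂ) (g u : ℝ → ℂ) : Prop :=
  ∀ t : ℝ, 0 ≤ t → u t = u 0 + ∫ s in (0 : ℝ)..t, (c * u s + g s)

section LinearSolution

variable {c d : ℂ} {g g' u u' v f : ℝ → ℂ} {D : ℝ}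

theorem IsLinearSolution.congr (h : IsLinearSolution c g u) (hg : EqOn g g' (Ioi 0))
    (hu : EqOn u u' (Ici 0)) : IsLinearSolution c g' u' := by
  intro t ht
  rw [← hu ht, ← hu self_mem_Ici, h t ht]
  congr 1
  refine intervalIntegral.integral_congr_ae (Eventually.of_forall fun s hs => ?_)
  rw [uIoc_of_le ht] at hs
  rw [hg hs.1, hu hs.1.le]

theorem intervalIntegrable_linear (hu : ContinuousOn u (Ici 0))
    (hg : LocallyIntegrableOn g (Ici 0)) (c : ℂ) {t : ℝ} (ht : 0 ≤ t) :
    IntervalIntegrable (fun s => c * u s + g s) volume 0 t := by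
  have hsub : uIcc 0 t ⊆ Ici 0 := by rw [uIcc_of_le ht]; exact Icc_subset_Ici_self
  refine ((hu.mono hsub).intervalIntegrable.const_mul c).add ?_
  rw [intervalIntegrable_iff_integrableOn_Icc_of_le ht, ← uIcc_of_le ht]
  exact hg.integrableOn_compact_subset hsub isCompact_uIcc

theorem IsLinearSolution.sub (hu : ContinuousOn u (Ici 0)) (hu' : ContinuousOn u' (Ici 0))
    (hg : LocallyIntegrableOn g (Ici 0)) (h : IsLinearSolution c g u)
    (h' : IsLinearSolution c g u') : IsLinearSolution c 0 (u - u') := by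
  intro t ht
  have hint := intervalIntegral.integral_sub (intervalIntegrable_linear hu hg c ht)
    (intervalIntegrable_linear hu' hg c ht)
  simp only [Pi.sub_apply, Pi.zero_apply, add_zero, mul_sub]
  simp only [add_sub_add_right_eq_sub] at hint
  rw [hint, h t ht, h' t ht]
  ring

theorem isLinearSolution_exp (d : ℂ) : IsLinearSolution d 0 fun s => Complex.exp (d * s) := by
  intro t _
  have hderiv : ∀ s : ℝ, HasDerivAt (fun s : ℝ => Complex.exp (d * s))
      (d * Complex.exp (d * s)) s := fun s => by
    have hlin : HasDerivAt (fun s : ℝ => d * (s : ℂ)) (d * 1) s :=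
      (Complex.ofRealCLM.hasDerivAt (x := s)).const_mul d
    simpa only [mul_one, mul_comm] using hlin.cexp
  simp only [Pi.zero_apply, add_zero]
  rw [intervalIntegral.integral_eq_sub_of_hasDerivAt (fun s _ => hderiv s)
    (Continuous.intervalIntegrable (by fun_prop) 0 t), add_sub_cancel]

theorem IsLinearSolution.exp_mul (hu : ContinuousOn u (Ici 0))
    (hg : LocallyIntegrableOn g (Ici 0)) (h : IsLinearSolution c g u) (d : ℂ) :
    IsLinearSolution (c + d) (fun s => Complex.exp (d * s) * g s)
      fun s => Complex.exp (d * s) * u s := by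
  intro t ht
  have hle : ∀ s ∈ uIcc 0 t, 0 ≤ s := fun s hs => by rw [uIcc_of_le ht] at hs; exact hs.1
  have hparts := integral_mul_add_mul_of_primitive (a := 0) (b := t)
    (u := fun s : ℝ => d * Complex.exp (d * s)) (Continuous.intervalIntegrable (by fun_prop) 0 t)
    (intervalIntegrable_linear hu hg c ht)
    (fun s hs => by simpa only [Pi.zero_apply, add_zero] using isLinearSolution_exp d s (hle s hs))
    fun s hs => h s (hle s hs)
  rw [← sub_eq_iff_eq_add', ← hparts]
  exact intervalIntegral.integral_congr fun s _ => by ring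

theorem exp_neg_mul_exp_mul_cancel (d z : ℂ) (s : ℝ) :
    Complex.exp (-d * s) * (Complex.exp (d * s) * z) = z := by
  rw [← mul_assoc, ← Complex.exp_add, neg_mul, neg_add_cancel, Complex.exp_zero, one_mul]

theorem isLinearSolution_exp_mul_iff (hu : ContinuousOn u (Ici 0))
    (hg : LocallyIntegrableOn g (Ici 0)) (d : ℂ) :
    IsLinearSolution (c + d) (fun s => Complex.exp (d * s) * g s)
      (fun s => Complex.exp (d * s) * u s) ↔ IsLinearSolution c g u := by
  refine ⟨fun h => ?_, fun h => h.exp_mul hu hg d⟩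
  have hexp : ContinuousOn (fun s : ℝ => Complex.exp (d * s)) (Ici 0) :=
    Continuous.continuousOn (by fun_prop)
  have h' := h.exp_mul (hexp.fun_mul hu)
    (hg.continuousOn_mul hexp isClosed_Ici.isLocallyClosed) (-d)
  simpa only [exp_neg_mul_exp_mul_cancel, add_neg_cancel_right] using h'

theorem tendsto_volterra_zero (hc : c.re ≤ 0) (hv : Integrable v) (hfD : ∀ s, ‖f s‖ ≤ D) :
    Tendsto (volterra c v f) atTop (𝓝 0) :=
  have hbound := hv.norm.mul_const D
  squeeze_zero_norm (fun _ => norm_volterra_le hc hfD hbound.integrableOn)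
    (tendsto_integral_Ioi_zero hbound)

theorem isLinearSolution_volterra (hc : c.re ≤ 0) (hv : Integrable v) (hf : Continuous f)
    (hfD : ∀ s, ‖f s‖ ≤ D) :
    IsLinearSolution (-c) (fun s => -(v s * f s)) (volterra c v f) := by
  set h : ℝ → ℂ := (Ioi 0).indicator fun s => Complex.exp (c * s) * v s * f s with hh
  have hint : Integrable h := by
    have hzero := integrableOn_volterra_integrand hc hv hf hfD 0
    simp only [Complex.ofReal_zero, sub_zero] at hzero
    exact hzero.integrable_indicator measurableSet_Ioi
  have hprim : IsLinearSolution 0 (fun s => -h s) fun t => ∫ s in Ioi t, h s := fun t _ => by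
    simp only [zero_mul, zero_add, intervalIntegral.integral_neg]
    rw [integral_Ioi_eq_sub hint 0 t, sub_eq_add_neg]
  have hmul := hprim.exp_mul (continuous_integral_Ioi hint).continuousOn
    (hint.neg.locallyIntegrable.locallyIntegrableOn _) (-c)
  rw [zero_add] at hmul
  refine hmul.congr (fun s hs => ?_) fun t ht => ?_
  · dsimp only
    rw [Pi.neg_apply, hh, indicator_of_mem hs, mul_neg, mul_assoc (Complex.exp _),
      exp_neg_mul_exp_mul_cancel]
  · dsimp only
    rw [volterra_eq_exp_mul, neg_mul]
    congr 1
    exact setIntegral_congr_fun measurableSet_Ioi fun s hs =>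
      indicator_of_mem (mem_Ioi.2 ((mem_Ici.1 ht).trans_lt hs)) _

/-- The decaying solution is unique because `e^{ct}` times the difference of two of them is
constant and tends to zero. -/
theorem IsLinearSolution.eqOn_volterra (hc : c.re ≤ 0) (hv : Integrable v) (hf : Continuous f)
    (hfD : ∀ s, ‖f s‖ ≤ D) (hu : ContinuousOn u (Ici 0))
    (h : IsLinearSolution (-c) (fun s => -(v s * f s)) u) (hlim : Tendsto u atTop (𝓝 0)) :
    EqOn u (volterra c v f) (Ici 0) := by
  have hV := (continuous_volterra hc hv hf hfD).continuousOn (s := Ici 0)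
  have hg : LocallyIntegrableOn (fun s => -(v s * f s)) (Ici 0) :=
    (hv.mul_bdd hf.aestronglyMeasurable
      (Eventually.of_forall hfD)).neg.locallyIntegrable.locallyIntegrableOn _
  set w := u - volterra c v f with hw
  have hconst : ∀ t : ℝ, 0 ≤ t → Complex.exp (c * t) * w t = w 0 := fun t ht => by
    have hexp := (IsLinearSolution.sub hu hV hg h (isLinearSolution_volterra hc hv hf hfD)).exp_mul
      (hu.sub hV) ((locallyIntegrable_const (0 : ℂ)).locallyIntegrableOn _) c t ht
    simpa only [neg_add_cancel, zero_mul, Pi.zero_apply, mul_zero, add_zero,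
      intervalIntegral.integral_zero, Complex.ofReal_zero, Complex.exp_zero, one_mul] using hexp
  have hw0 : Tendsto w atTop (𝓝 0) := by
    simpa only [sub_zero, ← Pi.sub_def, ← hw] using hlim.sub (tendsto_volterra_zero hc hv hfD)
  have hzero : w 0 = 0 := by
    refine norm_le_zero_iff.1 (ge_of_tendsto (tendsto_zero_iff_norm_tendsto_zero.1 hw0) ?_)
    filter_upwards [eventually_ge_atTop 0] with t ht
    have hexp := norm_exp_mul_sub_le_one hc ht
    rw [Complex.ofReal_zero, sub_zero] at hexp
    rw [← hconst t ht, norm_mul]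
    exact mul_le_of_le_one_left (norm_nonneg _) hexp
  refine fun t ht => sub_eq_zero.1 ?_
  exact (mul_eq_zero.1 ((hconst t ht).trans hzero)).resolve_left (Complex.exp_ne_zero _)

theorem volterra_congr (h : ∀ s, v s ≠ 0 → f s = g s) (c : ℂ) :
    volterra c v f = volterra c v g := by
  ext t
  refine integral_congr_ae (Eventually.of_forall fun s => ?_)
  by_cases hs : v s = 0
  · simp only [hs, mul_zero, zero_mul]
  · simp only [h s hs]

theorem volterra_zero_max (hv : ∀ s ≤ 0, v s = 0) (f : ℝ → ℂ) (t : ℝ) :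
    volterra 0 v f (max t 0) = volterra 0 v f t := by
  simp only [volterra, zero_mul, Complex.exp_zero, one_mul]
  refine (setIntegral_eq_of_subset_of_forall_sdiff_eq_zero measurableSet_Ioi
    (Ioi_subset_Ioi (le_max_left t 0)) fun s hs => ?_).symm
  have hs0 : s ≤ 0 := not_lt.1 fun h => hs.2 (max_lt hs.1 h)
  simp only [hv s hs0, zero_mul]

end LinearSolution

section Jost

variable {E : ℝ → ℂ} {k : ℂ}

theorem laxU_mulVec (e k : ℂ) (v : Fin 2 → ℂ) :
    (laxU e k).mulVec v = ![-(Complex.I * k) * v 0 + -(e / 2 * v 1),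
      Complex.I * k * v 1 + starRingEnd ℂ e / 2 * v 0] := by
  ext i
  fin_cases i
  · simp [laxU, laxH, sigma3, Matrix.mulVec, dotProduct, Fin.sum_univ_two]
    ring
  · simp [laxU, laxH, sigma3, Matrix.mulVec, dotProduct, Fin.sum_univ_two]
    ring_nf
    tauto

theorem locallyIntegrableOn_conj (hE : LocallyIntegrableOn E (Ici 0)) :
    LocallyIntegrableOn (fun s => starRingEnd ℂ (E s)) (Ici 0) := fun s hs =>
  let ⟨U, hU, hint⟩ := hE s hs
  ⟨U, hU, Complex.conjCLE.toContinuousLinearMap.integrable_comp hint⟩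

theorem locallyIntegrableOn_div_two_mul {f : ℝ → ℂ} (hE : LocallyIntegrableOn E (Ici 0))
    (hf : ContinuousOn f (Ici 0)) : LocallyIntegrableOn (fun s => E s / 2 * f s) (Ici 0) := by
  have hmul := hE.continuousOn_mul (hf.div_const 2) isClosed_Ici.isLocallyClosed
  exact hmul.congr (Eventually.of_forall fun s => by ring)

theorem laxEquation_iff (hE : LocallyIntegrableOn E (Ici 0)) {φ : ℝ → Fin 2 → ℂ}
    (hφ : ∀ i, ContinuousOn (fun s => φ s i) (Ici 0)) :
    (∀ t : ℝ, 0 ≤ t → φ t = φ 0 + ∫ s in (0 : ℝ)..t, (laxU (E s) k).mulVec (φ s)) ↔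
      IsLinearSolution (-(Complex.I * k)) (fun s => -(E s / 2 * φ s 1)) (fun s => φ s 0) ∧
      IsLinearSolution (Complex.I * k) (fun s => starRingEnd ℂ (E s) / 2 * φ s 0)
        (fun s => φ s 1) := by
  have hint : ∀ t : ℝ, 0 ≤ t → ∀ i, IntervalIntegrable
      (fun s => (laxU (E s) k).mulVec (φ s) i) volume 0 t := fun t ht i => by
    fin_cases i <;> simp only [laxU_mulVec]
    · exact intervalIntegrable_linear (hφ 0) (locallyIntegrableOn_div_two_mul hE (hφ 1)).neg _ ht
    · exact intervalIntegrable_linear (hφ 1)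
        (locallyIntegrableOn_div_two_mul (locallyIntegrableOn_conj hE) (hφ 0)) _ ht
  have hcomp : ∀ t : ℝ, 0 ≤ t → ∀ i, (∫ s in (0 : ℝ)..t, (laxU (E s) k).mulVec (φ s)) i =
      ∫ s in (0 : ℝ)..t, (laxU (E s) k).mulVec (φ s) i := fun t ht i => by
    simp only [intervalIntegral, Pi.sub_apply]
    rw [eval_integral fun j => (hint t ht j).1, eval_integral fun j => (hint t ht j).2]
  rw [IsLinearSolution, IsLinearSolution, ← forall₂_and]
  refine forall₂_congr fun t ht => ?_
  rw [funext_iff, Fin.forall_fin_two, Pi.add_apply, Pi.add_apply, hcomp t ht, hcomp t ht]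
  simp only [laxU_mulVec, Matrix.cons_val_zero, Matrix.cons_val_one]

/-- With the normalizing factor `e^{ikt}` split off, only the first component of the Jost column
oscillates. -/
theorem isJostColumn_exp_mul_iff (hE : LocallyIntegrableOn E (Ici 0)) {q f : ℝ → ℂ}
    (hq : ContinuousOn q (Ici 0)) (hf : ContinuousOn f (Ici 0)) :
    IsJostColumn E k (fun t => ![Complex.exp (Complex.I * k * t) * q t,
        Complex.exp (Complex.I * k * t) * f t]) ↔
      (IsLinearSolution (-(2 * Complex.I * k)) (fun s => -(E s / 2 * f s)) q ∧
        Tendsto q atTop (𝓝 0)) ∧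
      IsLinearSolution 0 (fun s => starRingEnd ℂ (E s) / 2 * q s) f ∧ Tendsto f atTop (𝓝 1) := by
  have hexp : ContinuousOn (fun s : ℝ => Complex.exp (Complex.I * k * s)) (Ici 0) :=
    Continuous.continuousOn (by fun_prop)
  set φ : ℝ → Fin 2 → ℂ := fun t => ![Complex.exp (Complex.I * k * t) * q t,
    Complex.exp (Complex.I * k * t) * f t] with hφdef
  have hφ : ∀ i, ContinuousOn (fun s => φ s i) (Ici 0) :=
    Fin.forall_fin_two.2 ⟨hexp.mul hq, hexp.mul hf⟩
  have heq := laxEquation_iff (k := k) hE hφ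
  have hone := isLinearSolution_exp_mul_iff (c := -(2 * Complex.I * k))
    (g := fun s => -(E s / 2 * f s)) hq
    (locallyIntegrableOn_div_two_mul hE hf).neg (Complex.I * k)
  have htwo := isLinearSolution_exp_mul_iff (c := 0) hf
    (locallyIntegrableOn_div_two_mul (locallyIntegrableOn_conj hE) hq) (Complex.I * k)
  rw [show -(2 * Complex.I * k) + Complex.I * k = -(Complex.I * k) by ring] at hone
  have hlim : Tendsto (fun t : ℝ => Complex.exp (-(Complex.I * k * t)) • φ t) atTop (𝓝 ![0, 1]) ↔
      Tendsto q atTop (𝓝 0) ∧ Tendsto f atTop (𝓝 1) := by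
    have hcancel := exp_neg_mul_exp_mul_cancel (Complex.I * k)
    simp only [neg_mul (Complex.I * k)] at hcancel
    simp only [tendsto_pi_nhds, Fin.forall_fin_two, hφdef, Pi.smul_apply, smul_eq_mul,
      Matrix.cons_val_zero, Matrix.cons_val_one, hcancel]
  simp only [mul_neg, mul_left_comm (Complex.exp _)] at hone
  simp only [zero_add, mul_left_comm (Complex.exp _)] at htwo
  have hjost : IsJostColumn E k φ ↔ (∀ t : ℝ, 0 ≤ t → φ t = φ 0 +
      ∫ s in (0 : ℝ)..t, (laxU (E s) k).mulVec (φ s)) ∧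
      Tendsto (fun t : ℝ => Complex.exp (-(Complex.I * k * t)) • φ t) atTop (𝓝 ![0, 1]) :=
    ⟨fun h => ⟨h.equation, h.normalization⟩, fun h => ⟨continuousOn_pi.2 hφ, h.1, h.2⟩⟩
  simp only [hφdef, Matrix.cons_val_zero, Matrix.cons_val_one] at heq
  rw [hjost, hlim, heq, hone, htwo]
  tauto

theorem locallyIntegrableOn_pulse (hE : IntegrableOn E (Ioi 0)) :
    LocallyIntegrableOn E (Ici 0) :=
  ((integrableOn_Ici_iff_integrableOn_Ioi (by simp)).2 hE).locallyIntegrableOn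

theorem isJostColumn_psi (hE : IntegrableOn E (Ioi 0)) (hk : 0 ≤ k.im) :
    IsJostColumn E k fun t => ![Complex.exp (Complex.I * k * t) *
      psiOne ((Ioi 0).indicator E) k t, Complex.exp (Complex.I * k * t) *
      psiTwo ((Ioi 0).indicator E) k t] := by
  have he : Integrable ((Ioi (0 : ℝ)).indicator E) := hE.integrable_indicator measurableSet_Ioi
  set e := (Ioi (0 : ℝ)).indicator E
  have heE : ∀ s ∈ Ioi (0 : ℝ), e s = E s := fun s hs => indicator_of_mem hs E
  obtain ⟨D₁, hone⟩ := exists_isJostFamily_psiOne he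
  obtain ⟨D₂, htwo⟩ := exists_isJostFamily_psiTwo he
  have hre := re_two_mul_I_mul_nonpos hk
  have hconj := integrable_neg_conj_div_two he
  rw [isJostColumn_exp_mul_iff (locallyIntegrableOn_pulse hE) (hone.continuous k hk).continuousOn
    (htwo.continuous k hk).continuousOn]
  refine ⟨⟨?_, tendsto_volterra_zero hre (he.div_const 2) (htwo.norm_le k hk)⟩, ?_, ?_⟩
  · refine (isLinearSolution_volterra hre (he.div_const 2) (htwo.continuous k hk)
      (htwo.norm_le k hk)).congr (fun s hs => ?_) fun s _ => rfl
    simp only [heE s hs]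
  · have hsol := isLinearSolution_volterra (c := 0) le_rfl hconj (hone.continuous k hk)
      (hone.norm_le k hk)
    intro t ht
    rw [psiTwo_eq he hk, Pi.add_apply, Pi.add_apply, volC, hsol t ht, ← add_assoc]
    congr 1
    refine intervalIntegral.integral_congr_ae (Eventually.of_forall fun s hs => ?_)
    rw [uIoc_of_le ht] at hs
    simp only [neg_zero, zero_mul, zero_add, neg_mul, neg_neg, heE s hs.1]
  · rw [psiTwo_eq he hk]
    have hlim := (tendsto_volterra_zero (c := 0) le_rfl hconj (hone.norm_le k hk)).const_add 1
    rwa [add_zero] at hlim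

theorem exists_bound_comp_max {f : ℝ → ℂ} (hf : ContinuousOn f (Ici 0)) {L : ℂ}
    (hL : Tendsto f atTop (𝓝 L)) : ∃ D, ∀ s, ‖f (max s 0)‖ ≤ D := by
  obtain ⟨T, hT⟩ := eventually_atTop.1 (hL.norm.eventually (gt_mem_nhds (lt_add_one ‖L‖)))
  obtain ⟨C, hC⟩ := (isCompact_Icc (a := (0 : ℝ)) (b := T)).exists_bound_of_continuousOn
    (hf.mono Icc_subset_Ici_self)
  refine ⟨max C (‖L‖ + 1), fun s => ?_⟩
  rcases le_total (max s 0) T with h | h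
  · exact (hC _ ⟨le_max_right s 0, h⟩).trans (le_max_left _ _)
  · exact (hT _ h).le.trans (le_max_right _ _)

theorem eqOn_volB_volC_of_isLinearSolution (hE : IntegrableOn E (Ioi 0)) (hk : 0 ≤ k.im)
    {q f : ℝ → ℂ} (hq : ContinuousOn q (Ici 0)) (hf : ContinuousOn f (Ici 0))
    (hqsol : IsLinearSolution (-(2 * Complex.I * k)) (fun s => -(E s / 2 * f s)) q)
    (hqlim : Tendsto q atTop (𝓝 0))
    (hfsol : IsLinearSolution 0 (fun s => starRingEnd ℂ (E s) / 2 * q s) f)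
    (hflim : Tendsto f atTop (𝓝 1)) :
    EqOn q (volB ((Ioi 0).indicator E) k fun s => f (max s 0)) (Ici 0) ∧
      EqOn f (fun t => 1 + volC ((Ioi 0).indicator E) (fun s => q (max s 0)) t) (Ici 0) := by
  have he : Integrable ((Ioi (0 : ℝ)).indicator E) := hE.integrable_indicator measurableSet_Ioi
  set e := (Ioi (0 : ℝ)).indicator E
  have heE : ∀ s ∈ Ioi (0 : ℝ), e s = E s := fun s hs => indicator_of_mem hs E
  have hmax : Continuous fun s : ℝ => max s 0 := by fun_prop
  have hpos : ∀ s ∈ Ioi (0 : ℝ), max s 0 = s := fun s hs => max_eq_left (le_of_lt hs)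
  obtain ⟨Dq, hDq⟩ := exists_bound_comp_max hq hqlim
  obtain ⟨Df, hDf⟩ := exists_bound_comp_max hf hflim
  constructor
  · refine IsLinearSolution.eqOn_volterra (re_two_mul_I_mul_nonpos hk) (he.div_const 2)
      (hf.comp_continuous hmax fun s => le_max_right s 0) hDf hq
      (hqsol.congr (fun s hs => ?_) fun s _ => rfl) hqlim
    simp only [heE s hs, hpos s hs]
  · have hfV : EqOn (fun s => f s - 1) (volC e fun s => q (max s 0)) (Ici 0) := by
      refine IsLinearSolution.eqOn_volterra (c := 0) le_rfl (integrable_neg_conj_div_two he)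
        (hq.comp_continuous hmax fun s => le_max_right s 0) hDq (hf.sub continuousOn_const)
        (fun t ht => ?_) (by simpa only [sub_self] using hflim.sub_const 1)
      rw [hfsol t ht, add_sub_right_comm]
      congr 1
      refine intervalIntegral.integral_congr_ae (Eventually.of_forall fun s hs => ?_)
      rw [uIoc_of_le ht] at hs
      simp only [neg_zero, zero_mul, neg_mul, neg_neg, heE s hs.1, hpos s hs.1]
    exact fun t ht => eq_add_of_sub_eq' (hfV ht)

theorem eq_psi_of_isLinearSolution (hE : IntegrableOn E (Ioi 0)) (hk : 0 ≤ k.im) {q f : ℝ → ℂ}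
    (hq : ContinuousOn q (Ici 0)) (hf : ContinuousOn f (Ici 0))
    (hqsol : IsLinearSolution (-(2 * Complex.I * k)) (fun s => -(E s / 2 * f s)) q)
    (hqlim : Tendsto q atTop (𝓝 0))
    (hfsol : IsLinearSolution 0 (fun s => starRingEnd ℂ (E s) / 2 * q s) f)
    (hflim : Tendsto f atTop (𝓝 1)) :
    q 0 = psiOne ((Ioi 0).indicator E) k 0 ∧ f 0 = psiTwo ((Ioi 0).indicator E) k 0 := by
  obtain ⟨hqV, hfV⟩ := eqOn_volB_volC_of_isLinearSolution hE hk hq hf hqsol hqlim hfsol hflim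
  have he : Integrable ((Ioi (0 : ℝ)).indicator E) := hE.integrable_indicator measurableSet_Ioi
  set e := (Ioi (0 : ℝ)).indicator E with hedef
  have hv : ∀ s ≤ 0, -(starRingEnd ℂ (e s) / 2) = 0 := fun s hs => by
    rw [hedef, indicator_of_notMem (notMem_Ioi.2 hs), map_zero, zero_div, neg_zero]
  set f' : ℝ → ℂ := fun s => f (max s 0) with hf'
  have hf'c : Continuous f' := hf.comp_continuous (by fun_prop) fun s => le_max_right s 0
  obtain ⟨Df, hDf⟩ := exists_bound_comp_max hf hflim
  have hqf : volC e (fun s => q (max s 0)) = volC e (volB e k f') := by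
    refine volterra_congr (fun s hs => ?_) 0
    have hs0 : 0 ≤ s := le_of_lt (not_le.1 fun h => hs (hv s h))
    rw [max_eq_left hs0, hqV hs0]
  have hfix : f' = 1 + volC e (volB e k f') := by
    rw [← hqf]
    ext t
    exact (hfV (le_max_right t 0)).trans (congrArg (1 + ·) (volterra_zero_max hv _ t))
  have hpsi : f' = psiTwo e k := eq_psiTwo_of_eq_one_add_volC_volB he hk hf'c hDf hfix
  constructor
  · rw [hqV self_mem_Ici, hpsi, psiOne]
  · rw [← hpsi, hf']
    dsimp only
    rw [max_self]

theorem IsJostColumn.apply_zero (hE : IntegrableOn E (Ioi 0)) (hk : 0 ≤ k.im)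
    {φ : ℝ → Fin 2 → ℂ} (h : IsJostColumn E k φ) :
    φ 0 = ![psiOne ((Ioi 0).indicator E) k 0, psiTwo ((Ioi 0).indicator E) k 0] := by
  set χ : Fin 2 → ℝ → ℂ := fun i t => Complex.exp (-(Complex.I * k) * t) * φ t i with hχdef
  have hχ : ∀ i, ContinuousOn (χ i) (Ici 0) := fun i =>
    ContinuousOn.mul (Continuous.continuousOn (by fun_prop))
      ((continuous_apply i).comp_continuousOn h.continuousOn)
  have hφ : φ = fun t : ℝ => ![Complex.exp (Complex.I * k * t) * χ 0 t,
      Complex.exp (Complex.I * k * t) * χ 1 t] := by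
    funext t
    have hcancel : ∀ z, Complex.exp (Complex.I * k * t) *
        (Complex.exp (-(Complex.I * k * t)) * z) = z := fun z => by
      simpa only [neg_neg, neg_mul] using exp_neg_mul_exp_mul_cancel (-(Complex.I * k)) z t
    ext i
    fin_cases i <;> simp [hχdef, hcancel]
  rw [hφ, isJostColumn_exp_mul_iff (locallyIntegrableOn_pulse hE) (hχ 0) (hχ 1)] at h
  obtain ⟨⟨hqsol, hqlim⟩, hfsol, hflim⟩ := h
  obtain ⟨hq, hf⟩ := eq_psi_of_isLinearSolution hE hk (hχ 0) (hχ 1) hqsol hqlim hfsol hflim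
  rw [hφ]
  dsimp only
  rw [hq, hf, Complex.ofReal_zero, mul_zero, Complex.exp_zero, one_mul, one_mul]

theorem jostAtZero_eq (hE : IntegrableOn E (Ioi 0)) (hk : 0 ≤ k.im) :
    jostAtZero E k = ![psiOne ((Ioi 0).indicator E) k 0, psiTwo ((Ioi 0).indicator E) k 0] := by
  have hex : ∃ φ, IsJostColumn E k φ := ⟨_, isJostColumn_psi hE hk⟩
  rw [jostAtZero, dif_pos hex]
  exact hex.choose_spec.apply_zero hE hk

theorem specA_eq (hE : IntegrableOn E (Ioi 0)) (hk : 0 ≤ k.im) :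
    specA E k = psiTwo ((Ioi 0).indicator E) k 0 := by
  rw [specA, jostAtZero_eq hE hk, Matrix.cons_val_one, Matrix.cons_val_fin_one]

theorem specB_eq (hE : IntegrableOn E (Ioi 0)) (hk : 0 ≤ k.im) :
    specB E k = psiOne ((Ioi 0).indicator E) k 0 := by
  rw [specB, jostAtZero_eq hE hk, Matrix.cons_val_zero]

end Jost

/-! ### The Riemann–Lebesgue lemma for the Jost column -/

section RiemannLebesgue

theorem mul_volterra_of_primitive {c : ℂ} (hc : c.re ≤ 0) {p p' : ℝ → ℂ} (hp : Integrable p)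
    (hp' : Integrable p') {t : ℝ} (hprim : ∀ s, p s = p t + ∫ r in t..s, p' r)
    (hlim : Tendsto p atTop (𝓝 0)) :
    c * volterra c p 1 t = -p t - volterra c p' 1 t := by
  set x : ℝ → ℂ := fun s => Complex.exp (c * (s - t))
  have hx : Continuous x := by fun_prop
  have hxd : ∀ s, HasDerivAt x (c * x s) s := fun s => by
    have h : HasDerivAt (fun s : ℝ => c * ((s : ℂ) - t)) (c * 1) s :=
      ((Complex.ofRealCLM.hasDerivAt (x := s)).sub_const (t : ℂ)).const_mul c
    simpa only [x, mul_one, mul_comm] using h.cexp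
  have hx' : Continuous fun s => c * x s := hx.const_mul c
  have hxprim : ∀ s, x s = x t + ∫ r in t..s, c * x r := fun s => by
    rw [intervalIntegral.integral_eq_sub_of_hasDerivAt (fun r _ => hxd r)
      (hx'.intervalIntegrable t s), add_sub_cancel]
  have hxt : x t = 1 := by simp only [x, sub_self, mul_zero, Complex.exp_zero]
  have hint := integrableOn_volterra_kernel hc hp t
  have hint' := integrableOn_volterra_kernel hc hp' t
  have hparts : ∀ T, ∫ s in t..T, (c * x s * p s + x s * p' s) = x T * p T - p t := fun T => by
    rw [integral_mul_add_mul_of_primitive (hx'.intervalIntegrable t T) hp'.intervalIntegrable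
      (fun s _ => hxprim s) fun s _ => hprim s, hxt, one_mul]
  have hsum : IntegrableOn (fun s => c * x s * p s + x s * p' s) (Ioi t) := by
    simpa only [mul_assoc] using! (hint.const_mul c).add hint'
  have hboundary : Tendsto (fun T => x T * p T) atTop (𝓝 0) := by
    refine squeeze_zero_norm' ?_ (tendsto_zero_iff_norm_tendsto_zero.1 hlim)
    filter_upwards [eventually_ge_atTop t] with T hT
    rw [norm_mul]
    exact mul_le_of_le_one_left (norm_nonneg _) (norm_exp_mul_sub_le_one hc hT)
  have heq : ∫ s in Ioi t, (c * x s * p s + x s * p' s) = 0 - p t :=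
    tendsto_nhds_unique (intervalIntegral_tendsto_integral_Ioi t hsum tendsto_id)
      ((hboundary.sub_const (p t)).congr fun T => (hparts T).symm)
  simp only [mul_assoc c] at heq
  rw [integral_add (hint.const_mul c) hint', integral_const_mul, zero_sub] at heq
  simp only [volterra, Pi.one_apply, mul_one]
  exact eq_sub_of_add_eq heq

theorem norm_mul_norm_volterra_le_of_primitive {c : ℂ} (hc : c.re ≤ 0) {p p' : ℝ → ℂ}
    (hp : Integrable p) (hp' : Integrable p') {t : ℝ}
    (hprim : ∀ s, p s = p t + ∫ r in t..s, p' r) (hlim : Tendsto p atTop (𝓝 0)) :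
    ‖c‖ * ‖volterra c p 1 t‖ ≤ ‖p t‖ + ∫ s, ‖p' s‖ := by
  rw [← norm_mul, mul_volterra_of_primitive hc hp hp' hprim hlim]
  refine (norm_sub_le _ _).trans (add_le_add (norm_neg _).le ?_)
  simpa only [mul_one] using norm_volterra_le_const (f := 1) (D := 1) hc hp'
    (fun _ => norm_one.le) t

variable {e : ℝ → ℂ} {k : ℂ}

theorem psiTwo_eq_add_integral (he : Integrable e) (hk : 0 ≤ k.im) (t s : ℝ) :
    psiTwo e k s = psiTwo e k t + ∫ r in t..s, starRingEnd ℂ (e r) / 2 * psiOne e k r := by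
  obtain ⟨D, hone⟩ := exists_isJostFamily_psiOne he
  have hint : Integrable fun r => -(starRingEnd ℂ (e r) / 2) * psiOne e k r :=
    (integrable_neg_conj_div_two he).mul_bdd (hone.continuous k hk).aestronglyMeasurable
      (Eventually.of_forall (hone.norm_le k hk))
  simp only [psiTwo_eq he hk, Pi.add_apply, Pi.one_apply, volC, volterra, zero_mul,
    Complex.exp_zero, one_mul]
  rw [integral_Ioi_eq_sub hint t s]
  simp only [neg_mul, intervalIntegral.integral_neg]
  ring

theorem norm_mul_norm_volterra_le_of_contDiff {c : ℂ} (hc : c.re ≤ 0) {η V v : ℝ → ℂ} {A D : ℝ}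
    (hη : HasCompactSupport η) (hη1 : ContDiff ℝ 1 η) (hA : ∀ s, ‖η s‖ ≤ A) (hV : Continuous V)
    (hD : ∀ s, ‖V s‖ ≤ D) (hv : Integrable v) {t : ℝ}
    (hprim : ∀ s, V s = V t + ∫ r in t..s, v r) :
    ‖c‖ * ‖volterra c η V t‖ ≤ A * D + ((∫ s, ‖deriv η s‖) * D + A * ∫ s, ‖v s‖) := by
  have hη' : Continuous (deriv η) := hη1.continuous_deriv le_rfl
  have hηi : Integrable η := hη1.continuous.integrable_of_hasCompactSupport hη
  have hη'i : Integrable (deriv η) := hη'.integrable_of_hasCompactSupport hη.deriv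
  have hηprim : ∀ s, η s = η t + ∫ r in t..s, deriv η r := fun s => by
    rw [intervalIntegral.integral_eq_sub_of_hasDerivAt
      (fun r _ => (hη1.differentiable one_ne_zero r).hasDerivAt) (hη'.intervalIntegrable t s),
      add_sub_cancel]
  have hleft : Integrable fun s => deriv η s * V s :=
    hη'i.mul_bdd hV.aestronglyMeasurable (Eventually.of_forall hD)
  have hright : Integrable fun s => η s * v s :=
    hv.bdd_mul hη1.continuous.aestronglyMeasurable (Eventually.of_forall hA)
  have hmain := norm_mul_norm_volterra_le_of_primitive hc (p := fun s => η s * V s) (t := t)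
    (hηi.mul_bdd hV.aestronglyMeasurable (Eventually.of_forall hD)) (hleft.add hright)
    (fun s => by
      simp only [Pi.add_apply]
      rw [integral_mul_add_mul_of_primitive (hη'.intervalIntegrable t s) hv.intervalIntegrable
        (fun r _ => hηprim r) (fun r _ => hprim r), add_sub_cancel])
    ((hη.mul_right.is_zero_at_infty).mono_left atTop_le_cocompact)
  have hint : ∫ s, ‖deriv η s * V s + η s * v s‖ ≤ (∫ s, ‖deriv η s‖) * D + A * ∫ s, ‖v s‖ := by
    have hleft' := hη'i.norm.mul_const D
    have hright' := hv.norm.const_mul A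
    rw [← integral_mul_const, ← integral_const_mul, ← integral_add hleft' hright']
    exact integral_mono (hleft.add hright).norm (hleft'.add hright') fun s => norm_add_le_of_le
      (norm_mul_le_of_le le_rfl (hD s)) (norm_mul_le_of_le (hA s) le_rfl)
  have hvol : volterra c (fun s => η s * V s) 1 t = volterra c η V t := by
    simp only [volterra, Pi.one_apply, mul_one, mul_assoc]
  rw [hvol] at hmain
  exact hmain.trans (add_le_add (norm_mul_le_of_le (hA t) (hD t)) hint)

theorem exists_norm_mul_norm_volterra_psiTwo_le (he : Integrable e) {η : ℝ → ℂ}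
    (hη : HasCompactSupport η) (hη1 : ContDiff ℝ 1 η) :
    ∃ C, ∀ k : ℂ, 0 ≤ k.im → ∀ t,
      ‖2 * Complex.I * k‖ * ‖volterra (2 * Complex.I * k) η (psiTwo e k) t‖ ≤ C := by
  obtain ⟨D₁, hone⟩ := exists_isJostFamily_psiOne he
  obtain ⟨D₂, htwo⟩ := exists_isJostFamily_psiTwo he
  obtain ⟨A, hA⟩ := hη.exists_bound_of_continuous hη1.continuous
  have hA0 : 0 ≤ A := (norm_nonneg _).trans (hA 0)
  have he2 : Integrable fun s => starRingEnd ℂ (e s) / 2 := by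
    simpa only [neg_neg] using (integrable_neg_conj_div_two he).fun_neg
  refine ⟨A * D₂ + ((∫ s, ‖deriv η s‖) * D₂ + A * ((∫ s, ‖starRingEnd ℂ (e s) / 2‖) * D₁)),
    fun k hk t => ?_⟩
  have hv : Integrable fun s => starRingEnd ℂ (e s) / 2 * psiOne e k s :=
    he2.mul_bdd (hone.continuous k hk).aestronglyMeasurable
      (Eventually.of_forall (hone.norm_le k hk))
  have hvle : ∫ s, ‖starRingEnd ℂ (e s) / 2 * psiOne e k s‖ ≤
      (∫ s, ‖starRingEnd ℂ (e s) / 2‖) * D₁ := by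
    rw [← integral_mul_const]
    exact integral_mono hv.norm (he2.norm.mul_const D₁) fun s =>
      norm_mul_le_of_le le_rfl (hone.norm_le k hk s)
  refine (norm_mul_norm_volterra_le_of_contDiff (re_two_mul_I_mul_nonpos hk) hη hη1 hA
    (htwo.continuous k hk) (htwo.norm_le k hk) hv (psiTwo_eq_add_integral he hk t)).trans ?_
  gcongr

theorem exists_contDiff_integral_norm_sub_le {v : ℝ → ℂ} (hv : Integrable v) {ε : ℝ}
    (hε : 0 < ε) :
    ∃ η : ℝ → ℂ, HasCompactSupport η ∧ ContDiff ℝ 1 η ∧ ∫ s, ‖v s - η s‖ ≤ ε := by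
  obtain ⟨η, hη, hη1, hle⟩ := (memLp_one_iff_integrable.2 hv).exist_eLpNorm_sub_le
    ENNReal.one_ne_top le_rfl hε
  have hint : Integrable (v - η) := hv.sub (hη1.continuous.integrable_of_hasCompactSupport hη)
  rw [eLpNorm_one_eq_lintegral_enorm, ← ofReal_integral_norm_eq_lintegral_enorm hint] at hle
  exact ⟨η, hη, hη1.of_le (mod_cast le_top), (ENNReal.ofReal_le_ofReal_iff hε.le).1 hle⟩

theorem volterra_sub_left {c : ℂ} (hc : c.re ≤ 0) {v w f : ℝ → ℂ} {D : ℝ}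
    (hv : Integrable v) (hw : Integrable w) (hf : Continuous f) (hfD : ∀ s, ‖f s‖ ≤ D) (t : ℝ) :
    volterra c (v - w) f t = volterra c v f t - volterra c w f t := by
  simp only [volterra]
  rw [← integral_sub (integrableOn_volterra_integrand hc hv hf hfD t)
    (integrableOn_volterra_integrand hc hw hf hfD t)]
  simp only [Pi.sub_apply, ← sub_mul, ← mul_sub]

theorem eventually_norm_psiOne_lt (he : Integrable e) {ε : ℝ} (hε : 0 < ε) :
    ∀ᶠ k in Bornology.cobounded ℂ ⊓ 𝓟 {k | 0 ≤ k.im}, ∀ t, ‖psiOne e k t‖ < ε := by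
  obtain ⟨D, htwo⟩ := exists_isJostFamily_psiTwo he
  have hD : 0 ≤ D := (norm_nonneg _).trans (htwo.norm_le 0 le_rfl 0)
  obtain ⟨δ, hδ, hδε⟩ := exists_pos_mul_lt (half_pos hε) D
  have he2 : Integrable fun s => e s / 2 := he.div_const 2
  obtain ⟨η, hη, hη1, hηe⟩ := exists_contDiff_integral_norm_sub_le he2 hδ
  have hηi : Integrable η := hη1.continuous.integrable_of_hasCompactSupport hη
  obtain ⟨C, hC⟩ := exists_norm_mul_norm_volterra_psiTwo_le he hη hη1
  rw [eventually_inf_principal]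
  filter_upwards [tendsto_norm_cobounded_atTop.eventually
    (eventually_gt_atTop (max 0 (C / ε)))] with k hlarge hk t
  have hk0 : 0 < ‖k‖ := (le_max_left _ _).trans_lt hlarge
  have hCk : C / ε < ‖k‖ := (le_max_right _ _).trans_lt hlarge
  have hre := re_two_mul_I_mul_nonpos hk
  have hfar : ‖volterra (2 * Complex.I * k) ((fun s => e s / 2) - η) (psiTwo e k) t‖ < ε / 2 :=
    calc _ ≤ (∫ s, ‖e s / 2 - η s‖) * D :=
          norm_volterra_le_const hre (he2.sub hηi) (htwo.norm_le k hk) t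
      _ ≤ D * δ := by rw [mul_comm]; gcongr
      _ < ε / 2 := hδε
  have hnear : ‖volterra (2 * Complex.I * k) η (psiTwo e k) t‖ ≤ ε / 2 := by
    have hle := hC k hk t
    rw [norm_mul, norm_mul, Complex.norm_I, Complex.norm_ofNat, mul_one] at hle
    rw [div_lt_iff₀ hε] at hCk
    nlinarith
  rw [psiOne, volB, ← sub_add_cancel (volterra _ (fun s => e s / 2) (psiTwo e k) t),
    ← volterra_sub_left hre he2 hηi (htwo.continuous k hk) (htwo.norm_le k hk)]
  exact (norm_add_le _ _).trans_lt (by linarith)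

end RiemannLebesgue

section SpectralFunctions

variable {E : ℝ → ℂ}

theorem tendsto_specB (hE : IntegrableOn E (Ioi 0)) :
    Tendsto (specB E) (Bornology.cobounded ℂ ⊓ 𝓟 {k | 0 ≤ k.im}) (𝓝 0) := by
  refine Metric.tendsto_nhds.2 fun ε hε => ?_
  filter_upwards [eventually_norm_psiOne_lt (hE.integrable_indicator measurableSet_Ioi) hε,
    mem_inf_of_right (mem_principal_self _)] with k hlt hk
  rw [dist_zero_right, specB_eq hE hk]
  exact hlt 0

theorem tendsto_specA (hE : IntegrableOn E (Ioi 0)) :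
    Tendsto (specA E) (Bornology.cobounded ℂ ⊓ 𝓟 {k | 0 ≤ k.im}) (𝓝 1) := by
  have he : Integrable ((Ioi (0 : ℝ)).indicator E) := hE.integrable_indicator measurableSet_Ioi
  refine Metric.tendsto_nhds.2 fun ε hε => ?_
  obtain ⟨δ, hδ, hδε⟩ := exists_pos_mul_lt hε
    (∫ s, ‖-(starRingEnd ℂ ((Ioi (0 : ℝ)).indicator E s) / 2)‖)
  filter_upwards [eventually_norm_psiOne_lt he hδ, mem_inf_of_right (mem_principal_self _)]
    with k hlt hk
  rw [specA_eq hE hk, psiTwo_eq he hk, Pi.add_apply, Pi.one_apply, dist_self_add_left]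
  exact (norm_volterra_le_const (c := 0) le_rfl (integrable_neg_conj_div_two he)
    (fun s => (hlt s).le) 0).trans_lt hδε

theorem continuousOn_specA (hE : IntegrableOn E (Ioi 0)) :
    ContinuousOn (specA E) {k | 0 ≤ k.im} :=
  let ⟨_, h⟩ := exists_isJostFamily_psiTwo (hE.integrable_indicator measurableSet_Ioi)
  (h.continuousOn 0).congr fun _ hk => specA_eq hE hk

theorem continuousOn_specB (hE : IntegrableOn E (Ioi 0)) :
    ContinuousOn (specB E) {k | 0 ≤ k.im} :=
  let ⟨_, h⟩ := exists_isJostFamily_psiOne (hE.integrable_indicator measurableSet_Ioi)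
  (h.continuousOn 0).congr fun _ hk => specB_eq hE hk

theorem differentiableOn_specA (hE : IntegrableOn E (Ioi 0)) :
    DifferentiableOn ℂ (specA E) {k | 0 < k.im} :=
  let ⟨_, h⟩ := exists_isJostFamily_psiTwo (hE.integrable_indicator measurableSet_Ioi)
  (h.differentiableOn 0).congr fun _ hk => specA_eq hE (le_of_lt hk)

theorem differentiableOn_specB (hE : IntegrableOn E (Ioi 0)) :
    DifferentiableOn ℂ (specB E) {k | 0 < k.im} :=
  let ⟨_, h⟩ := exists_isJostFamily_psiOne (hE.integrable_indicator measurableSet_Ioi)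
  (h.differentiableOn 0).congr fun _ hk => specB_eq hE (le_of_lt hk)

end SpectralFunctions

/-! ### Transvections -/

section Transvection

open Matrix

variable {n : Type*} [DecidableEq n] {i j : n}

theorem differentiable_transvection_apply (i j k l : n) :
    Differentiable ℂ fun c : ℂ => transvection i j c k l := by
  simp only [transvection, Matrix.add_apply, single_apply]
  split_ifs <;> fun_prop

theorem continuous_transvection (i j : n) : Continuous (transvection (R := ℂ) i j) :=
  continuous_matrix fun k l => (differentiable_transvection_apply i j k l).continuous

theorem norm_transvection_sub_one_apply_le (i j k l : n) (c : ℂ) :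
    ‖transvection i j c k l - (1 : Matrix n n ℂ) k l‖ ≤ ‖c‖ := by
  simp only [transvection, Matrix.add_apply, add_sub_cancel_left, single_apply]
  split_ifs <;> simp

theorem inv_transvection [Fintype n] (h : i ≠ j) (c : ℂ) :
    (transvection i j c)⁻¹ = transvection i j (-c) :=
  inv_eq_right_inv (by
    rw [transvection_mul_transvection_same _ _ h, add_neg_cancel, transvection_zero])

theorem transvection_zero_one (c : ℂ) : transvection (0 : Fin 2) 1 c = !![1, c; 0, 1] := by
  ext k l; fin_cases k <;> fin_cases l <;> simp [transvection]

theorem transvection_one_zero (c : ℂ) : transvection (1 : Fin 2) 0 c = !![1, 0; c, 1] := by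
  ext k l; fin_cases k <;> fin_cases l <;> simp [transvection]

end Transvection

namespace BoundedAlong

variable {M N : ℂ → Matrix (Fin 2) (Fin 2) ℂ} {l l' : Filter ℂ}

theorem mono (h : BoundedAlong M l') (hl : l ≤ l') : BoundedAlong M l :=
  fun i j => (h i j).mono hl

theorem congr (h : BoundedAlong M l) (hMN : M =ᶠ[l] N) : BoundedAlong N l := fun i j =>
  (h i j).congr' (hMN.mono fun k hk => by simp only [hk]) EventuallyEq.rfl

theorem sup (h : BoundedAlong M l) (h' : BoundedAlong M l') : BoundedAlong M (l ⊔ l') :=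
  fun i j => (h i j).sup (h' i j)

theorem mul (hM : BoundedAlong M l) (hN : BoundedAlong N l) :
    BoundedAlong (fun k => M k * N k) l := fun i j => by
  simpa only [Matrix.mul_apply, Fin.sum_univ_two, mul_one] using
    ((hM i 0).mul (hN 0 j)).add ((hM i 1).mul (hN 1 j))

theorem of_tendsto {L : Matrix (Fin 2) (Fin 2) ℂ} (h : Tendsto M l (𝓝 L)) : BoundedAlong M l :=
  fun i j => (tendsto_pi_nhds.1 (tendsto_pi_nhds.1 h i) j).isBigO_one ℝ

theorem transvection {g : ℂ → ℂ} (hg : g =O[l] fun _ => (1 : ℝ)) (i j : Fin 2) :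
    BoundedAlong (fun k => Matrix.transvection i j (g k)) l := fun m n => by
  have hsub : (fun k => Matrix.transvection i j (g k) m n - (1 : Matrix (Fin 2) (Fin 2) ℂ) m n)
      =O[l] fun _ => (1 : ℝ) :=
    (isBigO_of_le l fun k => norm_transvection_sub_one_apply_le i j m n (g k)).trans hg
  simpa using hsub.add (isBigO_const_const ((1 : Matrix (Fin 2) (Fin 2) ℂ) m n) one_ne_zero l)

end BoundedAlong

/-! ### The exponentials -/

section Exponentials

variable {t x : ℝ} {k : ℂ}

theorem theta_im (t x : ℝ) (k : ℂ) :
    (theta t x k).im = k.im * (t - x + x / (4 * ‖k‖ ^ 2)) := by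
  have hinv : (1 / (4 * k)).im = -(k.im / (4 * ‖k‖ ^ 2)) := by
    have h4 : (4 * k)⁻¹ = ((4⁻¹ : ℝ) : ℂ) * k⁻¹ := by push_cast; exact mul_inv _ _
    rw [one_div, h4, Complex.im_ofReal_mul, Complex.inv_im, Complex.normSq_eq_norm_sq]
    ring
  simp only [theta, Complex.sub_im, Complex.im_mul_ofReal, Complex.add_im, hinv]
  ring

theorem norm_eMinus (t x : ℝ) (k : ℂ) :
    ‖eMinus t x k‖ = Real.exp (2 * (k.im * (t - x + x / (4 * ‖k‖ ^ 2)))) := by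
  rw [eMinus, Complex.norm_exp, ← theta_im]
  simp

theorem norm_ePlus (t x : ℝ) (k : ℂ) :
    ‖ePlus t x k‖ = Real.exp (-(2 * (k.im * (t - x + x / (4 * ‖k‖ ^ 2))))) := by
  rw [ePlus, Complex.norm_exp, ← theta_im]
  simp

theorem eMinus_mul_ePlus (t x : ℝ) (k : ℂ) : eMinus t x k * ePlus t x k = 1 := by
  rw [eMinus, ePlus, ← Complex.exp_add, neg_add_cancel, Complex.exp_zero]

theorem theta_conj (t x : ℝ) (k : ℂ) :
    theta t x (starRingEnd ℂ k) = starRingEnd ℂ (theta t x k) := by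
  simp [theta, Complex.conj_ofNat]

theorem schwarz_eMinus (t x : ℝ) : schwarz (eMinus t x) = ePlus t x := by
  ext k
  rw [schwarz, eMinus, ePlus, ← Complex.exp_conj, theta_conj]
  simp [Complex.conj_ofNat]

theorem schwarz_ePlus (t x : ℝ) : schwarz (ePlus t x) = eMinus t x := by
  ext k
  rw [schwarz, eMinus, ePlus, ← Complex.exp_conj, theta_conj]
  simp [Complex.conj_ofNat]

theorem norm_eMinus_le (hx : 0 ≤ x) (hk : 1 / 2 ≤ ‖k‖) :
    ‖eMinus t x k‖ ≤ Real.exp x * Real.exp (-(2 * (x - t) * k.im)) := by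
  have hquot : k.im / ‖k‖ ^ 2 ≤ 2 := by
    rw [div_le_iff₀ (by positivity)]
    nlinarith [(le_abs_self _).trans (Complex.abs_im_le_norm k)]
  have hexp : 2 * (k.im * (t - x + x / (4 * ‖k‖ ^ 2)))
      = x / 2 * (k.im / ‖k‖ ^ 2) - 2 * (x - t) * k.im := by ring
  rw [norm_eMinus, ← Real.exp_add, Real.exp_le_exp, hexp]
  linarith [mul_le_mul_of_nonneg_left hquot (div_nonneg hx zero_le_two)]

theorem norm_eMinus_le_exp (hx : 0 ≤ x) (htx : t ≤ x) (hk : 0 ≤ k.im) (hk2 : 1 / 2 ≤ ‖k‖) :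
    ‖eMinus t x k‖ ≤ Real.exp x := by
  refine (norm_eMinus_le hx hk2).trans (mul_le_of_le_one_right (Real.exp_pos _).le ?_)
  rw [Real.exp_le_one_iff, neg_nonpos]
  exact mul_nonneg (mul_nonneg zero_le_two (sub_nonneg.2 htx)) hk

theorem isBigO_eMinus_cobounded (hx : 0 ≤ x) (htx : t ≤ x) :
    eMinus t x =O[Bornology.cobounded ℂ ⊓ 𝓟 {k | 0 ≤ k.im}] fun _ => (1 : ℝ) := by
  refine IsBigO.of_bound (Real.exp x) (eventually_inf_principal.2 ?_)
  filter_upwards [(tendsto_norm_cobounded_atTop (E := ℂ)).eventually_ge_atTop (1 / 2)]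
    with k hk him
  simpa using norm_eMinus_le_exp hx htx him hk

/-- As `x > 0`, the term `x / (4 k)` dominates the phase near the origin. -/
theorem isBigO_ePlus_nhds_zero (hx : 0 < x) :
    ePlus t x =O[𝓝[{k | 0 ≤ k.im}] 0] fun _ => (1 : ℝ) := by
  have hsmall : ∀ᶠ k : ℂ in 𝓝 0, 4 * ‖k‖ ^ 2 * (x - t) < x :=
    (by fun_prop : Continuous fun k : ℂ => 4 * ‖k‖ ^ 2 * (x - t)).tendsto 0
      |>.eventually_lt_const (by simpa using hx)
  refine IsBigO.of_bound 1 ?_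
  filter_upwards [nhdsWithin_le_nhds hsmall, self_mem_nhdsWithin] with k hk him
  rw [norm_one, mul_one, norm_ePlus, Real.exp_le_one_iff, neg_nonpos]
  rcases eq_or_ne k 0 with rfl | hk0
  · simp
  have hphase : x - t ≤ x / (4 * ‖k‖ ^ 2) := by
    rw [le_div_iff₀ (by have := norm_pos_iff.2 hk0; positivity)]
    linarith
  exact mul_nonneg zero_le_two (mul_nonneg him (by linarith))

theorem differentiableAt_theta (t x : ℝ) (hk : k ≠ 0) : DifferentiableAt ℂ (theta t x) k := by
  have hk4 : 4 * k ≠ 0 := mul_ne_zero (by norm_num) hk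
  unfold theta
  fun_prop (disch := assumption)

theorem differentiableAt_eMinus (t x : ℝ) (hk : k ≠ 0) : DifferentiableAt ℂ (eMinus t x) k :=
  (((differentiableAt_theta t x hk).const_mul _).neg).cexp

theorem differentiableAt_ePlus (t x : ℝ) (hk : k ≠ 0) : DifferentiableAt ℂ (ePlus t x) k :=
  ((differentiableAt_theta t x hk).const_mul _).cexp

end Exponentials

/-! ### The four domains -/

theorem isOpen_OmegaP : IsOpen OmegaP :=
  isOpen_upper.inter (isOpen_lt continuous_const continuous_norm)

theorem isOpen_DP : IsOpen DP :=
  isOpen_upper.inter (isOpen_lt continuous_norm continuous_const)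

theorem OmegaM_eq : OmegaM = starRingEnd ℂ ⁻¹' OmegaP := by
  ext k; simp [OmegaM, OmegaP]

theorem DM_eq : DM = starRingEnd ℂ ⁻¹' DP := by
  ext k; simp [DM, DP]

theorem closure_OmegaP_subset : closure OmegaP ⊆ {k | 0 ≤ k.im} ∩ {k | 1 / 2 ≤ ‖k‖} :=
  closure_minimal (fun _ hk => ⟨hk.1.le, hk.2.le⟩)
    ((isClosed_le continuous_const Complex.continuous_im).inter
      (isClosed_le continuous_const continuous_norm))

theorem closure_DP_subset : closure DP ⊆ {k | 0 ≤ k.im} ∩ {k | ‖k‖ ≤ 1 / 2} :=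
  closure_minimal (fun _ hk => ⟨hk.1.le, hk.2.le⟩)
    ((isClosed_le continuous_const Complex.continuous_im).inter
      (isClosed_le continuous_norm continuous_const))

theorem zero_notMem_closure_OmegaP : 0 ∉ closure OmegaP := fun h => by
  have := (closure_OmegaP_subset h).2
  norm_num at this

theorem zero_notMem_closure_OmegaM : 0 ∉ closure OmegaM := fun h => by
  rw [OmegaM_eq] at h
  exact zero_notMem_closure_OmegaP
    (by simpa using Complex.continuous_conj.closure_preimage_subset OmegaP h)

theorem compl_contour_eq : contourᶜ = OmegaP ∪ OmegaM ∪ (DP ∪ DM) := by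
  ext k
  simp only [contour, OmegaP, OmegaM, DP, DM, mem_compl_iff, mem_union, mem_ofPred_eq]
  constructor
  · intro h
    push Not at h
    rcases lt_or_gt_of_ne h.1 with him | him <;> rcases lt_or_gt_of_ne h.2 with hk | hk <;> tauto
  · rintro ((h | h) | (h | h)) (him | hk) <;> linarith [h.1, h.2]

/-! ### Schwarz reflection -/

theorem tendsto_conj_nhdsWithin (S : Set ℂ) (p : ℂ) :
    Tendsto (starRingEnd ℂ) (𝓝[starRingEnd ℂ ⁻¹' S] p) (𝓝[S] (starRingEnd ℂ p)) :=
  Complex.continuous_conj.continuousWithinAt.tendsto_nhdsWithin (mapsTo_preimage _ S)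

theorem tendsto_conj_cobounded (S : Set ℂ) :
    Tendsto (starRingEnd ℂ) (Bornology.cobounded ℂ ⊓ 𝓟 (starRingEnd ℂ ⁻¹' S))
      (Bornology.cobounded ℂ ⊓ 𝓟 S) :=
  Complex.conjLIE.antilipschitz.tendsto_cobounded.inf
    (tendsto_principal_principal.2 fun _ hk => hk)

theorem conj_preimage_mem_codiscrete {S : Set ℂ} (hS : S ∈ codiscrete ℂ) :
    starRingEnd ℂ ⁻¹' S ∈ codiscrete ℂ := by
  simp only [mem_codiscrete, disjoint_principal_right, compl_compl] at hS ⊢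
  intro p
  have hpunctured : starRingEnd ℂ ⁻¹' {starRingEnd ℂ p}ᶜ = {p}ᶜ := by
    ext k; simp [(starRingEnd ℂ).injective.eq_iff]
  have h := tendsto_conj_nhdsWithin {starRingEnd ℂ p}ᶜ p
  rw [hpunctured] at h
  exact h (hS _)

theorem isBigO_schwarz {E : Type*} [Norm E] {f : ℂ → ℂ} {g : ℂ → E} {l l' : Filter ℂ}
    (h : f =O[l] g) (hl : Tendsto (starRingEnd ℂ) l' l) :
    schwarz f =O[l'] (g ∘ starRingEnd ℂ) :=
  (isBigO_of_le _ fun _ => (Complex.norm_conj _).le).trans (h.comp_tendsto hl)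

/-! ### Entries of the triangular factors -/

/-- `g` can be the nontrivial entry of a triangular factor on the domain `S`: it is holomorphic in
`S` and continuous up to the boundary off the pole set `Z`, has polar part `P z` at `z ∈ Z`, and is
bounded near the essential singularity `0` of the phase. Conditions at points outside the closure
of `S` are void. -/
structure IsFactorEntry (S Z : Set ℂ) (g : ℂ → ℂ) (P : ℂ → ℂ → ℂ) : Prop where
  isOpen : IsOpen S
  differentiableAt : ∀ k ∈ S, k ∉ Z → DifferentiableAt ℂ g k
  continuousWithinAt : ∀ p ∉ Z, p ≠ 0 → ContinuousWithinAt g S p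
  isBigO_zero : g =O[𝓝[S] 0] fun _ => (1 : ℝ)
  isBigO_sub : ∀ z ∈ Z, (fun k => g k - P z k) =O[𝓝[S \ {z}] z] fun _ => (1 : ℝ)

theorem IsFactorEntry.isBigO_one {S Z : Set ℂ} {g : ℂ → ℂ} {P : ℂ → ℂ → ℂ}
    (h : IsFactorEntry S Z g P) {p : ℂ} (hp : p ∉ Z) : g =O[𝓝[S] p] fun _ => (1 : ℝ) := by
  rcases eq_or_ne p 0 with rfl | hp0
  · exact h.isBigO_zero
  · exact (h.continuousWithinAt p hp hp0).isBigO_one ℝ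

theorem IsFactorEntry.neg {S Z : Set ℂ} {g : ℂ → ℂ} {P : ℂ → ℂ → ℂ}
    (h : IsFactorEntry S Z g P) :
    IsFactorEntry S Z (fun k => -g k) (fun z k => -P z k) where
  isOpen := h.isOpen
  differentiableAt k hk hkZ := (h.differentiableAt k hk hkZ).neg
  continuousWithinAt p hp hp0 := (h.continuousWithinAt p hp hp0).neg
  isBigO_zero := h.isBigO_zero.neg_left
  isBigO_sub z hz := (h.isBigO_sub z hz).neg_left.congr_left fun _ => neg_sub' _ _

theorem IsFactorEntry.schwarz {S Z : Set ℂ} {g : ℂ → ℂ} {P : ℂ → ℂ → ℂ}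
    (h : IsFactorEntry S Z g P) :
    IsFactorEntry (starRingEnd ℂ ⁻¹' S) (starRingEnd ℂ ⁻¹' Z) (fun k => -schwarz g k)
      (fun z k => -MaxwellBloch.schwarz (P (starRingEnd ℂ z)) k) where
  isOpen := h.isOpen.preimage Complex.continuous_conj
  differentiableAt k hk hkZ := by
    have hconj := (h.differentiableAt _ hk hkZ).conj_conj
    rw [Complex.conj_conj] at hconj
    exact hconj.neg
  continuousWithinAt p hpZ hp0 :=
    (Complex.continuous_conj.continuousAt.comp_continuousWithinAt
      ((h.continuousWithinAt _ hpZ (by simpa using hp0)).comp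
        Complex.continuous_conj.continuousWithinAt (mapsTo_preimage _ S))).neg
  isBigO_zero := by
    have h0 := tendsto_conj_nhdsWithin S 0
    rw [map_zero] at h0
    exact (isBigO_schwarz h.isBigO_zero h0).neg_left
  isBigO_sub z hz := by
    have hset : starRingEnd ℂ ⁻¹' (S \ {starRingEnd ℂ z}) = starRingEnd ℂ ⁻¹' S \ {z} := by
      ext k
      simp [(starRingEnd ℂ).injective.eq_iff]
    have hreflect := isBigO_schwarz (h.isBigO_sub _ hz) (tendsto_conj_nhdsWithin _ _)
    rw [hset] at hreflect
    refine hreflect.neg_left.congr_left fun k => ?_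
    simp only [MaxwellBloch.schwarz, map_sub]
    ring

theorem isFactorEntry_div_mul {S Z : Set ℂ} {f g e : ℂ → ℂ} (hS : IsOpen S)
    (hSU : S ⊆ {k | 0 < k.im}) (hZU : Z ⊆ {k | 0 < k.im})
    (hfc : ContinuousOn f {k | 0 ≤ k.im}) (hgc : ContinuousOn g {k | 0 ≤ k.im})
    (hfd : DifferentiableOn ℂ f {k | 0 < k.im}) (hgd : DifferentiableOn ℂ g {k | 0 < k.im})
    (hf : ∀ p ∈ closure S, p ∉ Z → f p ≠ 0) (hord : ∀ z ∈ Z, analyticOrderAt f z ≠ ⊤)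
    (hed : ∀ k ≠ 0, DifferentiableAt ℂ e k) (he : e =O[𝓝[S] 0] fun _ => (1 : ℝ)) :
    IsFactorEntry S Z (fun k => -(g k / f k * e k)) (fun z k => -(polarSum f g z k * e k)) := by
  have hU : S ⊆ {k | 0 ≤ k.im} := hSU.trans fun k (hk : 0 < k.im) => hk.le
  have hcl : closure S ⊆ {k | 0 ≤ k.im} :=
    closure_minimal hU (isClosed_le continuous_const Complex.continuous_im)
  have hne0 : ∀ {z : ℂ}, 0 < z.im → z ≠ 0 := by rintro z hz rfl; simp at hz
  have hquot : ∀ p ∉ Z, ContinuousWithinAt (fun k => g k / f k) S p := fun p hpZ => by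
    by_cases hp : p ∈ closure S
    · exact ((hgc p (hcl hp)).mono hU).div ((hfc p (hcl hp)).mono hU) (hf p hp hpZ)
    · exact continuousWithinAt_of_notMem_closure hp
  refine ⟨hS, fun k hk hkZ => ?_, fun p hpZ hp0 => ?_, ?_, fun z hz => ?_⟩
  · have hU' := isOpen_upper.mem_nhds (hSU hk)
    exact (((hgd.differentiableAt hU').fun_div (hfd.differentiableAt hU')
      (hf k (subset_closure hk) hkZ)).mul (hed k (hne0 (hSU hk)))).neg
  · exact ((hquot p hpZ).mul (hed p hp0).continuousAt.continuousWithinAt).neg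
  · have h0 : (0 : ℂ) ∉ Z := fun h0 => hne0 (hZU h0) rfl
    simpa using (((hquot 0 h0).isBigO_one ℝ).mul he).neg_left
  · have hU' := isOpen_upper.mem_nhds (hZU hz)
    have hpolar := (polarSum_sub_isBigO (hfd.analyticAt hU') (hord z hz)
      (hgd.analyticAt hU')).mono (nhdsWithin_mono z fun k (hk : k ∈ S \ {z}) => hk.2)
    have he' : e =O[𝓝[S \ {z}] z] fun _ => (1 : ℝ) :=
      (hed z (hne0 (hZU hz))).continuousAt.continuousWithinAt.isBigO_one ℝ
    have hprod := (hpolar.mul he').neg_left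
    simp only [mul_one] at hprod
    exact hprod.congr_left fun k => by ring

/-! ### Zeros of the spectral functions -/

theorem eq_ofReal_re {p : ℂ} (hp : p.im = 0) : p = (p.re : ℂ) :=
  Complex.ext rfl (by simpa using hp)

theorem norm_eq_abs_re {p : ℂ} (hp : p.im = 0) : ‖p‖ = |p.re| := by
  rw [eq_ofReal_re hp, Complex.norm_real, Real.norm_eq_abs, Complex.ofReal_re]

section Zeros

variable {f : ℂ → ℂ} {S : Set ℂ}

theorem ne_zero_of_notMem_zeros (hne : ∀ s : ℝ, (s : ℂ) ∈ S → f s ≠ 0) {p : ℂ} (hp : 0 ≤ p.im)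
    (hpS : p ∈ S) (hpZ : ¬(0 < p.im ∧ p ∈ S ∧ f p = 0)) : f p ≠ 0 := by
  rcases hp.eq_or_lt with him | him
  · have hre := eq_ofReal_re him.symm
    rw [hre] at hpS ⊢
    exact hne _ hpS
  · exact fun hz => hpZ ⟨him, hpS, hz⟩

theorem analyticOrderAt_ne_top_of_ne_zero (hc : ContinuousOn f {k | 0 ≤ k.im})
    (hd : DifferentiableOn ℂ f {k | 0 < k.im}) {s : ℝ} (hs : f s ≠ 0) {p : ℂ} (hp : 0 < p.im) :
    analyticOrderAt f p ≠ ⊤ := by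
  intro htop
  have hzero : EqOn f 0 {k | 0 < k.im} :=
    (hd.analyticOnNhd isOpen_upper).eqOn_zero_of_preconnected_of_eventuallyEq_zero
      (convex_halfSpace_im_gt 0).isPreconnected hp (analyticOrderAt_eq_top.1 htop)
  refine hs (hzero.of_subset_closure hc continuousOn_const (fun k (hk : 0 < k.im) => hk.le) ?_
    (show (s : ℂ) ∈ {k : ℂ | 0 ≤ k.im} by simp))
  rw [Complex.closure_setOfPred_lt_im]

/-- The zeros do not accumulate at the real axis because `f` is continuous and nonzero there. -/
theorem compl_zeros_mem_codiscrete (hc : ContinuousOn f {k | 0 ≤ k.im})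
    (hd : DifferentiableOn ℂ f {k | 0 < k.im}) (hS : IsClosed S)
    (hne : ∀ s : ℝ, (s : ℂ) ∈ S → f s ≠ 0) {s : ℝ} (hs : (s : ℂ) ∈ S) :
    {k | 0 < k.im ∧ k ∈ S ∧ f k = 0}ᶜ ∈ codiscrete ℂ := by
  simp only [mem_codiscrete, disjoint_principal_right, compl_compl]
  intro p
  rcases lt_trichotomy p.im 0 with hp | hp | hp
  · filter_upwards [nhdsWithin_le_nhds
      ((isOpen_lt Complex.continuous_im continuous_const).mem_nhds hp)] with k hk hkZ
    exact lt_asymm hk hkZ.1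
  · by_cases hpS : p ∈ S
    · have hp0 : f p ≠ 0 :=
        ne_zero_of_notMem_zeros hne hp.ge hpS fun h => h.1.ne' hp
      filter_upwards [nhdsWithin_le_nhds
        (eventually_nhdsWithin_iff.1 ((hc p hp.ge).eventually_ne hp0))] with k hk hkZ
      exact hk hkZ.1.le hkZ.2.2
    · filter_upwards [nhdsWithin_le_nhds (hS.isOpen_compl.mem_nhds hpS)] with k hk hkZ
      exact hk hkZ.2.1
  · have han : AnalyticAt ℂ f p := hd.analyticAt (isOpen_upper.mem_nhds hp)
    filter_upwards [han.eventually_eq_zero_or_eventually_ne_zero.resolve_left fun h =>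
      analyticOrderAt_ne_top_of_ne_zero hc hd (hne s hs) hp (analyticOrderAt_eq_top.2 h)]
      with k hk hkZ
    exact hk hkZ.2.2

end Zeros

/-- The properties of the spectral functions on which the Riemann–Hilbert analysis rests. -/
structure IsSpectralPair (a b : ℂ → ℂ) : Prop where
  continuousOn_a : ContinuousOn a {k | 0 ≤ k.im}
  continuousOn_b : ContinuousOn b {k | 0 ≤ k.im}
  differentiableOn_a : DifferentiableOn ℂ a {k | 0 < k.im}
  differentiableOn_b : DifferentiableOn ℂ b {k | 0 < k.im}
  tendsto_a : Tendsto a (Bornology.cobounded ℂ ⊓ 𝓟 {k | 0 ≤ k.im}) (𝓝 1)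
  tendsto_b : Tendsto b (Bornology.cobounded ℂ ⊓ 𝓟 {k | 0 ≤ k.im}) (𝓝 0)
  a_ne_zero : ∀ s : ℝ, 1 / 2 ≤ |s| → a s ≠ 0
  b_ne_zero : ∀ s : ℝ, |s| ≤ 1 / 2 → b s ≠ 0

namespace IsSpectralPair

variable {a b : ℂ → ℂ}

theorem a_ne_zero_of_notMem (h : IsSpectralPair a b) {p : ℂ} (hp : 0 ≤ p.im) (hp2 : 1 / 2 ≤ ‖p‖)
    (hpZ : p ∉ zerosA a) : a p ≠ 0 :=
  ne_zero_of_notMem_zeros (S := {k : ℂ | 1 / 2 ≤ ‖k‖})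
    (fun s hs => h.a_ne_zero s (by simpa using hs)) hp hp2 hpZ

theorem b_ne_zero_of_notMem (h : IsSpectralPair a b) {p : ℂ} (hp : 0 ≤ p.im) (hp2 : ‖p‖ ≤ 1 / 2)
    (hpZ : p ∉ zerosB b) : b p ≠ 0 :=
  ne_zero_of_notMem_zeros (S := {k : ℂ | ‖k‖ ≤ 1 / 2})
    (fun s hs => h.b_ne_zero s (by simpa using hs)) hp hp2 hpZ

theorem compl_zerosA_mem_codiscrete (h : IsSpectralPair a b) : (zerosA a)ᶜ ∈ codiscrete ℂ :=
  compl_zeros_mem_codiscrete (S := {k : ℂ | 1 / 2 ≤ ‖k‖}) (s := 1) h.continuousOn_a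
    h.differentiableOn_a (isClosed_le continuous_const continuous_norm)
    (fun s hs => h.a_ne_zero s (by simpa using hs)) (by norm_num)

theorem compl_zerosB_mem_codiscrete (h : IsSpectralPair a b) : (zerosB b)ᶜ ∈ codiscrete ℂ :=
  compl_zeros_mem_codiscrete (S := {k : ℂ | ‖k‖ ≤ 1 / 2}) (s := 0) h.continuousOn_b
    h.differentiableOn_b (isClosed_le continuous_norm continuous_const)
    (fun s hs => h.b_ne_zero s (by simpa using hs)) (by norm_num)

theorem tendsto_refl (h : IsSpectralPair a b) :
    Tendsto (refl a b) (Bornology.cobounded ℂ ⊓ 𝓟 {k | 0 ≤ k.im}) (𝓝 0) := by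
  simpa using! h.tendsto_b.div h.tendsto_a one_ne_zero

theorem isFactorEntry_OmegaP (h : IsSpectralPair a b) (t x : ℝ) :
    IsFactorEntry OmegaP (zerosA a) (fun k => -(refl a b k * eMinus t x k))
      (fun z k => -(polarSum a b z k * eMinus t x k)) := by
  refine isFactorEntry_div_mul isOpen_OmegaP (fun k hk => hk.1) (fun k hk => hk.1)
    h.continuousOn_a h.continuousOn_b h.differentiableOn_a h.differentiableOn_b
    (fun p hp hpZ => h.a_ne_zero_of_notMem (closure_OmegaP_subset hp).1
      (closure_OmegaP_subset hp).2 hpZ)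
    (fun z hz => analyticOrderAt_ne_top_of_ne_zero h.continuousOn_a h.differentiableOn_a
      (h.a_ne_zero 1 (by norm_num)) hz.1)
    (fun _ => differentiableAt_eMinus t x) ?_
  exact notMem_closure_iff_nhdsWithin_eq_bot.1 zero_notMem_closure_OmegaP ▸
    (isBigOWith_bot 1 _ _).isBigO

theorem isFactorEntry_DP (h : IsSpectralPair a b) (t : ℝ) {x : ℝ} (hx : 0 < x) :
    IsFactorEntry DP (zerosB b) (fun k => -((refl a b k)⁻¹ * ePlus t x k))
      (fun z k => -(polarSum b a z k * ePlus t x k)) := by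
  simp only [refl, inv_div]
  exact isFactorEntry_div_mul isOpen_DP (fun k hk => hk.1) (fun k hk => hk.1)
    h.continuousOn_b h.continuousOn_a h.differentiableOn_b h.differentiableOn_a
    (fun p hp hpZ => h.b_ne_zero_of_notMem (closure_DP_subset hp).1 (closure_DP_subset hp).2 hpZ)
    (fun z hz => analyticOrderAt_ne_top_of_ne_zero h.continuousOn_b h.differentiableOn_b
      (h.b_ne_zero 0 (by norm_num)) hz.1)
    (fun _ => differentiableAt_ePlus t x)
    ((isBigO_ePlus_nhds_zero hx).mono (nhdsWithin_mono 0 fun k hk => hk.1.le))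

theorem isFactorEntry_OmegaM (h : IsSpectralPair a b) (t x : ℝ) :
    IsFactorEntry OmegaM (starRingEnd ℂ ⁻¹' zerosA a)
      (fun k => schwarz (refl a b) k * ePlus t x k)
      (fun z k => schwarz (polarSum a b (starRingEnd ℂ z)) k * ePlus t x k) := by
  have := (h.isFactorEntry_OmegaP t x).schwarz
  rw [← OmegaM_eq] at this
  simpa only [← schwarz_eMinus, schwarz, map_neg, map_mul, neg_neg] using this

theorem isFactorEntry_DM (h : IsSpectralPair a b) (t : ℝ) {x : ℝ} (hx : 0 < x) :
    IsFactorEntry DM (starRingEnd ℂ ⁻¹' zerosB b)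
      (fun k => (schwarz (refl a b) k)⁻¹ * eMinus t x k)
      (fun z k => schwarz (polarSum b a (starRingEnd ℂ z)) k * eMinus t x k) := by
  have := (h.isFactorEntry_DP t hx).schwarz
  rw [← DM_eq] at this
  simpa only [← schwarz_ePlus, schwarz, map_neg, map_mul, map_inv₀, neg_neg] using this

end IsSpectralPair

/-! ### Removal of jumps and poles by a triangular factor -/

/-- The points `-1/2, 0, 1/2` of the real axis, where a solution is only required to be bounded. -/
def cornerSet : Set ℂ := {-(1 / 2), 0, 1 / 2}

theorem ContinuousUpTo.mono {M : ℂ → Matrix (Fin 2) (Fin 2) ℂ} {R S S' : Set ℂ}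
    (h : ContinuousUpTo M R S) (hS : S ⊆ S') : ContinuousUpTo M R S' :=
  fun k hk => h k ⟨hk.1, fun hk' => hk.2 (hS hk')⟩

theorem ContinuousUpTo.boundedAlong {M : ℂ → Matrix (Fin 2) (Fin 2) ℂ} {R S : Set ℂ}
    (h : ContinuousUpTo M R S) {p : ℂ} (hpR : p ∉ interior R) (hpS : p ∉ S) :
    BoundedAlong M (𝓝[R] p) := by
  by_cases hp : p ∈ closure R
  · obtain ⟨L, hL⟩ := h p ⟨⟨hp, hpR⟩, hpS⟩
    exact .of_tendsto hL
  · rw [notMem_closure_iff_nhdsWithin_eq_bot.1 hp]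
    exact .of_tendsto (L := 0) tendsto_bot

/-- On the domain `S` the matrix function `G` is triangular, unipotent, with `g` as its nontrivial
`(i, j)` entry. -/
structure IsFactorOn (G : ℂ → Matrix (Fin 2) (Fin 2) ℂ) (S Z : Set ℂ) (i j : Fin 2) (g : ℂ → ℂ)
    (P : ℂ → ℂ → ℂ) : Prop where
  ne : i ≠ j
  entry : IsFactorEntry S Z g P
  eqOn : ∀ k ∈ S, G k = Matrix.transvection i j (g k)

/-- `G` has unimodular boundary values at `p` from `P` and `N` that are related by `J`. -/
def RemovesJump (G : ℂ → Matrix (Fin 2) (Fin 2) ℂ) (P N : Set ℂ) (p : ℂ)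
    (J : Matrix (Fin 2) (Fin 2) ℂ) : Prop :=
  ∃ A B, Tendsto G (𝓝[P] p) (𝓝 A) ∧ Tendsto G (𝓝[N] p) (𝓝 B) ∧
    A.det = 1 ∧ B.det = 1 ∧ J * B = A

section Jump

variable {M G : ℂ → Matrix (Fin 2) (Fin 2) ℂ} {P N : Set ℂ} {p : ℂ} {J : Matrix (Fin 2) (Fin 2) ℂ}

theorem HasJump.exists_tendsto_mul (hM : HasJump M P N p J) (hG : RemovesJump G P N p J) :
    ∃ L, Tendsto (fun k => M k * G k) (𝓝[P ∪ N] p) (𝓝 L) := by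
  obtain ⟨Mp, Mm, hMp, hMm, rfl⟩ := hM
  obtain ⟨A, B, hA, hB, -, -, rfl⟩ := hG
  refine ⟨Mp * (J * B), nhdsWithin_union p P N ▸ (hMp.mul hA).sup ?_⟩
  rw [← Matrix.mul_assoc]
  exact hMm.mul hB

theorem RemovesJump.hasJump_inv (hG : RemovesJump G P N p J) :
    HasJump (fun k => (G k)⁻¹) P N p J := by
  obtain ⟨A, B, hA, hB, hAdet, hBdet, rfl⟩ := hG
  have hinv : ∀ C : Matrix (Fin 2) (Fin 2) ℂ, C.det = 1 → ContinuousAt Inv.inv C := fun C hC =>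
    continuousAt_matrix_inv C (by
      rw [Ring.inverse_eq_inv', hC]
      exact continuousAt_inv₀ one_ne_zero)
  have hJ : J.det = 1 := by rwa [Matrix.det_mul, hBdet, mul_one] at hAdet
  refine ⟨_, _, (hinv _ hAdet).tendsto.comp hA, (hinv _ hBdet).tendsto.comp hB, ?_⟩
  rw [Matrix.mul_inv_rev, Matrix.mul_assoc, Matrix.nonsing_inv_mul _ (by simp [hJ]),
    Matrix.mul_one]

end Jump

namespace IsFactorOn

variable {M G : ℂ → Matrix (Fin 2) (Fin 2) ℂ} {S Z : Set ℂ} {i j : Fin 2} {g : ℂ → ℂ}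
  {P : ℂ → ℂ → ℂ}

theorem inv (h : IsFactorOn G S Z i j g P) :
    IsFactorOn (fun k => (G k)⁻¹) S Z i j (fun k => -g k) (fun z k => -P z k) where
  ne := h.ne
  entry := h.entry.neg
  eqOn k hk := by rw [h.eqOn k hk, inv_transvection h.ne]

theorem eventuallyEq (h : IsFactorOn G S Z i j g P) (p : ℂ) :
    (fun k => Matrix.transvection i j (g k)) =ᶠ[𝓝[S] p] G :=
  eventually_nhdsWithin_of_forall fun k hk => (h.eqOn k hk).symm

theorem differentiableAt (h : IsFactorOn G S Z i j g P) {k : ℂ} (hk : k ∈ S) (hkZ : k ∉ Z)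
    (m n : Fin 2) : DifferentiableAt ℂ (fun k => G k m n) k := by
  refine ((differentiable_transvection_apply i j m n (g k)).comp k
    (h.entry.differentiableAt k hk hkZ)).congr_of_eventuallyEq ?_
  filter_upwards [h.entry.isOpen.mem_nhds hk] with k' hk' using by rw [h.eqOn k' hk']; rfl

theorem tendsto (h : IsFactorOn G S Z i j g P) {p : ℂ} (hpZ : p ∉ Z) (hp0 : p ≠ 0) :
    Tendsto G (𝓝[S] p) (𝓝 (Matrix.transvection i j (g p))) :=
  (((continuous_transvection i j).tendsto _).comp
    (h.entry.continuousWithinAt p hpZ hp0)).congr' (h.eventuallyEq p)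

theorem continuousUpTo (h : IsFactorOn G S Z i j g P) {C : Set ℂ} (hC : 0 ∈ closure S → 0 ∈ C) :
    ContinuousUpTo G S (C ∪ Z) := fun _ ⟨hp, hpC⟩ =>
  ⟨_, h.tendsto (fun hpZ => hpC (.inr hpZ)) fun hp0 =>
    hpC (.inl (hp0 ▸ hC (hp0 ▸ frontier_subset_closure hp)))⟩

theorem boundedAlong (h : IsFactorOn G S Z i j g P) {p : ℂ} (hp : p ∉ Z) :
    BoundedAlong G (𝓝[S] p) :=
  (BoundedAlong.transvection (h.entry.isBigO_one hp) i j).congr (h.eventuallyEq p)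

theorem boundedAlong_inv_mul (h : IsFactorOn G S Z i j g P) {z : ℂ} (hz : z ∈ Z) :
    BoundedAlong (fun k => (G k)⁻¹ * Matrix.transvection i j (P z k)) (𝓝[S \ {z}] z) := by
  refine (BoundedAlong.transvection (h.entry.isBigO_sub z hz).neg_left i j).congr ?_
  filter_upwards [self_mem_nhdsWithin] with k hk
  rw [h.inv.eqOn k hk.1, Matrix.transvection_mul_transvection_same _ _ h.ne, neg_sub,
    neg_add_eq_sub]

theorem boundedAlong_mul (h : IsFactorOn G S Z i j g P)
    (hcont : ContinuousUpTo M S (cornerSet ∪ Z))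
    (hpole : ∀ z ∈ Z, BoundedAlong (fun k => M k * Matrix.transvection i j (P z k)) (𝓝[S \ {z}] z))
    (hcorner : ∀ p ∈ cornerSet, BoundedAlong M (𝓝[S] p)) {p : ℂ} (hp : p ∈ S → p ∈ Z) :
    BoundedAlong (fun k => M k * G k) (𝓝[S \ {p}] p) := by
  by_cases hpZ : p ∈ Z
  · refine ((hpole p hpZ).mul (.transvection (h.entry.isBigO_sub p hpZ) i j)).congr ?_
    filter_upwards [self_mem_nhdsWithin] with k hk
    rw [h.eqOn k hk.1, Matrix.mul_assoc, Matrix.transvection_mul_transvection_same _ _ h.ne,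
      add_sub_cancel]
  · refine BoundedAlong.mono (.mul ?_ (h.boundedAlong hpZ)) (nhdsWithin_mono p sdiff_subset)
    by_cases hpc : p ∈ cornerSet
    · exact hcorner p hpc
    · exact hcont.boundedAlong (fun hi => hpZ (hp (interior_subset hi))) (by simp [hpc, hpZ])

theorem isBigO_sub_one (h : IsFactorOn G S Z i j g P) (l : Filter ℂ) (m n : Fin 2) :
    (fun k => G k m n - (1 : Matrix (Fin 2) (Fin 2) ℂ) m n) =O[l ⊓ 𝓟 S] g :=
  IsBigO.of_bound' (eventually_inf_principal.2 (Eventually.of_forall fun k hk => by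
    rw [h.eqOn k hk]
    exact norm_transvection_sub_one_apply_le i j m n (g k)))

theorem removesJump {S' Z' : Set ℂ} {i' j' : Fin 2} {g' : ℂ → ℂ} {P' : ℂ → ℂ → ℂ}
    (h : IsFactorOn G S Z i j g P) (h' : IsFactorOn G S' Z' i' j' g' P') {p : ℂ} (hp : p ∉ Z)
    (hp' : p ∉ Z') (hp0 : p ≠ 0) {J : Matrix (Fin 2) (Fin 2) ℂ}
    (hJ : J * Matrix.transvection i' j' (g' p) = Matrix.transvection i j (g p)) :
    RemovesJump G S S' p J :=
  ⟨_, _, h.tendsto hp hp0, h'.tendsto hp' hp0, Matrix.det_transvection_of_ne _ _ h.ne _,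
    Matrix.det_transvection_of_ne _ _ h'.ne _, hJ⟩

end IsFactorOn

/-! ### The triangular factor -/

section FactorG

variable (r : ℂ → ℂ) (t x : ℝ) {k : ℂ}

theorem factorG_OmegaP (hk : k ∈ OmegaP) :
    factorG r t x k = Matrix.transvection 0 1 (-(r k * eMinus t x k)) := by
  rw [factorG, if_pos hk, transvection_zero_one]

theorem factorG_OmegaM (hk : k ∈ OmegaM) :
    factorG r t x k = Matrix.transvection 1 0 (schwarz r k * ePlus t x k) := by
  have hkΩ : k ∉ OmegaP := fun h => lt_asymm h.1 hk.1
  rw [factorG, if_neg hkΩ, if_pos hk, transvection_one_zero]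

theorem factorG_DP (hk : k ∈ DP) :
    factorG r t x k = Matrix.transvection 1 0 (-((r k)⁻¹ * ePlus t x k)) := by
  have hkΩ : k ∉ OmegaP := fun h => lt_asymm h.2 hk.2
  have hkΩ' : k ∉ OmegaM := fun h => lt_asymm h.2 hk.2
  rw [factorG, if_neg hkΩ, if_neg hkΩ', if_pos hk, transvection_one_zero]

theorem factorG_DM (hk : k ∈ DM) :
    factorG r t x k = Matrix.transvection 0 1 ((schwarz r k)⁻¹ * eMinus t x k) := by
  have hkΩ : k ∉ OmegaP := fun h => lt_asymm h.2 hk.2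
  have hkΩ' : k ∉ OmegaM := fun h => lt_asymm h.2 hk.2
  have hkD : k ∉ DP := fun h => lt_asymm h.1 hk.1
  rw [factorG, if_neg hkΩ, if_neg hkΩ', if_neg hkD, if_pos hk, transvection_zero_one]

theorem jumpOuter_mul (hk : k.im = 0) :
    jumpOuter r t x k * Matrix.transvection 1 0 (schwarz r k * ePlus t x k) =
      Matrix.transvection 0 1 (-(r k * eMinus t x k)) := by
  have hschwarz : schwarz r k = starRingEnd ℂ (r k) := by
    rw [schwarz, Complex.conj_eq_iff_im.2 hk]
  have hcorner : 1 + r k * starRingEnd ℂ (r k) +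
      -(r k * eMinus t x k * (starRingEnd ℂ (r k) * ePlus t x k)) = 1 := by
    linear_combination (-(r k * starRingEnd ℂ (r k))) * eMinus_mul_ePlus t x k
  simp [transvection_one_zero, transvection_zero_one, jumpOuter, hschwarz,
    ← Complex.mul_conj', hcorner]

theorem jumpInner_mul (hk : k.im = 0) :
    jumpInner r t x k * Matrix.transvection 0 1 ((schwarz r k)⁻¹ * eMinus t x k) =
      Matrix.transvection 1 0 (-((r k)⁻¹ * ePlus t x k)) := by
  have hschwarz : schwarz r k = starRingEnd ℂ (r k) := by
    rw [schwarz, Complex.conj_eq_iff_im.2 hk]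
  have hcorner : -((r k)⁻¹ * ePlus t x k * ((starRingEnd ℂ (r k))⁻¹ * eMinus t x k)) +
      (1 + (r k * starRingEnd ℂ (r k))⁻¹) = 1 := by
    rw [mul_inv]
    linear_combination (-((r k)⁻¹ * (starRingEnd ℂ (r k))⁻¹)) * eMinus_mul_ePlus t x k
  simp [transvection_one_zero, transvection_zero_one, jumpInner, hschwarz,
    ← Complex.mul_conj', -mul_inv_rev, hcorner]

theorem jumpUp_mul (hr : r k ≠ 0) :
    jumpUp r t x k * Matrix.transvection 1 0 (-((r k)⁻¹ * ePlus t x k)) =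
      Matrix.transvection 0 1 (-(r k * eMinus t x k)) := by
  have hcorner : r k * eMinus t x k * ((r k)⁻¹ * ePlus t x k) = 1 := by
    rw [mul_mul_mul_comm, mul_inv_cancel₀ hr, eMinus_mul_ePlus, one_mul]
  simp [transvection_one_zero, transvection_zero_one, jumpUp, hcorner]

theorem jumpDown_mul (hr : schwarz r k ≠ 0) :
    jumpDown r t x k * Matrix.transvection 1 0 (schwarz r k * ePlus t x k) =
      Matrix.transvection 0 1 ((schwarz r k)⁻¹ * eMinus t x k) := by
  have hcorner : (schwarz r k)⁻¹ * eMinus t x k * (schwarz r k * ePlus t x k) = 1 := by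
    rw [mul_mul_mul_comm, inv_mul_cancel₀ hr, eMinus_mul_ePlus, one_mul]
  simp [transvection_one_zero, transvection_zero_one, jumpDown, hcorner]

end FactorG

/-! ### The exceptional set -/

/-- All points where a solution need not have boundary values: the corners and the poles. -/
def poleSet (a b : ℂ → ℂ) : Set ℂ :=
  cornerSet ∪ ((zerosA a ∪ starRingEnd ℂ ⁻¹' zerosA a) ∪ (zerosB b ∪ starRingEnd ℂ ⁻¹' zerosB b))

theorem im_eq_zero_of_mem_cornerSet {p : ℂ} (hp : p ∈ cornerSet) : p.im = 0 := by
  rcases hp with rfl | rfl | rfl <;> simp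

theorem norm_ne_half_of_notMem_cornerSet {p : ℂ} (him : p.im = 0) (hp : p ∉ cornerSet) :
    ‖p‖ ≠ 1 / 2 := fun hn => by
  rw [norm_eq_abs_re him, abs_eq (by norm_num)] at hn
  rw [eq_ofReal_re him] at hp
  rcases hn with hn | hn <;> simp [hn, cornerSet] at hp

theorem regularSet_eq (a b : ℂ → ℂ) : regularSet a b = (contour ∪ poleSet a b)ᶜ := by
  ext k
  have hcorner : k ∈ cornerSet → k ∈ contour := fun h => .inl (im_eq_zero_of_mem_cornerSet h)
  simp only [regularSet, poleSet, mem_compl_iff, mem_union, mem_preimage, mem_ofPred_eq]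
  tauto

theorem regularSet_subset_compl_contour (a b : ℂ → ℂ) : regularSet a b ⊆ contourᶜ :=
  fun _ hk => hk.1

theorem conj_mem_poleSet {a b : ℂ → ℂ} {p : ℂ} (hp : p ∈ poleSet a b) :
    starRingEnd ℂ p ∈ poleSet a b := by
  have hcorner : p ∈ cornerSet → starRingEnd ℂ p ∈ cornerSet := fun h => by
    rwa [Complex.conj_eq_iff_im.2 (im_eq_zero_of_mem_cornerSet h)]
  simp only [poleSet, mem_union, mem_preimage, Complex.conj_conj] at hp ⊢
  tauto

theorem mem_zerosA_of_mem_poleSet {a b : ℂ → ℂ} {p : ℂ} (hp : p ∈ poleSet a b)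
    (hS : p ∈ OmegaP) : p ∈ zerosA a := by
  rcases hp with hp | (hp | hp) | (hp | hp)
  · exact absurd (im_eq_zero_of_mem_cornerSet hp) hS.1.ne'
  · exact hp
  · exact absurd hp.1 (by simpa using hS.1.le)
  · exact absurd hp.2.1 (not_le.2 hS.2)
  · exact absurd hp.1 (by simpa using hS.1.le)

theorem mem_zerosB_of_mem_poleSet {a b : ℂ → ℂ} {p : ℂ} (hp : p ∈ poleSet a b) (hS : p ∈ DP) :
    p ∈ zerosB b := by
  rcases hp with hp | (hp | hp) | (hp | hp)
  · exact absurd (im_eq_zero_of_mem_cornerSet hp) hS.1.ne'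
  · exact absurd hp.2.1 (not_le.2 hS.2)
  · exact absurd hp.1 (by simpa using hS.1.le)
  · exact hp
  · exact absurd hp.1 (by simpa using hS.1.le)

section NhdsWithin

variable {p : ℂ}

theorem nhdsWithin_compl_contour (p : ℂ) :
    𝓝[contourᶜ] p = 𝓝[OmegaP] p ⊔ 𝓝[OmegaM] p ⊔ (𝓝[DP] p ⊔ 𝓝[DM] p) := by
  simp only [compl_contour_eq, nhdsWithin_union]

theorem nhdsWithin_compl_contour_le_of_im_pos (hp : 0 < p.im) :
    𝓝[contourᶜ] p ≤ 𝓝[OmegaP ∪ DP] p := by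
  refine nhdsWithin_le_iff.2 ?_
  filter_upwards [nhdsWithin_le_nhds (isOpen_upper.mem_nhds hp), self_mem_nhdsWithin] with k hk hkc
  exact (lt_or_gt_of_ne fun h => hkc (.inr h)).elim (fun h => .inr ⟨hk, h⟩) fun h => .inl ⟨hk, h⟩

theorem nhdsWithin_compl_contour_le_of_im_neg (hp : p.im < 0) :
    𝓝[contourᶜ] p ≤ 𝓝[DM ∪ OmegaM] p := by
  refine nhdsWithin_le_iff.2 ?_
  filter_upwards [nhdsWithin_le_nhds ((isOpen_lt Complex.continuous_im continuous_const).mem_nhds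
    hp), self_mem_nhdsWithin] with k hk hkc
  exact (lt_or_gt_of_ne fun h => hkc (.inr h)).elim (fun h => .inl ⟨hk, h⟩) fun h => .inr ⟨hk, h⟩

theorem nhdsWithin_compl_contour_le_of_norm_lt (hp : ‖p‖ < 1 / 2) :
    𝓝[contourᶜ] p ≤ 𝓝[DP ∪ DM] p := by
  refine nhdsWithin_le_iff.2 ?_
  filter_upwards [nhdsWithin_le_nhds ((isOpen_lt continuous_norm continuous_const).mem_nhds hp),
    self_mem_nhdsWithin] with k hk hkc
  exact (lt_or_gt_of_ne fun h => hkc (.inl h)).elim (fun h => .inr ⟨h, hk⟩) fun h => .inl ⟨h, hk⟩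

theorem nhdsWithin_compl_contour_le_of_lt_norm (hp : 1 / 2 < ‖p‖) :
    𝓝[contourᶜ] p ≤ 𝓝[OmegaP ∪ OmegaM] p := by
  refine nhdsWithin_le_iff.2 ?_
  filter_upwards [nhdsWithin_le_nhds ((isOpen_lt continuous_const continuous_norm).mem_nhds hp),
    self_mem_nhdsWithin] with k hk hkc
  exact (lt_or_gt_of_ne fun h => hkc (.inl h)).elim (fun h => .inr ⟨h, hk⟩) fun h => .inl ⟨h, hk⟩

theorem cobounded_inf_compl_contour_le :
    Bornology.cobounded ℂ ⊓ 𝓟 contourᶜ ≤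
      (Bornology.cobounded ℂ ⊓ 𝓟 OmegaP) ⊔ (Bornology.cobounded ℂ ⊓ 𝓟 OmegaM) := by
  rw [← inf_sup_left, sup_principal]
  refine le_inf inf_le_left (le_principal_iff.2 ?_)
  refine eventually_inf_principal.2 ?_
  filter_upwards [(tendsto_norm_cobounded_atTop (E := ℂ)).eventually_gt_atTop (1 / 2)]
    with k hk hkc
  exact (lt_or_gt_of_ne fun h => hkc (.inl h)).elim (fun h => .inr ⟨h, hk⟩) fun h => .inl ⟨h, hk⟩

end NhdsWithin

namespace IsSpectralPair

variable {a b : ℂ → ℂ} {t x : ℝ}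

theorem compl_poleSet_mem_codiscrete (h : IsSpectralPair a b) :
    (poleSet a b)ᶜ ∈ codiscrete ℂ := by
  have hA := h.compl_zerosA_mem_codiscrete
  have hB := h.compl_zerosB_mem_codiscrete
  simp only [poleSet, compl_union]
  exact inter_mem (toFinite {-(1 / 2), 0, 1 / 2}).compl_mem_codiscrete
    (inter_mem (inter_mem hA (conj_preimage_mem_codiscrete hA))
      (inter_mem hB (conj_preimage_mem_codiscrete hB)))

theorem nhdsWithin_compl_contour_le_regularSet (h : IsSpectralPair a b) {p : ℂ}
    (hp : p ∈ contour) : 𝓝[contourᶜ] p ≤ 𝓝[regularSet a b] p := by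
  have hpoles := h.compl_poleSet_mem_codiscrete
  simp only [mem_codiscrete, disjoint_principal_right, compl_compl] at hpoles
  rw [regularSet_eq, compl_union, nhdsWithin_le_iff]
  exact inter_mem self_mem_nhdsWithin
    (nhdsWithin_mono p (subset_compl_comm.1 (singleton_subset_iff.2 (not_not.2 hp))) (hpoles p))

theorem cobounded_inf_compl_contour_le_regularSet (h : IsSpectralPair a b) :
    Bornology.cobounded ℂ ⊓ 𝓟 contourᶜ ≤ Bornology.cobounded ℂ ⊓ 𝓟 (regularSet a b) := by
  have ha := h.tendsto_a.eventually_ne one_ne_zero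
  have ha' := (tendsto_conj_cobounded _).eventually ha
  refine le_inf inf_le_left (le_principal_iff.2 (eventually_inf_principal.2 ?_))
  filter_upwards [eventually_inf_principal.1 ha, eventually_inf_principal.1 ha',
    (tendsto_norm_cobounded_atTop (E := ℂ)).eventually_gt_atTop (1 / 2)] with k hk hk' hnorm hkc
  refine ⟨hkc, fun hz => hk hz.1.le hz.2.2, fun hz => hk' hz.1.le hz.2.2,
    fun hz => not_lt.2 hz.2.1 hnorm, fun hz => not_lt.2 hz.2.1 ?_⟩
  rwa [Complex.norm_conj]

theorem isFactorOn_OmegaP (h : IsSpectralPair a b) (t x : ℝ) :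
    IsFactorOn (factorG (refl a b) t x) OmegaP (zerosA a) 0 1
      (fun k => -(refl a b k * eMinus t x k)) (fun z k => -(polarSum a b z k * eMinus t x k)) :=
  ⟨zero_ne_one, h.isFactorEntry_OmegaP t x, fun _ => factorG_OmegaP _ t x⟩

theorem isFactorOn_OmegaM (h : IsSpectralPair a b) (t x : ℝ) :
    IsFactorOn (factorG (refl a b) t x) OmegaM (starRingEnd ℂ ⁻¹' zerosA a) 1 0
      (fun k => schwarz (refl a b) k * ePlus t x k)
      (fun z k => schwarz (polarSum a b (starRingEnd ℂ z)) k * ePlus t x k) :=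
  ⟨one_ne_zero, h.isFactorEntry_OmegaM t x, fun _ => factorG_OmegaM _ t x⟩

theorem isFactorOn_DP (h : IsSpectralPair a b) (t : ℝ) (hx : 0 < x) :
    IsFactorOn (factorG (refl a b) t x) DP (zerosB b) 1 0
      (fun k => -((refl a b k)⁻¹ * ePlus t x k)) (fun z k => -(polarSum b a z k * ePlus t x k)) :=
  ⟨one_ne_zero, h.isFactorEntry_DP t hx, fun _ => factorG_DP _ t x⟩

theorem isFactorOn_DM (h : IsSpectralPair a b) (t : ℝ) (hx : 0 < x) :
    IsFactorOn (factorG (refl a b) t x) DM (starRingEnd ℂ ⁻¹' zerosB b) 0 1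
      (fun k => (schwarz (refl a b) k)⁻¹ * eMinus t x k)
      (fun z k => schwarz (polarSum b a (starRingEnd ℂ z)) k * eMinus t x k) :=
  ⟨zero_ne_one, h.isFactorEntry_DM t hx, fun _ => factorG_DM _ t x⟩

theorem removesJump_outer (h : IsSpectralPair a b) (t x : ℝ) {p : ℂ} (hp : p.im = 0)
    (hp0 : p ≠ 0) :
    RemovesJump (factorG (refl a b) t x) OmegaP OmegaM p (jumpOuter (refl a b) t x p) :=
  (h.isFactorOn_OmegaP t x).removesJump (h.isFactorOn_OmegaM t x) (fun hz => hz.1.ne' hp)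
    (fun hz => hz.1.ne' (by simpa using hp)) hp0 (jumpOuter_mul _ t x hp)

theorem removesJump_inner (h : IsSpectralPair a b) (t : ℝ) (hx : 0 < x) {p : ℂ} (hp : p.im = 0)
    (hp0 : p ≠ 0) :
    RemovesJump (factorG (refl a b) t x) DP DM p (jumpInner (refl a b) t x p) :=
  (h.isFactorOn_DP t hx).removesJump (h.isFactorOn_DM t hx) (fun hz => hz.1.ne' hp)
    (fun hz => hz.1.ne' (by simpa using hp)) hp0 (jumpInner_mul _ t x hp)

theorem removesJump_up (h : IsSpectralPair a b) (t : ℝ) (hx : 0 < x) {p : ℂ} (hp0 : p ≠ 0)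
    (hpa : a p ≠ 0) (hpb : b p ≠ 0) :
    RemovesJump (factorG (refl a b) t x) OmegaP DP p (jumpUp (refl a b) t x p) :=
  (h.isFactorOn_OmegaP t x).removesJump (h.isFactorOn_DP t hx) (fun hz => hpa hz.2.2)
    (fun hz => hpb hz.2.2) hp0 (jumpUp_mul _ t x (div_ne_zero hpb hpa))

theorem removesJump_down (h : IsSpectralPair a b) (t : ℝ) (hx : 0 < x) {p : ℂ} (hp0 : p ≠ 0)
    (hpa : schwarz a p ≠ 0) (hpb : schwarz b p ≠ 0) :
    RemovesJump (factorG (refl a b) t x) DM OmegaM p (jumpDown (refl a b) t x p) := by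
  have hr : schwarz (refl a b) p ≠ 0 := by
    simpa only [schwarz, refl, map_div₀] using div_ne_zero hpb hpa
  rw [schwarz, map_ne_zero] at hpa hpb
  exact (h.isFactorOn_DM t hx).removesJump (h.isFactorOn_OmegaM t x) (fun hz => hpb hz.2.2)
    (fun hz => hpa hz.2.2) hp0 (jumpDown_mul _ t x hr)

theorem differentiableOn_factorG (h : IsSpectralPair a b) (t : ℝ) (hx : 0 < x) (i j : Fin 2) :
    DifferentiableOn ℂ (fun k => factorG (refl a b) t x k i j) (regularSet a b) := by
  rintro k ⟨hkc, hA, hA', hB, hB'⟩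
  refine DifferentiableAt.differentiableWithinAt ?_
  rcases compl_contour_eq.subset hkc with (hk | hk) | (hk | hk)
  exacts [(h.isFactorOn_OmegaP t x).differentiableAt hk hA i j,
    (h.isFactorOn_OmegaM t x).differentiableAt hk hA' i j,
    (h.isFactorOn_DP t hx).differentiableAt hk hB i j,
    (h.isFactorOn_DM t hx).differentiableAt hk hB' i j]

theorem differentiableOn_inv_factorG (h : IsSpectralPair a b) (t : ℝ) (hx : 0 < x) (i j : Fin 2) :
    DifferentiableOn ℂ (fun k => (factorG (refl a b) t x k)⁻¹ i j) (regularSet a b) := by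
  rintro k ⟨hkc, hA, hA', hB, hB'⟩
  refine DifferentiableAt.differentiableWithinAt ?_
  rcases compl_contour_eq.subset hkc with (hk | hk) | (hk | hk)
  exacts [(h.isFactorOn_OmegaP t x).inv.differentiableAt hk hA i j,
    (h.isFactorOn_OmegaM t x).inv.differentiableAt hk hA' i j,
    (h.isFactorOn_DP t hx).inv.differentiableAt hk hB i j,
    (h.isFactorOn_DM t hx).inv.differentiableAt hk hB' i j]

end IsSpectralPair

section AtInfinity

variable {t x : ℝ} (r : ℂ → ℂ)

theorem isBigO_entry_OmegaP (hx : 0 ≤ x) (htx : t ≤ x) :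
    (fun k => -(r k * eMinus t x k)) =O[Bornology.cobounded ℂ ⊓ 𝓟 OmegaP] r := by
  have hexp := ((isBigO_eMinus_cobounded hx htx).mono
    (inf_le_inf_left _ (principal_mono.2 fun k (hk : k ∈ OmegaP) => hk.1.le))).trans
    (isBigO_const_const (1 : ℝ) (one_ne_zero (α := ℂ)) _)
  simpa using ((isBigO_refl r _).mul hexp).neg_left

theorem isBigO_entry_OmegaM (hx : 0 ≤ x) (htx : t ≤ x) :
    (fun k => schwarz r k * ePlus t x k) =O[Bornology.cobounded ℂ ⊓ 𝓟 OmegaM]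
      (r ∘ starRingEnd ℂ) := by
  rw [OmegaM_eq]
  refine (isBigO_schwarz (isBigO_entry_OmegaP r hx htx)
    (tendsto_conj_cobounded OmegaP)).neg_left.congr_left fun k => ?_
  simp only [← schwarz_eMinus, schwarz, map_neg, map_mul, neg_neg]

end AtInfinity

namespace IsSpectralPair

variable {a b : ℂ → ℂ} {t x : ℝ}

theorem tendsto_factorG_cobounded (h : IsSpectralPair a b) (hx : 0 < x) (htx : t ≤ x) :
    Tendsto (factorG (refl a b) t x) (Bornology.cobounded ℂ ⊓ 𝓟 contourᶜ) (𝓝 1) := by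
  have hΩ : Bornology.cobounded ℂ ⊓ 𝓟 OmegaP ≤ Bornology.cobounded ℂ ⊓ 𝓟 {k | 0 ≤ k.im} :=
    inf_le_inf_left _ (principal_mono.2 fun k (hk : k ∈ OmegaP) => hk.1.le)
  have hr := h.tendsto_refl.mono_left hΩ
  have hr' := hr.comp (tendsto_conj_cobounded OmegaP)
  rw [← OmegaM_eq] at hr'
  refine tendsto_pi_nhds.2 fun i => tendsto_pi_nhds.2 fun j => tendsto_sub_nhds_zero_iff.1 ?_
  refine Tendsto.mono_left (.sup ?_ ?_) cobounded_inf_compl_contour_le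
  · exact (((h.isFactorOn_OmegaP t x).isBigO_sub_one _ i j).trans
      (isBigO_entry_OmegaP _ hx.le htx)).trans_tendsto hr
  · exact (((h.isFactorOn_OmegaM t x).isBigO_sub_one _ i j).trans
      (isBigO_entry_OmegaM _ hx.le htx)).trans_tendsto hr'

theorem isBigO_inv_factorG_sub_one (h : IsSpectralPair a b) (hx : 0 < x) (htx : t ≤ x)
    (hr : refl a b =O[Bornology.cobounded ℂ ⊓ 𝓟 {k | 0 ≤ k.im}] fun k => k⁻¹) (i j : Fin 2) :
    (fun k => (factorG (refl a b) t x k)⁻¹ i j - (1 : Matrix (Fin 2) (Fin 2) ℂ) i j)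
      =O[Bornology.cobounded ℂ ⊓ 𝓟 contourᶜ] fun k => k⁻¹ := by
  have hr := hr.mono (inf_le_inf_left _ (principal_mono.2 fun k (hk : k ∈ OmegaP) => hk.1.le))
  have hr' := (hr.comp_tendsto (tendsto_conj_cobounded OmegaP)).trans
    (isBigO_of_le _ fun k => by simp : _ =O[_] fun k : ℂ => k⁻¹)
  rw [← OmegaM_eq] at hr'
  refine IsBigO.mono (.sup ?_ ?_) cobounded_inf_compl_contour_le
  · exact (((h.isFactorOn_OmegaP t x).inv.isBigO_sub_one _ i j).trans
      (isBigO_entry_OmegaP _ hx.le htx).neg_left).trans hr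
  · exact (((h.isFactorOn_OmegaM t x).inv.isBigO_sub_one _ i j).trans
      (isBigO_entry_OmegaM _ hx.le htx).neg_left).trans hr'

end IsSpectralPair

/-! ### Solutions of the Riemann–Hilbert problem -/

namespace IsRHSolution

variable {a b : ℂ → ℂ} {t x : ℝ} {M : ℂ → Matrix (Fin 2) (Fin 2) ℂ} {p : ℂ}

theorem exists_tendsto_mul_factorG_of_im_eq_zero (hM : IsRHSolution a b t x M)
    (h : IsSpectralPair a b) (hx : 0 < x) (him : p.im = 0) (hp : p ∉ cornerSet) :
    ∃ L, Tendsto (fun k => M k * factorG (refl a b) t x k) (𝓝[contourᶜ] p) (𝓝 L) := by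
  have hp0 : p ≠ 0 := fun h0 => hp (.inr (.inl h0))
  have hre0 : p.re ≠ 0 := fun h0 => hp0 (Complex.ext h0 him)
  have hre : (p.re : ℂ) = p := (eq_ofReal_re him).symm
  rcases lt_or_gt_of_ne (norm_ne_half_of_notMem_cornerSet him hp) with hn | hn
  · have hjump := hM.jump_inner p.re hre0 (norm_eq_abs_re him ▸ hn)
    rw [hre] at hjump
    obtain ⟨L, hL⟩ := hjump.exists_tendsto_mul (h.removesJump_inner t hx him hp0)
    exact ⟨L, hL.mono_left (nhdsWithin_compl_contour_le_of_norm_lt hn)⟩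
  · have hjump := hM.jump_outer p.re (norm_eq_abs_re him ▸ hn)
    rw [hre] at hjump
    obtain ⟨L, hL⟩ := hjump.exists_tendsto_mul (h.removesJump_outer t x him hp0)
    exact ⟨L, hL.mono_left (nhdsWithin_compl_contour_le_of_lt_norm hn)⟩

theorem exists_tendsto_mul_factorG_of_norm_eq_half (hM : IsRHSolution a b t x M)
    (h : IsSpectralPair a b) (hx : 0 < x) (him : p.im ≠ 0) (hn : ‖p‖ = 1 / 2)
    (hp : p ∉ poleSet a b) :
    ∃ L, Tendsto (fun k => M k * factorG (refl a b) t x k) (𝓝[contourᶜ] p) (𝓝 L) := by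
  have hp0 : p ≠ 0 := fun h0 => him (by simp [h0])
  rcases lt_or_gt_of_ne him with him | him
  · have hpa : schwarz a p ≠ 0 := fun hz => hp (.inr (.inl (.inr
      ⟨by simpa using him, by simp [hn], by simpa [schwarz] using hz⟩)))
    have hpb : schwarz b p ≠ 0 := fun hz => hp (.inr (.inr (.inr
      ⟨by simpa using him, by simp [hn], by simpa [schwarz] using hz⟩)))
    obtain ⟨L, hL⟩ := (hM.jump_down p him hn hpa hpb).exists_tendsto_mul
      (h.removesJump_down t hx hp0 hpa hpb)
    exact ⟨L, hL.mono_left (nhdsWithin_compl_contour_le_of_im_neg him)⟩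
  · have hpa : a p ≠ 0 := fun hz => hp (.inr (.inl (.inl ⟨him, hn.ge, hz⟩)))
    have hpb : b p ≠ 0 := fun hz => hp (.inr (.inr (.inl ⟨him, hn.le, hz⟩)))
    obtain ⟨L, hL⟩ := (hM.jump_up p him hn hpa hpb).exists_tendsto_mul
      (h.removesJump_up t hx hp0 hpa hpb)
    exact ⟨L, hL.mono_left (nhdsWithin_compl_contour_le_of_im_pos him)⟩

theorem exists_tendsto_mul_factorG (hM : IsRHSolution a b t x M) (h : IsSpectralPair a b)
    (hx : 0 < x) (hp : p ∈ contour \ poleSet a b) :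
    ∃ L, Tendsto (fun k => M k * factorG (refl a b) t x k) (𝓝[contourᶜ] p) (𝓝 L) := by
  obtain ⟨hpc, hpX⟩ := hp
  by_cases him : p.im = 0
  · exact hM.exists_tendsto_mul_factorG_of_im_eq_zero h hx him fun hc => hpX (.inl hc)
  · exact hM.exists_tendsto_mul_factorG_of_norm_eq_half h hx him (hpc.resolve_left him) hpX

theorem boundedAlong_of_mem_cornerSet (hM : IsRHSolution a b t x M) (h : IsSpectralPair a b)
    {S : Set ℂ} (hS : S ⊆ contourᶜ) (hp : p ∈ cornerSet) : BoundedAlong M (𝓝[S] p) :=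
  (hM.bounded p hp).mono ((nhdsWithin_mono p hS).trans
    (h.nhdsWithin_compl_contour_le_regularSet (.inl (im_eq_zero_of_mem_cornerSet hp))))

theorem boundedAlong_mul_factorG_upper (hM : IsRHSolution a b t x M) (h : IsSpectralPair a b)
    (hx : 0 < x) (hp : p ∈ poleSet a b) :
    BoundedAlong (fun k => M k * factorG (refl a b) t x k) (𝓝[(OmegaP ∪ DP) \ {p}] p) := by
  have hcorner : ({-(1 / 2), 1 / 2} : Set ℂ) ⊆ cornerSet :=
    insert_subset_insert (subset_insert 0 _)
  rw [union_sdiff_distrib, nhdsWithin_union]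
  refine .sup ?_ ?_
  · refine (h.isFactorOn_OmegaP t x).boundedAlong_mul
      (hM.cont_OmegaP.mono (union_subset_union_left _ hcorner)) (fun z hz => ?_)
      (fun _ => hM.boundedAlong_of_mem_cornerSet h ?_) (mem_zerosA_of_mem_poleSet hp)
    · simpa only [transvection_zero_one] using hM.pole_a z hz
    · exact fun k hk => compl_contour_eq.superset (.inl (.inl hk))
  · refine (h.isFactorOn_DP t hx).boundedAlong_mul hM.cont_DP (fun z hz => ?_)
      (fun _ => hM.boundedAlong_of_mem_cornerSet h ?_) (mem_zerosB_of_mem_poleSet hp)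
    · simpa only [transvection_one_zero] using hM.pole_b z hz
    · exact fun k hk => compl_contour_eq.superset (.inr (.inl hk))

theorem boundedAlong_mul_factorG_lower (hM : IsRHSolution a b t x M) (h : IsSpectralPair a b)
    (hx : 0 < x) (hp : p ∈ poleSet a b) :
    BoundedAlong (fun k => M k * factorG (refl a b) t x k) (𝓝[(OmegaM ∪ DM) \ {p}] p) := by
  have hcorner : ({-(1 / 2), 1 / 2} : Set ℂ) ⊆ cornerSet :=
    insert_subset_insert (subset_insert 0 _)
  have hp' := conj_mem_poleSet hp
  rw [union_sdiff_distrib, nhdsWithin_union]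
  refine .sup ?_ ?_
  · refine (h.isFactorOn_OmegaM t x).boundedAlong_mul
      (hM.cont_OmegaM.mono (union_subset_union_left _ hcorner)) (fun z hz => ?_)
      (fun _ => hM.boundedAlong_of_mem_cornerSet h ?_)
      (fun hS => mem_zerosA_of_mem_poleSet hp' (OmegaM_eq.subset hS))
    · simpa only [transvection_one_zero, Complex.conj_conj] using hM.pole_a_conj _ hz
    · exact fun k hk => compl_contour_eq.superset (.inl (.inr hk))
  · refine (h.isFactorOn_DM t hx).boundedAlong_mul hM.cont_DM (fun z hz => ?_)
      (fun _ => hM.boundedAlong_of_mem_cornerSet h ?_)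
      (fun hS => mem_zerosB_of_mem_poleSet hp' (DM_eq.subset hS))
    · simpa only [transvection_zero_one, Complex.conj_conj] using hM.pole_b_conj _ hz
    · exact fun k hk => compl_contour_eq.superset (.inr (.inr hk))

theorem boundedAlong_mul_factorG (hM : IsRHSolution a b t x M) (h : IsSpectralPair a b)
    (hx : 0 < x) (hp : p ∈ poleSet a b) :
    BoundedAlong (fun k => M k * factorG (refl a b) t x k) (𝓝[regularSet a b] p) := by
  refine ((hM.boundedAlong_mul_factorG_upper h hx hp).sup
    (hM.boundedAlong_mul_factorG_lower h hx hp)).mono ?_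
  rw [← nhdsWithin_union, ← union_sdiff_distrib, regularSet_eq]
  refine nhdsWithin_mono p fun k hk => ⟨?_, fun hkp => hk (.inr (hkp ▸ hp))⟩
  exact union_union_union_comm .. ▸ compl_contour_eq.subset fun hkc => hk (.inl hkc)

theorem tendsto_cobounded (hM : IsRHSolution a b t x M) :
    Tendsto M (Bornology.cobounded ℂ ⊓ 𝓟 (regularSet a b)) (𝓝 1) :=
  tendsto_pi_nhds.2 fun i => tendsto_pi_nhds.2 fun j => tendsto_sub_nhds_zero_iff.1
    ((hM.normalization i j).trans_tendsto (tendsto_inv₀_cobounded.mono_left inf_le_left))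

theorem mul_factorG (hM : IsRHSolution a b t x M) (h : IsSpectralPair a b) (hx : 0 < x)
    (htx : t ≤ x) {k : ℂ} (hk : k ∈ regularSet a b) : M k * factorG (refl a b) t x k = 1 := by
  ext i j
  have hinf : Tendsto (fun k => M k * factorG (refl a b) t x k)
      (Bornology.cobounded ℂ ⊓ 𝓟 (regularSet a b)) (𝓝 1) := by
    simpa using hM.tendsto_cobounded.mul ((h.tendsto_factorG_cobounded hx htx).mono_left
      (inf_le_inf_left _ (principal_mono.2 (regularSet_subset_compl_contour a b))))
  have hdiff : DifferentiableOn ℂ (fun k => (M k * factorG (refl a b) t x k) i j)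
      (regularSet a b) := by
    simp only [Matrix.mul_apply, Fin.sum_univ_two]
    exact ((hM.analytic i 0).mul (h.differentiableOn_factorG t hx 0 j)).add
      ((hM.analytic i 1).mul (h.differentiableOn_factorG t hx 1 j))
  have hlim : ∀ p ∈ contour \ poleSet a b, ∃ L, Tendsto
      (fun k => (M k * factorG (refl a b) t x k) i j) (𝓝[regularSet a b] p) (𝓝 L) :=
    fun p hp => by
      obtain ⟨L, hL⟩ := hM.exists_tendsto_mul_factorG h hx hp
      exact ⟨L i j, tendsto_pi_nhds.1 (tendsto_pi_nhds.1 (hL.mono_left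
        (nhdsWithin_mono p (regularSet_subset_compl_contour a b))) i) j⟩
  have hbdd := fun p hp => hM.boundedAlong_mul_factorG h hx (p := p) hp i j
  simp only [regularSet_eq] at hk hinf hdiff hlim hbdd
  exact eq_const_of_removable_contour h.compl_poleSet_mem_codiscrete hdiff hlim hbdd
    (tendsto_pi_nhds.1 (tendsto_pi_nhds.1 hinf i) j) k hk

theorem eq_inv_factorG (hM : IsRHSolution a b t x M) (h : IsSpectralPair a b) (hx : 0 < x)
    (htx : t ≤ x) {k : ℂ} (hk : k ∈ regularSet a b) : M k = (factorG (refl a b) t x k)⁻¹ :=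
  (Matrix.inv_eq_left_inv (hM.mul_factorG h hx htx hk)).symm

end IsRHSolution

theorem IsSpectralPair.isRHSolution_inv {a b : ℂ → ℂ} {t x : ℝ} (h : IsSpectralPair a b)
    (hx : 0 < x) (htx : t ≤ x)
    (hr : refl a b =O[Bornology.cobounded ℂ ⊓ 𝓟 {k | 0 ≤ k.im}] fun k => k⁻¹) :
    IsRHSolution a b t x fun k => (factorG (refl a b) t x k)⁻¹ where
  analytic := h.differentiableOn_inv_factorG t hx
  cont_OmegaP := (h.isFactorOn_OmegaP t x).inv.continuousUpTo fun h0 =>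
    absurd h0 zero_notMem_closure_OmegaP
  cont_OmegaM := (h.isFactorOn_OmegaM t x).inv.continuousUpTo fun h0 =>
    absurd h0 zero_notMem_closure_OmegaM
  cont_DP := (h.isFactorOn_DP t hx).inv.continuousUpTo fun _ => .inr (.inl rfl)
  cont_DM := (h.isFactorOn_DM t hx).inv.continuousUpTo fun _ => .inr (.inl rfl)
  pole_a z hz := by
    simpa only [transvection_zero_one] using (h.isFactorOn_OmegaP t x).boundedAlong_inv_mul hz
  pole_a_conj z hz := by
    simpa only [transvection_one_zero, Complex.conj_conj] using
      (h.isFactorOn_OmegaM t x).boundedAlong_inv_mul (z := starRingEnd ℂ z) (by simpa using hz)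
  pole_b z hz := by
    simpa only [transvection_one_zero] using (h.isFactorOn_DP t hx).boundedAlong_inv_mul hz
  pole_b_conj z hz := by
    simpa only [transvection_zero_one, Complex.conj_conj] using
      (h.isFactorOn_DM t hx).boundedAlong_inv_mul (z := starRingEnd ℂ z) (by simpa using hz)
  jump_outer s hs := (h.removesJump_outer t x (Complex.ofReal_im s) (fun h0 => by
    rw [Complex.ofReal_eq_zero.1 h0, abs_zero] at hs; norm_num at hs)).hasJump_inv
  jump_inner s hs _ := (h.removesJump_inner t hx (Complex.ofReal_im s)
    (Complex.ofReal_ne_zero.2 hs)).hasJump_inv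
  jump_up k hk _ hka hkb := (h.removesJump_up t hx (fun h0 => hk.ne' (by simp [h0])) hka
    hkb).hasJump_inv
  jump_down k hk _ hka hkb := (h.removesJump_down t hx (fun h0 => hk.ne (by simp [h0])) hka
    hkb).hasJump_inv
  bounded p hp := by
    have him : p.im = 0 := im_eq_zero_of_mem_cornerSet hp
    have him' : (starRingEnd ℂ p).im = 0 := by simp [him]
    refine BoundedAlong.mono ?_ (nhdsWithin_mono p (regularSet_subset_compl_contour a b))
    rw [nhdsWithin_compl_contour]
    exact (((h.isFactorOn_OmegaP t x).inv.boundedAlong fun hz => hz.1.ne' him).sup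
      ((h.isFactorOn_OmegaM t x).inv.boundedAlong fun hz => hz.1.ne' him')).sup
      (((h.isFactorOn_DP t hx).inv.boundedAlong fun hz => hz.1.ne' him).sup
      ((h.isFactorOn_DM t hx).inv.boundedAlong fun hz => hz.1.ne' him'))
  normalization i j := (h.isBigO_inv_factorG_sub_one hx htx hr i j).mono
    (inf_le_inf_left _ (principal_mono.2 (regularSet_subset_compl_contour a b)))

/-! ### The reconstructed field and medium -/

section Decay

variable {t x : ℝ}

theorem tendsto_mul_eMinus {f : ℂ → ℂ} (hx : 0 ≤ x) (htx : t ≤ x) {l : Filter ℂ}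
    (hl : l ≤ Bornology.cobounded ℂ ⊓ 𝓟 {k | 0 ≤ k.im}) (hf : Tendsto f l (𝓝 0)) :
    Tendsto (fun k => f k * eMinus t x k) l (𝓝 0) :=
  ((isBigO_refl f l).mul (((isBigO_eMinus_cobounded hx htx).mono hl).trans
    (isBigO_const_const (1 : ℝ) (one_ne_zero (α := ℂ)) l))).trans_tendsto (by simpa using hf)

theorem tendsto_mul_eMinus_sector (hx : 0 ≤ x) (htx : t < x) {c : ℝ} (hc : 0 < c) :
    Tendsto (fun k => k * eMinus t x k)
      (Bornology.cobounded ℂ ⊓ 𝓟 {k | c * ‖k‖ ≤ k.im}) (𝓝 0) := by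
  have hδ : 0 < 2 * (x - t) * c := mul_pos (mul_pos two_pos (sub_pos.2 htx)) hc
  have hdecay := ((((isLittleO_pow_exp_pos_mul_atTop 1 hδ).tendsto_div_nhds_zero).comp
    (tendsto_norm_cobounded_atTop (E := ℂ))).const_mul (Real.exp x))
  rw [mul_zero] at hdecay
  refine squeeze_zero_norm' (eventually_inf_principal.2 ?_) (hdecay.mono_left inf_le_left)
  filter_upwards [(tendsto_norm_cobounded_atTop (E := ℂ)).eventually_ge_atTop (1 / 2)]
    with k hk hkc
  have hexp : -(2 * (x - t) * k.im) ≤ -(2 * (x - t) * c * ‖k‖) := by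
    rw [mul_assoc _ c]
    gcongr
  calc ‖k * eMinus t x k‖
      ≤ ‖k‖ * (Real.exp x * Real.exp (-(2 * (x - t) * k.im))) := by
        rw [norm_mul]
        gcongr
        exact norm_eMinus_le hx hk
    _ ≤ ‖k‖ * (Real.exp x * Real.exp (-(2 * (x - t) * c * ‖k‖))) := by gcongr
    _ = Real.exp x * (‖k‖ ^ 1 / Real.exp (2 * (x - t) * c * ‖k‖)) := by
        rw [Real.exp_neg]
        ring

theorem tendsto_ePlus_I_mul (t : ℝ) (hx : 0 < x) :
    Tendsto (fun y : ℝ => ePlus t x (Complex.I * y)) (𝓝[>] 0) (𝓝 0) := by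
  have hlin : Tendsto (fun y : ℝ => 2 * (x - t) * y) (𝓝[>] 0) (𝓝 0) := by
    simpa using ((tendsto_id (α := ℝ) (x := 𝓝 0)).const_mul (2 * (x - t))).mono_left
      nhdsWithin_le_nhds
  have hexp : Tendsto (fun y : ℝ => 2 * (x - t) * y + -(x / 2 * y⁻¹)) (𝓝[>] 0) atBot :=
    hlin.add_atBot (tendsto_neg_atTop_atBot.comp
      (tendsto_inv_nhdsGT_zero.const_mul_atTop (half_pos hx)))
  refine tendsto_zero_iff_norm_tendsto_zero.2 ((Real.tendsto_exp_atBot.comp hexp).congr' ?_)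
  filter_upwards [self_mem_nhdsWithin] with y hy
  have hy0 : y ≠ 0 := ne_of_gt hy
  rw [Function.comp, norm_ePlus]
  congr 1
  simp only [Complex.mul_im, Complex.I_re, Complex.ofReal_im, mul_zero, Complex.I_im,
    Complex.ofReal_re, one_mul, zero_add, Complex.norm_mul, Complex.norm_I, Complex.norm_real,
    Real.norm_eq_abs, sq_abs]
  field_simp
  ring

theorem tendsto_I_mul_nhdsGT : Tendsto (fun y : ℝ => Complex.I * y) (𝓝[>] 0) (𝓝[DP] 0) := by
  refine tendsto_nhdsWithin_iff.2 ⟨?_, ?_⟩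
  · have hcont : Continuous fun y : ℝ => Complex.I * y := by fun_prop
    simpa using (hcont.tendsto 0).mono_left nhdsWithin_le_nhds
  · filter_upwards [Ioo_mem_nhdsGT (by norm_num : (0 : ℝ) < 1 / 2)] with y hy
    exact ⟨by simpa using hy.1, by simpa [abs_of_pos hy.1] using hy.2⟩

theorem eventually_sector_subset_compl_contour {c : ℝ} (hc : 0 < c) :
    ∀ᶠ k in Bornology.cobounded ℂ, k ∈ {k : ℂ | c * ‖k‖ ≤ |k.im|} → k ∈ contourᶜ := by
  filter_upwards [(tendsto_norm_cobounded_atTop (E := ℂ)).eventually_gt_atTop (1 / 2)]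
    with k hk hkc
  rintro (him | hnorm)
  · have hpos : 0 < c * ‖k‖ := mul_pos hc (one_half_pos.trans hk)
    exact hpos.not_ge (by simpa [him] using hkc)
  · exact hk.ne' hnorm

end Decay

namespace IsRHSolution

variable {a b : ℂ → ℂ} {t x : ℝ} {M : ℂ → Matrix (Fin 2) (Fin 2) ℂ}

theorem apply_zero_one_of_mem_OmegaP (hM : IsRHSolution a b t x M) (h : IsSpectralPair a b)
    (hx : 0 < x) (htx : t ≤ x) {k : ℂ} (hk : k ∈ regularSet a b) (hkΩ : k ∈ OmegaP) :
    M k 0 1 = refl a b k * eMinus t x k := by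
  rw [hM.eq_inv_factorG h hx htx hk, (h.isFactorOn_OmegaP t x).inv.eqOn k hkΩ,
    transvection_zero_one]
  simp

theorem apply_zero_one_of_mem_OmegaM (hM : IsRHSolution a b t x M) (h : IsSpectralPair a b)
    (hx : 0 < x) (htx : t ≤ x) {k : ℂ} (hk : k ∈ regularSet a b) (hkΩ : k ∈ OmegaM) :
    M k 0 1 = 0 := by
  rw [hM.eq_inv_factorG h hx htx hk, (h.isFactorOn_OmegaM t x).inv.eqOn k hkΩ,
    transvection_one_zero]
  simp

theorem tendsto_field (hM : IsRHSolution a b t x M) (h : IsSpectralPair a b) (hx : 0 < x)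
    (htx : t ≤ x) {S : Set ℂ} (hS : ∀ᶠ k in Bornology.cobounded ℂ, k ∈ S → k ∈ contourᶜ)
    (hlim : Tendsto (fun k => k * refl a b k * eMinus t x k)
      (Bornology.cobounded ℂ ⊓ 𝓟 (S ∩ {k | 0 ≤ k.im})) (𝓝 0)) :
    Tendsto (fun k => -(4 * Complex.I * k * M k 0 1)) (Bornology.cobounded ℂ ⊓ 𝓟 S) (𝓝 0) := by
  have hSc : Bornology.cobounded ℂ ⊓ 𝓟 S ≤ Bornology.cobounded ℂ ⊓ 𝓟 contourᶜ :=
    le_inf inf_le_left (le_principal_iff.2 (eventually_inf_principal.2 hS))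
  have hreg : ∀ᶠ k in Bornology.cobounded ℂ ⊓ 𝓟 S, k ∈ regularSet a b :=
    (hSc.trans h.cobounded_inf_compl_contour_le_regularSet)
      (mem_inf_of_right (mem_principal_self _))
  have hΩ : ∀ᶠ k in Bornology.cobounded ℂ ⊓ 𝓟 S, k ∈ OmegaP ∪ OmegaM :=
    (hSc.trans cobounded_inf_compl_contour_le) (by
      rw [← inf_sup_left, sup_principal]; exact mem_inf_of_right (mem_principal_self _))
  have hif : Tendsto (fun k => if 0 ≤ k.im then k * refl a b k * eMinus t x k else 0)
      (Bornology.cobounded ℂ ⊓ 𝓟 S) (𝓝 0) :=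
    .if (by rwa [inf_assoc, inf_principal]) tendsto_const_nhds
  have hlim' := hif.const_mul (-(4 * Complex.I))
  rw [mul_zero] at hlim'
  refine hlim'.congr' ?_
  filter_upwards [hreg, hΩ] with k hk hkΩ
  rcases hkΩ with hkΩ | hkΩ
  · rw [hM.apply_zero_one_of_mem_OmegaP h hx htx hk hkΩ, if_pos hkΩ.1.le]
    ring
  · rw [hM.apply_zero_one_of_mem_OmegaM h hx htx hk hkΩ, if_neg (not_le.2 hkΩ.1)]
    ring

theorem hasField_of_lt (hM : IsRHSolution a b t x M) (h : IsSpectralPair a b) (hx : 0 < x)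
    (htx : t < x) : HasField M 0 := fun c hc => by
  rw [univ_inter]
  refine hM.tendsto_field h hx htx.le (eventually_sector_subset_compl_contour hc) ?_
  have hle : Bornology.cobounded ℂ ⊓ 𝓟 ({k : ℂ | c * ‖k‖ ≤ |k.im|} ∩ {k | 0 ≤ k.im}) ≤
      Bornology.cobounded ℂ ⊓ 𝓟 {k | c * ‖k‖ ≤ k.im} :=
    inf_le_inf_left _ (principal_mono.2 fun k (hk : c * ‖k‖ ≤ |k.im| ∧ 0 ≤ k.im) =>
      mem_ofPred.2 (hk.1.trans_eq (abs_of_nonneg hk.2)))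
  have hrefl := h.tendsto_refl.mono_left
    (inf_le_inf_left (Bornology.cobounded ℂ) (principal_mono.2 (inter_subset_right
      (s := {k : ℂ | c * ‖k‖ ≤ |k.im|}))))
  simpa [mul_right_comm] using ((tendsto_mul_eMinus_sector hx.le htx hc).mono_left hle).mul hrefl

theorem hasField_of_tendstoSector (hM : IsRHSolution a b t x M) (h : IsSpectralPair a b)
    (hx : 0 < x) (htx : t ≤ x) (hr : TendstoSector (fun k => k * refl a b k) {k | 0 ≤ k.im} 0) :
    HasField M 0 := fun c hc => by
  rw [univ_inter]
  refine hM.tendsto_field h hx htx (eventually_sector_subset_compl_contour hc) ?_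
  rw [inter_comm]
  exact tendsto_mul_eMinus hx.le htx
    (inf_le_inf_left _ (principal_mono.2 inter_subset_left)) (hr c hc)

theorem hasFieldUnrestricted (hM : IsRHSolution a b t x M) (h : IsSpectralPair a b) (hx : 0 < x)
    (htx : t ≤ x)
    (hr : Tendsto (fun k => k * refl a b k) (Bornology.cobounded ℂ ⊓ 𝓟 {k | 0 ≤ k.im}) (𝓝 0)) :
    HasFieldUnrestricted M 0 := by
  have hle : Bornology.cobounded ℂ ⊓ 𝓟 (contourᶜ ∩ {k | 0 ≤ k.im}) ≤
      Bornology.cobounded ℂ ⊓ 𝓟 {k | 0 ≤ k.im} :=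
    inf_le_inf_left _ (principal_mono.2 inter_subset_right)
  exact hM.tendsto_field h hx htx (.of_forall fun _ hk => hk)
    (tendsto_mul_eMinus hx.le htx hle (hr.mono_left hle))

theorem hasValueAtZero (hM : IsRHSolution a b t x M) (h : IsSpectralPair a b) (hx : 0 < x)
    (htx : t ≤ x) : HasValueAtZero M 1 := by
  have hDP : DP ⊆ {k | 0 ≤ k.im} := fun k hk => hk.1.le
  have hb0 : b 0 ≠ 0 := by simpa using h.b_ne_zero 0 (by norm_num)
  have hquot := (((h.continuousOn_a 0 (by simp)).mono hDP).div
    ((h.continuousOn_b 0 (by simp)).mono hDP) hb0).tendsto.comp tendsto_I_mul_nhdsGT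
  have hentry := hquot.mul (tendsto_ePlus_I_mul t hx)
  rw [mul_zero] at hentry
  have hlim := ((continuous_transvection (1 : Fin 2) 0).tendsto 0).comp hentry
  rw [Matrix.transvection_zero] at hlim
  refine hlim.congr' ?_
  have hreg : ∀ᶠ k in 𝓝[DP] (0 : ℂ), k ∈ regularSet a b :=
    ((nhdsWithin_mono 0 fun k hk => compl_contour_eq.superset (.inr (.inl hk))).trans
      (h.nhdsWithin_compl_contour_le_regularSet (.inl Complex.zero_im))) self_mem_nhdsWithin
  filter_upwards [tendsto_I_mul_nhdsGT.eventually (hreg.and self_mem_nhdsWithin)] with y hy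
  rw [hM.eq_inv_factorG h hx htx hy.1, (h.isFactorOn_DP t hx).inv.eqOn _ hy.2]
  simp [refl]

end IsRHSolution

theorem hasMedium_of_hasValueAtZero_one {M : ℂ → Matrix (Fin 2) (Fin 2) ℂ}
    (hM : HasValueAtZero M 1) : HasMedium M 1 0 :=
  ⟨1, hM, by simp, by simp [sigma3]⟩

theorem isSpectralPair_spec {E : ℝ → ℂ} (hE : IntegrableOn E (Ioi 0))
    (ha : ∀ s : ℝ, 1 / 2 ≤ |s| → specA E s ≠ 0) (hb : ∀ s : ℝ, |s| ≤ 1 / 2 → specB E s ≠ 0) :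
    IsSpectralPair (specA E) (specB E) :=
  ⟨continuousOn_specA hE, continuousOn_specB hE, differentiableOn_specA hE,
    differentiableOn_specB hE, tendsto_specA hE, tendsto_specB hE, ha, hb⟩

theorem integrableOn_of_moment {E : ℝ → ℂ} (hloc : LocallyIntegrableOn E (Ici 0))
    (hmoment : IntegrableOn (fun t : ℝ => (1 + t) * ‖E t‖) (Ioi 0)) :
    IntegrableOn E (Ioi 0) := by
  refine Integrable.mono hmoment
    (hloc.aestronglyMeasurable.mono_measure (Measure.restrict_mono Ioi_subset_Ici_self le_rfl)) ?_
  filter_upwards [self_mem_ae_restrict measurableSet_Ioi] with s hs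
  rw [norm_mul, norm_norm, Real.norm_of_nonneg (add_pos one_pos hs).le]
  exact le_mul_of_one_le_left (norm_nonneg _) (le_add_of_nonneg_right (le_of_lt hs))

end MaxwellBloch

theorem theorem3p2_general (E₁ : ℝ → ℂ) (hE : IntegrableOn E₁ (Set.Ioi 0)) (a b r : ℂ → ℂ)
    (ha : a = MaxwellBloch.specA E₁) (hb : b = MaxwellBloch.specB E₁)
    (hr : r = MaxwellBloch.refl a b)
    (ha0 : ∀ s : ℝ, 1 / 2 ≤ |s| → a s ≠ 0)
    (hb0 : ∀ s : ℝ, |s| ≤ 1 / 2 → b s ≠ 0)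
    (t x : ℝ) (hx : 0 < x) (htx : t ≤ x) :
    (r =O[Bornology.cobounded ℂ ⊓ 𝓟 {k | 0 ≤ k.im}] (fun k => k⁻¹) →
      ∃ M, MaxwellBloch.IsRHSolution a b t x M) ∧
    ∀ M, MaxwellBloch.IsRHSolution a b t x M →
      (∀ k ∈ MaxwellBloch.regularSet a b, M k * MaxwellBloch.factorG r t x k = 1) ∧
      (t < x → MaxwellBloch.HasField M 0) ∧
      (MaxwellBloch.TendstoSector (fun k => k * r k) {k | 0 ≤ k.im} 0 →
        MaxwellBloch.HasField M 0) ∧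
      (Tendsto (fun k => k * r k) (Bornology.cobounded ℂ ⊓ 𝓟 {k | 0 ≤ k.im}) (𝓝 0) →
        MaxwellBloch.HasFieldUnrestricted M 0) ∧
      MaxwellBloch.HasValueAtZero M 1 ∧
      MaxwellBloch.HasMedium M 1 0 := by
  subst ha hb hr
  have h := MaxwellBloch.isSpectralPair_spec hE ha0 hb0
  refine ⟨fun hO => ⟨_, h.isRHSolution_inv hx htx hO⟩, fun M hM => ?_⟩
  have h0 := hM.hasValueAtZero h hx htx
  exact ⟨fun k hk => hM.mul_factorG h hx htx hk, hM.hasField_of_lt h hx,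
    hM.hasField_of_tendstoSector h hx htx, hM.hasFieldUnrestricted h hx htx, h0,
    MaxwellBloch.hasMedium_of_hasValueAtZero_one h0⟩

theorem theorem3p2 (E₁ : ℝ → ℂ)
    (hloc : LocallyIntegrableOn E₁ (Set.Ici 0))
    (hmoment : IntegrableOn (fun t : ℝ => (1 + t) * ‖E₁ t‖) (Set.Ioi 0))
    (hne : ¬ E₁ =ᵐ[volume.restrict (Set.Ioi 0)] 0)
    (a b r : ℂ → ℂ)
    (ha : a = MaxwellBloch.specA E₁) (hb : b = MaxwellBloch.specB E₁)
    (hr : r = MaxwellBloch.refl a b)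
    -- `r` is finite on the real contour outside the circle, `1 / r` is finite inside it
    (ha0 : ∀ s : ℝ, 1 / 2 ≤ |s| → a s ≠ 0)
    (hb0 : ∀ s : ℝ, |s| ≤ 1 / 2 → b s ≠ 0)
    (t x : ℝ) (ht : 0 ≤ t) (hx : 0 < x) (htx : t ≤ x) :
    -- existence, as soon as `r = O(1/k)` in the closed upper half-plane
    (r =O[Bornology.cobounded ℂ ⊓ 𝓟 {k | 0 ≤ k.im}] (fun k => k⁻¹) →
      ∃ M, MaxwellBloch.IsRHSolution a b t x M) ∧
    -- uniqueness and triviality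
    ∀ M, MaxwellBloch.IsRHSolution a b t x M →
      (∀ k ∈ MaxwellBloch.regularSet a b, M k * MaxwellBloch.factorG r t x k = 1) ∧
      -- the reconstructed field and medium are trivial
      (t < x → MaxwellBloch.HasField M 0) ∧
      (MaxwellBloch.TendstoSector (fun k => k * r k) {k | 0 ≤ k.im} 0 →
        MaxwellBloch.HasField M 0) ∧
      (Tendsto (fun k => k * r k) (Bornology.cobounded ℂ ⊓ 𝓟 {k | 0 ≤ k.im}) (𝓝 0) →
        MaxwellBloch.HasFieldUnrestricted M 0) ∧
      MaxwellBloch.HasValueAtZero M 1 ∧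
      MaxwellBloch.HasMedium M 1 0 := by
  exact theorem3p2_general E₁ (MaxwellBloch.integrableOn_of_moment hloc hmoment) a b r ha hb hr
    ha0 hb0 t x hx htx
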